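/- **Setting.** Let $n\ge 2$, let $U\subset\mathbb R^n$ be open and bounded with $C^1$ boundary $\Gamma=\partial U$, with surface measure $\sigma$. Let $g(s)=\sum_{i=0}^N a_i s^{\alpha_i}$ for $s\ge 0$, where $N\ge1$, $0=\alpha_0<\alpha_1<\dots<\alpha_N$ are real and $a_0,\dots,a_N>0$. Put $a=\alpha_N/(\alpha_N+1)\in(0,1)$ and $K(\xi)=1/g(s(\xi))$ for $\xi\ge 0$, where $s=s(\xi)\ge0$ is the unique non-negative solution of $s\,g(s)=\xi$. Let $\lambda\in(0,1]$, $\delta=1-\lambda$, and assume $a>\delta$. Set $$\mu_0=\frac{a-\delta}{1-a},\qquad \alpha_*=\frac{n(a-\delta)}{2-a},$$ let $\alpha\ge 2-\delta$ with $\alpha>n\mu_0$, and set $$\theta=\frac1{(1-a)(\alpha/\alpha_*-1)}\in(0,1),\qquad \mu_1=\frac{\mu_0(1+\theta(1-a))}{1-\theta},\qquad q=\frac{2-a}{(1-a)(1-\theta)}.$$ For $T>0$, consider non-negative weak solutions $u$ on $U\times(0,T]$ of $$\frac{\partial (u^\lambda)}{\partial t}=\nabla\cdot(K(|\nabla u|)\nabla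 u)\ \text{ in } U,\qquad u(\cdot,0)=u_0\ \text{ in } U,\qquad K(|\nabla u|)\frac{\partial u}{\partial\vec\nu}+\varphi u^\lambda=0\ \text{ on }\Gamma .$$ That is: $u\ge0$, $u\in C([0,T];L^\alpha(U))$, $u(0)=u_0$; for every $\varepsilon>0$, $\nabla u\in L^{2-a}(U\times(\varepsilon,T))$ and $\varphi u^\lambda\in L^1(\Gamma\times(\varepsilon,T))$ (boundary values in the sense of traces); and for all $0<s<t\le T$ and all $\zeta\in C^1(\mathbb R^n)$, $$\int_U u^\lambda(x,t)\zeta\,dx-\int_U u^\lambda(x,s)\zeta\,dx=-\int_s^t\!\int_U K(|\nabla u|)\nabla u\cdot\nabla\zeta\,dx\,d\tau-\int_s^t\!\int_\Gamma\varphi u^\lambda\zeta\,d\sigma\,d\tau .$$ Write $\varphi^-=\max\{-\varphi,0\}$. **Theorem.** There are constants $C_2>0$, $C_3=C_2\mu_1/\alpha>0$ and $C>0$, depending only on $\alpha,\lambda,g,n,U$, such that for every $T>0$, every measurable $\varphi$ on $\Gamma\times(0,T)$, every $u_0$ and every such solution $u$ the following holds. (i) If $$\int_0^T\Big(1+\|\varphi^-(t)\|_{L^\infty(\Gamma)}^{q}\Big)dt<\frac1{C_3}\Big(1+\int_U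 u_0^\alpha\,dx\Big)^{-\mu_1/\alpha},$$ then for all $t\in(0,T]$ $$\int_U u^\alpha(x,t)\,dx\le\Big\{\Big(1+\int_U u_0^\alpha\,dx\Big)^{-\mu_1/\alpha}-C_3\int_0^t\Big(1+\|\varphi^-(\tau)\|_{L^\infty(\Gamma)}^{q}\Big)d\tau\Big\}^{-\alpha/\mu_1}.$$ (ii) If $$\int_0^T\Big(1+\|\varphi^-(t)\|_{L^\infty(\Gamma)}^{q}\Big)dt\le\frac{1-2^{-\mu_1/\alpha}}{C_3}\Big(1+\int_U u_0^\alpha\,dx\Big)^{-\mu_1/\alpha},$$ then $$\int_U u^\alpha(x,t)\,dx\le 2\Big(1+\int_U u_0^\alpha\,dx\Big)\quad\text{for all }t\in(0,T],$$ $$\int_0^T\!\int_U u^{\alpha+\delta-2}|\nabla u|^{2-a}\,dx\,dt\le C\Big(1+\int_U u_0^\alpha\,dx\Big).$$ -/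

import Mathlib

open MeasureTheory Set Filter Topology
open scoped ENNReal ContDiff

noncomputable section

namespace Forchheimer

/-- The space `ℝⁿ` with its Euclidean norm. -/
abbrev E (n : ℕ) : Type := EuclideanSpace ℝ (Fin n)

/-! ### The generalized polynomial `g` and the function `K` -/

/-- The data of a generalized polynomial `g(s) = a₀ s^{α₀} + a₁ s^{α₁} + ⋯ + a_N s^{α_N}` with
`N ≥ 1`, real exponents `0 = α₀ < α₁ < ⋯ < α_N` and positive coefficients. -/
structure GenPoly where
  N : ℕ
  one_le_N : 1 ≤ N
  expo : Fin (N + 1) → ℝ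
  coef : Fin (N + 1) → ℝ
  expo_zero : expo 0 = 0
  expo_strictMono : StrictMono expo
  coef_pos : ∀ i, 0 < coef i

namespace GenPoly

variable (g : GenPoly)

/-- The value `g(s)`, for `s ≥ 0`. -/
def eval (s : ℝ) : ℝ := ∑ i, g.coef i * s ^ g.expo i

/-- The exponent `a = α_N / (α_N + 1)`. -/
def a : ℝ := g.expo (Fin.last g.N) / (g.expo (Fin.last g.N) + 1)

lemma expo_nonneg (i : Fin (g.N + 1)) : 0 ≤ g.expo i := by
  rw [← g.expo_zero]
  exact g.expo_strictMono.monotone (Fin.zero_le i)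

lemma coef_zero_le_eval {s : ℝ} (hs : 0 ≤ s) : g.coef 0 ≤ g.eval s := by
  have h := Finset.single_le_sum (f := fun i => g.coef i * s ^ g.expo i)
    (fun i _ => mul_nonneg (g.coef_pos i).le (Real.rpow_nonneg hs _)) (Finset.mem_univ 0)
  simpa [g.expo_zero, eval] using h

lemma eval_mono {s t : ℝ} (hs : 0 ≤ s) (hst : s ≤ t) : g.eval s ≤ g.eval t :=
  Finset.sum_le_sum fun i _ =>
    mul_le_mul_of_nonneg_left (Real.rpow_le_rpow hs hst (g.expo_nonneg i)) (g.coef_pos i).le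

lemma continuous_eval : Continuous g.eval :=
  continuous_finsetSum _ fun i _ =>
    continuous_const.mul (Real.continuous_rpow_const (g.expo_nonneg i))

/-- For every `ξ ≥ 0` the equation `s g(s) = ξ` has exactly one solution `s ≥ 0`. -/
lemma existsUnique_mul_eval {ξ : ℝ} (hξ : 0 ≤ ξ) : ∃! s : ℝ, 0 ≤ s ∧ s * g.eval s = ξ := by
  have h0 := g.coef_pos 0
  have hb : (0 : ℝ) ≤ ξ / g.coef 0 := div_nonneg hξ h0.le
  have hub : ξ ≤ ξ / g.coef 0 * g.eval (ξ / g.coef 0) := by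
    calc ξ = ξ / g.coef 0 * g.coef 0 := by field_simp
      _ ≤ _ := mul_le_mul_of_nonneg_left (g.coef_zero_le_eval hb) hb
  obtain ⟨s, hs, hse⟩ := intermediate_value_Icc hb
    (f := fun s => s * g.eval s) (continuous_id.mul g.continuous_eval).continuousOn
    ⟨by simpa using hξ, hub⟩
  have key : ∀ x y : ℝ, 0 ≤ x → x < y → x * g.eval x < y * g.eval y := by
    intro x y hx hxy
    have hy : 0 < g.eval y := h0.trans_le (g.coef_zero_le_eval (hx.trans hxy.le))
    exact (mul_le_mul_of_nonneg_left (g.eval_mono hx hxy.le) hx).trans_lt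
      (mul_lt_mul_of_pos_right hxy hy)
  refine ⟨s, ⟨hs.1, hse⟩, ?_⟩
  rintro y ⟨hy, hye⟩
  simp only at hse
  rcases lt_trichotomy y s with h | h | h
  · have := key y s hy h
    linarith
  · exact h
  · have := key s y hs.1 h
    linarith

/-- `s(ξ)`: the unique non-negative solution of `s g(s) = ξ`, for `ξ ≥ 0`. -/
def sOf (ξ : ℝ) : ℝ := if h : 0 ≤ ξ then (g.existsUnique_mul_eval h).choose else 0

/-- `K(ξ) = 1 / g(s(ξ))`, for `ξ ≥ 0`. -/
def K (ξ : ℝ) : ℝ := 1 / g.eval (g.sOf ξ)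

end GenPoly

/-! ### The domain and its boundary -/

/-- `U` has `C¹` boundary: near each boundary point, in suitable orthogonal coordinates (the last
of which is along a unit vector `e`), `U` is the region above the graph of a `C¹` function `γ` of
the other coordinates, which are those of the orthogonal projection to the hyperplane `e^⊥`. -/
def HasC1Boundary {n : ℕ} (U : Set (E n)) : Prop :=
  ∀ x ∈ frontier U, ∃ r > 0, ∃ e : E n, ‖e‖ = 1 ∧
    ∃ γ : ((Submodule.span ℝ {e})ᗮ : Submodule ℝ (E n)) → ℝ, ContDiff ℝ 1 γ ∧
      ∀ y ∈ Metric.ball x r,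
        (y ∈ U ↔ γ ((Submodule.span ℝ {e})ᗮ.orthogonalProjectionOnto y) < inner ℝ e y)

/-- The surface measure `σ` on `Γ = ∂U`: the `(n-1)`-dimensional Hausdorff measure, normalized so
as to agree with Lebesgue measure on hyperplanes, restricted to `Γ`. -/
def surfaceMeasure {n : ℕ} (U : Set (E n)) : Measure (E n) :=
  (Measure.euclideanHausdorffMeasure (n - 1)).restrict (frontier U)

/-! ### Weak gradients and traces -/

/-- `G` is the weak gradient of `w` in `U`: both are locally integrable in `U` and
`∫_U w ∂_e ψ dx = - ∫_U (G · e) ψ dx` for all `ψ ∈ C_c^∞(U)` and all directions `e`. -/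
def IsWeakGradient {n : ℕ} (U : Set (E n)) (w : E n → ℝ) (G : E n → E n) : Prop :=
  LocallyIntegrableOn w U ∧ LocallyIntegrableOn G U ∧
    ∀ ψ : E n → ℝ, ContDiff ℝ ∞ ψ → HasCompactSupport ψ → tsupport ψ ⊆ U → ∀ e : E n,
      ∫ x in U, w x * fderiv ℝ ψ x e = - ∫ x in U, inner ℝ (G x) e * ψ x

/-- `h` is the trace on `Γ = ∂U` of the function `w ∈ W^{1,p}(U)` whose weak gradient is `G`:
there are functions `v_k`, continuously differentiable up to the boundary, with `v_k → w` in
`W^{1,p}(U)` and `v_k → h` in `L^p(Γ)`. -/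
def HasTrace {n : ℕ} (U : Set (E n)) (p : ℝ) (w : E n → ℝ) (G : E n → E n) (h : E n → ℝ) : Prop :=
  ∃ v : ℕ → E n → ℝ, (∀ k, ContDiff ℝ 1 (v k)) ∧
    Tendsto (fun k => eLpNorm (fun x => v k x - w x) (ENNReal.ofReal p) (volume.restrict U))
      atTop (𝓝 0) ∧
    Tendsto (fun k => eLpNorm (fun x => gradient (v k) x - G x) (ENNReal.ofReal p)
      (volume.restrict U)) atTop (𝓝 0) ∧
    Tendsto (fun k => eLpNorm (fun x => v k x - h x) (ENNReal.ofReal p) (surfaceMeasure U))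
      atTop (𝓝 0)

/-! ### Non-negative weak solutions -/

/-- `u ∈ C([0,T]; L^α(U))`. -/
def ContinuousInLp {n : ℕ} (U : Set (E n)) (α T : ℝ) (u : ℝ → E n → ℝ) : Prop :=
  (∀ t ∈ Icc 0 T, MemLp (u t) (ENNReal.ofReal α) (volume.restrict U)) ∧
  ∀ t ∈ Icc 0 T,
    Tendsto (fun s => eLpNorm (fun x => u s x - u t x) (ENNReal.ofReal α) (volume.restrict U))
      (𝓝[Icc 0 T] t) (𝓝 0)

/-- `u` is a non-negative weak solution on `U × (0,T]`, of class `C([0,T]; L^α(U))`, of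

* `∂(u^λ)/∂t = ∇ · (K(|∇u|) ∇u)` in `U × (0,T]`,
* `u(·,0) = u₀` in `U`,
* `K(|∇u|) ∂u/∂ν + φ u^λ = 0` on `Γ × (0,T]`.

`Du` is the spatial weak gradient of `u`, and `tr` is the trace of `u` on `Γ`; both are determined
by `u` up to null sets.  No bound near `t = 0` is required of `Du` or of `φ u^λ`. -/
structure IsWeakSolution {n : ℕ} (U : Set (E n)) (g : GenPoly) (lam α T : ℝ)
    (φ : ℝ → E n → ℝ) (u₀ : E n → ℝ)
    (u : ℝ → E n → ℝ) (Du : ℝ → E n → E n) (tr : ℝ → E n → ℝ) : Prop where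
  meas_u : AEStronglyMeasurable (Function.uncurry u)
    ((volume.restrict (Ioc 0 T)).prod (volume.restrict U))
  meas_Du : AEStronglyMeasurable (Function.uncurry Du)
    ((volume.restrict (Ioc 0 T)).prod (volume.restrict U))
  meas_tr : AEStronglyMeasurable (Function.uncurry tr)
    ((volume.restrict (Ioc 0 T)).prod (surfaceMeasure U))
  nonneg : ∀ t ∈ Icc 0 T, ∀ᵐ x ∂(volume.restrict U), 0 ≤ u t x
  continuousInLp : ContinuousInLp U α T u
  initial : u 0 =ᵐ[volume.restrict U] u₀
  weakGradient : ∀ᵐ t ∂(volume.restrict (Ioc 0 T)), IsWeakGradient U (u t) (Du t)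
  hasTrace : ∀ᵐ t ∂(volume.restrict (Ioc 0 T)), HasTrace U (2 - g.a) (u t) (Du t) (tr t)
  /-- `∇u ∈ L^{2-a}(U × (ε,T))` for every `ε > 0`. -/
  memLp_Du : ∀ ε > 0, MemLp (Function.uncurry Du) (ENNReal.ofReal (2 - g.a))
    ((volume.restrict (Ioc ε T)).prod (volume.restrict U))
  /-- `φ u^λ ∈ L¹(Γ × (ε,T))` for every `ε > 0`. -/
  integrable_flux : ∀ ε > 0, Integrable (fun z : ℝ × E n => φ z.1 z.2 * tr z.1 z.2 ^ lam)
    ((volume.restrict (Ioc ε T)).prod (surfaceMeasure U))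
  /-- The equation and the boundary condition, tested with `ζ ∈ C¹` and integrated in time. -/
  weak_form : ∀ s t : ℝ, 0 < s → s < t → t ≤ T → ∀ ζ : E n → ℝ, ContDiff ℝ 1 ζ →
    (∫ x in U, u t x ^ lam * ζ x) - (∫ x in U, u s x ^ lam * ζ x)
      = - (∫ τ in s..t, ∫ x in U, g.K ‖Du τ x‖ * inner ℝ (Du τ x) (gradient ζ x))
        - ∫ τ in s..t, ∫ x, φ τ x * tr τ x ^ lam * ζ x ∂(surfaceMeasure U)

/-! ### Exponents and the boundary data -/

section Exponents

/-- `δ = 1 - λ`. -/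
def delta (lam : ℝ) : ℝ := 1 - lam

/-- `α_* = n (a - δ) / (2 - a)`. -/
def alphaStar (n : ℕ) (a lam : ℝ) : ℝ := n * (a - delta lam) / (2 - a)

/-- `μ₀ = (a - δ) / (1 - a)`. -/
def mu0 (a lam : ℝ) : ℝ := (a - delta lam) / (1 - a)

/-- `θ = 1 / ((1 - a) (α / α_* - 1))`. -/
def theta (n : ℕ) (a lam α : ℝ) : ℝ := 1 / ((1 - a) * (α / alphaStar n a lam - 1))

/-- `μ₁ = μ₀ (1 + θ (1 - a)) / (1 - θ)`. -/
def mu1 (n : ℕ) (a lam α : ℝ) : ℝ :=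
  mu0 a lam * (1 + theta n a lam α * (1 - a)) / (1 - theta n a lam α)

/-- The exponent `(2 - a) / ((1 - a) (1 - θ))` of `‖φ⁻‖`. -/
def phiExp (n : ℕ) (a lam α : ℝ) : ℝ := (2 - a) / ((1 - a) * (1 - theta n a lam α))

end Exponents

/-- `∫₀ᵗ (1 + ‖φ⁻(τ)‖_{L^∞(Γ)}^q) dτ`, a value in `[0,∞]`. -/
def dataIntegral {n : ℕ} (U : Set (E n)) (φ : ℝ → E n → ℝ) (q t : ℝ) : ℝ≥0∞ :=
  ∫⁻ τ in Ioc 0 t, (1 + eLpNorm (fun x => max (-φ τ x) 0) ⊤ (surfaceMeasure U) ^ q)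

end Forchheimer

end

/-!
The equation is tested with powers of the solution, and the resulting growth inequality for
`Y(t) = ∫_U u(t)^α` is integrated.

*Energy inequality.* For a density `ρ ≥ 0`, testing formally with `∫₀^u ρ` gives
`d/dt ∫_U S(u) + ∫_U ρ(u) K(|∇u|)|∇u|² = -∫_Γ φ u^λ ∫₀^u ρ`, where `S = storage λ ρ` is convex as
a function of `u^λ`. As `u` has no time derivative, the weak form is taken on a short interval
`(τ - η, τ)` with the test function `∫₀^{u(τ)} ρ`, the increment of `S` is bounded by convexity, and
the result is integrated over `τ` and divided by `η`, before `η → 0` (`IsWeakSolution.energy_le`,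
for bounded `ρ` with bounded primitive). Monotone convergence extends it to all continuous `ρ ≥ 0`
(`IsWeakSolution.energy_lintegral_le`).

*The boundary term.* For `ρ = |z|^e` with `e = α - λ - 1`, the trace inequality in `W^{1,1}` bounds
`∫_Γ u^α` by `∫_U (u^α + u^{α-1}|∇u|)`. By Young's inequality, a small multiple of the dissipation
`∫_U u^e |∇u|^{2-a}` is split off, and `∫_U u^{λ(2-a)/(1-a)+e}` remains. By Hölder's inequality and
the Sobolev embedding of `u^{(2-a+e)/(2-a)}` it is at most a constant times
`(1 + Y)^{1-θ(1-(2-a)/n)} (1 + Y + dissipation)^θ`, and the choice of `θ` is what makes the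
exponents match (`theta_relation`). Since `θ < 1`, Young's inequality absorbs the dissipation
once more. To know that the dissipation to be absorbed is finite, all this is done for the
truncated densities `min(|z|, M)^e`, with constants independent of `M` (`exists_boundary_le`). In
the limit `M → ∞`, `Y(t) ≤ Y(s) + C ∫ₛᵗ (1 + ‖φ⁻‖^q)(1 + Y)^{1+μ₁/α}`, with a corresponding bound
of the dissipation (`exists_power_energy_le`).

*Conclusion.* `Y` is continuous on `[0, T]`, so `s → 0` is allowed, and `bihari` integrates the
inequality: `(1 + Y)^{-μ₁/α}` decreases at most at the rate `C₃(1 + ‖φ⁻‖^q)`.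

The trace and Sobolev inequalities on a bounded `C¹` domain are proved first: near a boundary point
`U` is a region above a graph, a cone of directions points into it, and values of a `C¹` function
are integrals of its gradient along these directions.
-/

noncomputable section

/-! ### The nonlinearity `K` -/

namespace Forchheimer.GenPoly

variable (g : GenPoly)

lemma eval_pos {s : ℝ} (hs : 0 ≤ s) : 0 < g.eval s :=
  (g.coef_pos 0).trans_le (g.coef_zero_le_eval hs)

lemma sOf_nonneg (ξ : ℝ) : 0 ≤ g.sOf ξ := by
  unfold sOf
  split_ifs with h
  · exact (g.existsUnique_mul_eval h).choose_spec.1.1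
  · exact le_rfl

lemma sOf_mul_eval {ξ : ℝ} (hξ : 0 ≤ ξ) : g.sOf ξ * g.eval (g.sOf ξ) = ξ := by
  unfold sOf
  rw [dif_pos hξ]
  exact (g.existsUnique_mul_eval hξ).choose_spec.1.2

lemma K_nonneg (ξ : ℝ) : 0 ≤ g.K ξ := one_div_nonneg.2 (g.eval_pos (g.sOf_nonneg ξ)).le

/-- `K(ξ) ξ = s(ξ)`: the flux has the size of the inverse function `s`. -/
lemma K_mul_self {ξ : ℝ} (hξ : 0 ≤ ξ) : g.K ξ * ξ = g.sOf ξ := by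
  have h := g.eval_pos (g.sOf_nonneg ξ)
  have h2 := g.sOf_mul_eval hξ
  rw [K, one_div, inv_mul_eq_div, div_eq_iff h.ne', h2]

lemma sOf_monotone : Monotone g.sOf := by
  intro x y hxy
  by_cases hx : 0 ≤ x
  · by_contra! hlt
    have h1 := g.sOf_mul_eval hx
    have h2 := g.sOf_mul_eval (hx.trans hxy)
    have h3 := g.eval_mono (g.sOf_nonneg y) hlt.le
    have h4 := g.eval_pos (g.sOf_nonneg y)
    have h5 := g.sOf_nonneg y
    nlinarith
  · rw [show g.sOf x = 0 by unfold sOf; rw [dif_neg hx]]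
    exact g.sOf_nonneg y

lemma measurable_K : Measurable g.K :=
  measurable_const.div (g.continuous_eval.measurable.comp g.sOf_monotone.measurable)

lemma expo_last_pos : 0 < g.expo (Fin.last g.N) := by
  rw [← g.expo_zero]
  apply g.expo_strictMono
  rw [Fin.lt_def]
  exact Nat.succ_le_iff.1 (by simpa using g.one_le_N)

lemma a_pos : 0 < g.a := div_pos g.expo_last_pos (by linarith [g.expo_last_pos])

lemma a_lt_one : g.a < 1 := by
  rw [a, div_lt_one (by linarith [g.expo_last_pos])]
  linarith

lemma one_sub_a : 1 - g.a = 1 / (g.expo (Fin.last g.N) + 1) := by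
  have := g.expo_last_pos
  rw [a]
  field_simp
  ring

lemma one_sub_a_mul : (g.expo (Fin.last g.N) + 1) * (1 - g.a) = 1 := by
  have := g.expo_last_pos
  rw [one_sub_a]
  field_simp

/-- Growth of the flux: `s(ξ) ≤ C ξ^{1-a}`. -/
lemma exists_sOf_le : ∃ C > 0, ∀ ξ, 0 ≤ ξ → g.sOf ξ ≤ C * ξ ^ (1 - g.a) := by
  set β := g.expo (Fin.last g.N) with hβ
  set c := g.coef (Fin.last g.N) with hc
  have hβ0 : 0 < β := g.expo_last_pos
  have hc0 : 0 < c := g.coef_pos _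
  have ha : 0 < 1 - g.a := by linarith [g.a_lt_one]
  refine ⟨(1 / c) ^ (1 - g.a), by positivity, fun ξ hξ => ?_⟩
  have hs := g.sOf_nonneg ξ
  set s := g.sOf ξ with hsdef
  have h1 : c * s ^ β ≤ g.eval s :=
    Finset.single_le_sum (f := fun i => g.coef i * s ^ g.expo i)
      (fun i _ => mul_nonneg (g.coef_pos i).le (Real.rpow_nonneg hs _)) (Finset.mem_univ _)
  have h2 : s ^ (β + 1) ≤ 1 / c * ξ := by
    rw [← g.sOf_mul_eval hξ, ← hsdef, Real.rpow_add_one' hs (by linarith)]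
    rw [one_div, inv_mul_eq_div, le_div_iff₀ hc0]
    nlinarith
  calc s = (s ^ (β + 1)) ^ (1 - g.a) := by
        rw [← Real.rpow_mul hs, hβ, one_sub_a_mul, Real.rpow_one]
    _ ≤ (1 / c * ξ) ^ (1 - g.a) := Real.rpow_le_rpow (Real.rpow_nonneg hs _) h2 ha.le
    _ = _ := Real.mul_rpow (by positivity) hξ

/-- Coercivity of the flux: `ξ^{2-a} ≤ C (K(ξ) ξ² + 1)`. -/
lemma exists_rpow_le_K : ∃ C > 0, ∀ ξ, 0 ≤ ξ → ξ ^ (2 - g.a) ≤ C * (g.K ξ * ξ ^ 2 + 1) := by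
  set β := g.expo (Fin.last g.N) with hβ
  set A := ∑ i, g.coef i with hA
  have hA0 : 0 < A := Finset.sum_pos (fun i _ => g.coef_pos i) Finset.univ_nonempty
  have ha : 0 < 1 - g.a := by linarith [g.a_lt_one]
  refine ⟨A ^ (1 - g.a) + A ^ (2 - g.a), by positivity, fun ξ hξ => ?_⟩
  have hs := g.sOf_nonneg ξ
  have hK : g.K ξ * ξ ^ 2 = g.sOf ξ * ξ := by rw [← g.K_mul_self hξ]; ring
  have hse := g.sOf_mul_eval hξ
  rw [hK]
  set s := g.sOf ξ with hsdef
  rcases le_total s 1 with h1 | h1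
  · have h2 : g.eval s ≤ A := by
      refine Finset.sum_le_sum fun i _ => ?_
      have := Real.rpow_le_one hs h1 (g.expo_nonneg i)
      nlinarith [g.coef_pos i]
    have h3 : ξ ≤ A := by nlinarith [g.eval_pos hs]
    have h4 : ξ ^ (2 - g.a) ≤ A ^ (2 - g.a) := Real.rpow_le_rpow hξ h3 (by linarith)
    have h5 : 0 < A ^ (1 - g.a) := by positivity
    have h6 : 0 < A ^ (2 - g.a) := by positivity
    nlinarith [mul_nonneg hs hξ, mul_nonneg (mul_nonneg hs hξ) h5.le,
      mul_nonneg (mul_nonneg hs hξ) h6.le]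
  · have h2 : g.eval s ≤ A * s ^ β := by
      rw [hA, Finset.sum_mul]
      refine Finset.sum_le_sum fun i _ => ?_
      exact mul_le_mul_of_nonneg_left (Real.rpow_le_rpow_of_exponent_le h1
        (g.expo_strictMono.monotone (Fin.le_last i))) (g.coef_pos i).le
    have h3 : ξ ≤ A * s ^ (β + 1) := by
      rw [← hse, Real.rpow_add_one' hs (by linarith [g.expo_last_pos])]
      nlinarith
    have h4 : ξ ^ (1 - g.a) ≤ A ^ (1 - g.a) * s := by
      calc ξ ^ (1 - g.a) ≤ (A * s ^ (β + 1)) ^ (1 - g.a) := Real.rpow_le_rpow hξ h3 ha.le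
        _ = A ^ (1 - g.a) * s := by
          rw [Real.mul_rpow hA0.le (Real.rpow_nonneg hs _), ← Real.rpow_mul hs, hβ,
            one_sub_a_mul, Real.rpow_one]
    have h5 : ξ ^ (2 - g.a) = ξ ^ (1 - g.a) * ξ := by
      rw [← Real.rpow_add_one' hξ (by linarith)]
      congr 1
      ring
    have h6 : 0 < A ^ (1 - g.a) := by positivity
    have h7 : 0 < A ^ (2 - g.a) := by positivity
    rw [h5]
    nlinarith [mul_nonneg hs hξ, mul_nonneg (mul_nonneg hs hξ) h7.le,
      mul_le_mul_of_nonneg_right h4 hξ]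

end Forchheimer.GenPoly

/-! ### A nonlinear Gronwall inequality -/

namespace Forchheimer

/-- A continuous function which decreases locally to the right decreases. -/
lemma le_of_local_le {f : ℝ → ℝ} {a b : ℝ} (hf : ContinuousOn f (Icc a b))
    (hloc : ∀ x ∈ Ico a b, ∀ᶠ y in 𝓝[>] x, f y ≤ f x) : ∀ x ∈ Icc a b, f x ≤ f a := by
  have hsub : Icc a b ⊆ {x | f x ≤ f a} := by
    by_cases hab : a ≤ b
    · refine IsClosed.Icc_subset_of_forall_mem_nhdsWithin ?_ (by simp) ?_
      · have := hf.preimage_isClosed_of_isClosed isClosed_Icc (isClosed_Iic (a := f a))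
        rwa [inter_comm] at this
      · rintro x ⟨hx, hx'⟩
        filter_upwards [hloc x hx'] with y hy using hy.trans hx
    · simp [hab]
  exact fun x hx => hsub hx

/-- **Bihari's inequality** for a power nonlinearity: if `Z > 0` is continuous and
`Z(t) - Z(s) ≤ c ∫ₛᵗ ψ Z^{1+m}`, then `Z^{-m}` decreases at most at the rate `c m ψ`. -/
lemma bihari {Z ψ : ℝ → ℝ} {T c m : ℝ} (hc : 0 < c) (hm : 0 < m)
    (hZ : ContinuousOn Z (Icc 0 T)) (hZ0 : ∀ t ∈ Icc 0 T, 0 < Z t)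
    (hψ : IntegrableOn ψ (Ioc 0 T)) (hψ1 : ∀ t, 1 ≤ ψ t)
    (hineq : ∀ s t, 0 ≤ s → s < t → t ≤ T →
      Z t - Z s ≤ c * ∫ τ in Ioc s t, ψ τ * Z τ ^ (1 + m)) :
    ∀ t ∈ Icc 0 T, Z 0 ^ (-m) - c * m * ∫ τ in Ioc 0 t, ψ τ ≤ Z t ^ (-m) := by
  intro t ht
  have hψi : ∀ s t, 0 ≤ s → t ≤ T → IntegrableOn ψ (Ioc s t) := fun s t hs ht =>
    hψ.mono_set (Ioc_subset_Ioc hs ht)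
  -- the monotonicity is proved for the rates `c m ε`, `ε > 1`, and then `ε → 1`
  suffices H : ∀ ε > 1, Z 0 ^ (-m) - c * m * ε * ∫ τ in Ioc 0 t, ψ τ ≤ Z t ^ (-m) by
    have hlim : Tendsto (fun ε : ℝ => Z 0 ^ (-m) - c * m * ε * ∫ τ in Ioc 0 t, ψ τ) (𝓝[>] 1)
        (𝓝 (Z 0 ^ (-m) - c * m * 1 * ∫ τ in Ioc 0 t, ψ τ)) := by
      apply Tendsto.mono_left _ nhdsWithin_le_nhds
      apply Continuous.tendsto
      fun_prop
    rw [mul_one] at hlim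
    exact le_of_tendsto hlim (eventually_mem_nhdsWithin.mono H)
  intro ε hε
  set N : ℝ → ℝ := fun t => ∫ τ in Ioc 0 t, ψ τ with hN
  have hNint : ∀ t, 0 ≤ t → N t = ∫ τ in (0:ℝ)..t, ψ τ := fun t ht => by
    rw [hN, intervalIntegral.integral_of_le ht]
  have hNc : ContinuousOn N (Icc 0 T) := by
    have h1 : ContinuousOn (fun t => ∫ τ in (0:ℝ)..t, ψ τ) (Icc 0 T) := by
      rcases le_total 0 T with hT | hT
      · have := intervalIntegral.continuousOn_primitive_interval (a := 0) (b := T) (f := ψ)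
          (μ := volume) ?_
        · rwa [uIcc_of_le hT] at this
        · rw [uIcc_of_le hT, integrableOn_Icc_iff_integrableOn_Ioc]
          exact hψ
      · rcases hT.eq_or_lt with rfl | hT
        · simp
        · simp [hT]
    exact h1.congr fun t ht => hNint t ht.1
  have hNadd : ∀ s t, 0 ≤ s → s < t → t ≤ T → N t - N s = ∫ τ in Ioc s t, ψ τ := by
    intro s t hs hst ht
    rw [hNint t (hs.trans hst.le), hNint s hs, intervalIntegral.integral_interval_sub_left,
      intervalIntegral.integral_of_le hst.le]
    · rw [intervalIntegrable_iff_integrableOn_Ioc_of_le (hs.trans hst.le)]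
      exact hψi 0 t le_rfl ht
    · rw [intervalIntegrable_iff_integrableOn_Ioc_of_le hs]
      exact hψi 0 s le_rfl (hst.le.trans ht)
  have key := le_of_local_le (f := fun t => -(Z t ^ (-m)) - c * m * ε * N t) (a := 0) (b := T)
    ?_ ?_ t ht
  · have hN0 : N 0 = 0 := by simp [hN]
    simp only [hN0] at key
    linarith
  · refine (hZ.rpow_const fun x hx => Or.inl (hZ0 x hx).ne').neg.sub (continuousOn_const.mul hNc)
  · intro x hx
    have hxI : x ∈ Icc 0 T := ⟨hx.1, hx.2.le⟩
    have hZx := hZ0 x hxI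
    -- near `x` the quantity `Z^{1+m}` exceeds its value at `x` by a factor `ε` at most
    have hcont : Tendsto (fun y => Z y ^ (1 + m)) (𝓝[Icc 0 T] x) (𝓝 (Z x ^ (1 + m))) :=
      (hZ x hxI).rpow_const (Or.inl hZx.ne')
    have hev : ∀ᶠ y in 𝓝[Icc 0 T] x, Z y ^ (1 + m) < ε * Z x ^ (1 + m) := by
      apply hcont.eventually_lt_const
      have : 0 < Z x ^ (1 + m) := by positivity
      nlinarith
    obtain ⟨d, hd, hdb⟩ := Metric.mem_nhdsWithin_iff.1 hev
    have hmem : Ioo x (min (x + d) T) ∈ 𝓝[>] x :=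
      Ioo_mem_nhdsGT (lt_min (by linarith) hx.2)
    filter_upwards [hmem] with y hy
    have hyT : y < T := hy.2.trans_le (min_le_right _ _)
    have hyd : y < x + d := hy.2.trans_le (min_le_left _ _)
    have hyI : y ∈ Icc 0 T := ⟨hx.1.trans hy.1.le, hyT.le⟩
    have hZy := hZ0 y hyI
    have hNxy := hNadd x y hx.1 hy.1 hyT.le
    have hNn : 0 ≤ N y - N x := by
      rw [hNxy]
      exact setIntegral_nonneg measurableSet_Ioc fun τ _ => by linarith [hψ1 τ]
    have hbound : Z y - Z x ≤ c * (ε * Z x ^ (1 + m)) * (N y - N x) := by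
      refine (hineq x y hx.1 hy.1 hyT.le).trans ?_
      rw [hNxy, mul_assoc]
      refine mul_le_mul_of_nonneg_left ?_ hc.le
      rw [← integral_const_mul]
      have hZint : IntegrableOn (fun τ => ψ τ * Z τ ^ (1 + m)) (Ioc x y) := by
        rw [← integrableOn_Icc_iff_integrableOn_Ioc]
        refine IntegrableOn.mul_continuousOn ?_ ?_ isCompact_Icc
        · rw [integrableOn_Icc_iff_integrableOn_Ioc]
          exact hψi x y hx.1 hyT.le
        · exact (hZ.mono (Icc_subset_Icc hx.1 hyT.le)).rpow_const fun z hz =>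
            Or.inl (hZ0 z ⟨hx.1.trans hz.1, hz.2.trans hyT.le⟩).ne'
      refine setIntegral_mono_on hZint ((hψi x y hx.1 hyT.le).const_mul _) measurableSet_Ioc ?_
      intro τ hτ
      have h1 : Z τ ^ (1 + m) < ε * Z x ^ (1 + m) := by
        apply hdb
        refine ⟨?_, ⟨hx.1.trans hτ.1.le, hτ.2.trans hyT.le⟩⟩
        rw [Metric.mem_ball, Real.dist_eq, abs_of_pos (by linarith [hτ.1])]
        linarith [hτ.2]
      have := hψ1 τ
      nlinarith
    -- the tangent line of the convex function `z ↦ z^{-m}` at `Z x`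
    have htan : Z x ^ (-m) - Z y ^ (-m) ≤ m * Z x ^ (-m - 1) * (Z y - Z x) := by
      have hr : 0 < Z y / Z x := by positivity
      have hcv : 1 + -m * (Z y / Z x - 1) ≤ (Z y / Z x) ^ (-m) := by
        rw [Real.rpow_def_of_pos hr]
        have h1 := Real.add_one_le_exp (Real.log (Z y / Z x) * -m)
        have h2 := Real.log_le_sub_one_of_pos hr
        nlinarith
      rw [Real.div_rpow hZy.le hZx.le, le_div_iff₀ (by positivity)] at hcv
      rw [Real.rpow_sub_one hZx.ne']
      have e1 : m * (Z x ^ (-m) / Z x) * (Z y - Z x) = m * (Z y / Z x - 1) * Z x ^ (-m) := by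
        field_simp
      rw [e1]
      linarith
    have hpow : Z x ^ (-m - 1) * Z x ^ (1 + m) = 1 := by
      rw [← Real.rpow_add hZx, show -m - 1 + (1 + m) = 0 by ring, Real.rpow_zero]
    have h3 : m * Z x ^ (-m - 1) * (Z y - Z x) ≤ c * m * ε * (N y - N x) := by
      have hp : 0 < m * Z x ^ (-m - 1) := by positivity
      calc m * Z x ^ (-m - 1) * (Z y - Z x)
          ≤ m * Z x ^ (-m - 1) * (c * (ε * Z x ^ (1 + m)) * (N y - N x)) :=
            mul_le_mul_of_nonneg_left hbound hp.le
        _ = c * m * ε * (N y - N x) * (Z x ^ (-m - 1) * Z x ^ (1 + m)) := by ring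
        _ = _ := by rw [hpow, mul_one]
    linarith

end Forchheimer

namespace Forchheimer

/-! ### Sobolev and trace inequalities for continuously differentiable functions -/

/-- A value of a `C¹` function is bounded by an integral along a segment issuing from the point. -/
lemma enorm_le_lintegral_segment {F : Type*} [NormedAddCommGroup F] [NormedSpace ℝ F]
    {f : F → ℝ} (hf : ContDiff ℝ 1 f) (x d : F) {h C : ℝ} (hh : 0 < h) (hC : 1 / h ≤ C)
    (hd : ‖d‖ ≤ C) :
    ‖f x‖ₑ ≤ ∫⁻ s in Ioc 0 h,
      ENNReal.ofReal C * (‖f (x + s • d)‖ₑ + ‖fderiv ℝ f (x + s • d)‖ₑ) := by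
  have hC0 : 0 < C := lt_of_lt_of_le (by positivity) hC
  have hline : Continuous fun s : ℝ => x + s • d := by fun_prop
  have hφc : Continuous fun s : ℝ => f (x + s • d) := hf.continuous.comp hline
  have hdc : Continuous fun s : ℝ => fderiv ℝ f (x + s • d) :=
    (hf.continuous_fderiv one_ne_zero).comp hline
  have hderiv : ∀ s : ℝ, HasDerivAt (fun s : ℝ => f (x + s • d)) (fderiv ℝ f (x + s • d) d) s := by
    intro s
    have h1 : HasDerivAt (fun s : ℝ => x + s • d) d s := by
      simpa using ((hasDerivAt_id s).smul_const d).const_add x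
    exact ((hf.differentiable one_ne_zero _).hasFDerivAt).comp_hasDerivAt s h1
  have hdc' : Continuous fun s : ℝ => fderiv ℝ f (x + s • d) d := hdc.clm_apply continuous_const
  set I := ∫ s in Ioc 0 h, C * ‖fderiv ℝ f (x + s • d)‖ with hI
  have hint1 : IntegrableOn (fun s : ℝ => C * ‖fderiv ℝ f (x + s • d)‖) (Ioc 0 h) :=
    (Continuous.integrableOn_Icc (by fun_prop)).mono_set Ioc_subset_Icc_self
  have hint2 : IntegrableOn (fun s : ℝ => ‖f (x + s • d)‖) (Ioc 0 h) :=
    (Continuous.integrableOn_Icc (by fun_prop)).mono_set Ioc_subset_Icc_self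
  have hpt : ∀ s ∈ Ioc 0 h, ‖f x‖ ≤ ‖f (x + s • d)‖ + I := by
    intro s hs
    have h1 : ∫ τ in (0:ℝ)..s, fderiv ℝ f (x + τ • d) d = f (x + s • d) - f x := by
      rw [intervalIntegral.integral_eq_sub_of_hasDerivAt (fun τ _ => hderiv τ)
        (hdc'.intervalIntegrable _ _)]
      simp
    have h2 : ‖∫ τ in (0:ℝ)..s, fderiv ℝ f (x + τ • d) d‖ ≤ I := by
      refine (intervalIntegral.norm_integral_le_integral_norm hs.1.le).trans ?_
      rw [intervalIntegral.integral_of_le hs.1.le]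
      refine (setIntegral_mono_on ?_ (hint1.mono_set (Ioc_subset_Ioc le_rfl hs.2))
        measurableSet_Ioc fun τ _ => ?_).trans
        (setIntegral_mono_set hint1 (ae_of_all _ fun τ => by positivity)
          (Ioc_subset_Ioc le_rfl hs.2).eventuallyLE)
      · exact (hdc'.norm.integrableOn_Icc).mono_set Ioc_subset_Icc_self
      · rw [mul_comm]
        exact ((fderiv ℝ f (x + τ • d)).le_opNorm d).trans
          (mul_le_mul_of_nonneg_left hd (norm_nonneg _))
    have h3 : f x = f (x + s • d) - ∫ τ in (0:ℝ)..s, fderiv ℝ f (x + τ • d) d := by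
      rw [h1]; ring
    rw [h3]
    exact (norm_sub_le _ _).trans (by linarith)
  have hmean : h * ‖f x‖ ≤ (∫ s in Ioc 0 h, ‖f (x + s • d)‖) + h * I := by
    have := setIntegral_mono_on (f := fun _ => ‖f x‖) (g := fun s => ‖f (x + s • d)‖ + I)
      (s := Ioc 0 h) (μ := volume) (by simp) (hint2.add (by simp)) measurableSet_Ioc hpt
    rw [integral_add hint2 (by simp)] at this
    simpa [hh.le, mul_comm] using this
  have hfin : ‖f x‖ ≤ ∫ s in Ioc 0 h, C * (‖f (x + s • d)‖ + ‖fderiv ℝ f (x + s • d)‖) := by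
    simp_rw [mul_add]
    rw [integral_add (hint2.const_mul C) hint1, ← hI, integral_const_mul]
    have hJ : 0 ≤ ∫ s in Ioc 0 h, ‖f (x + s • d)‖ :=
      setIntegral_nonneg measurableSet_Ioc fun _ _ => norm_nonneg _
    have : ‖f x‖ ≤ 1 / h * (∫ s in Ioc 0 h, ‖f (x + s • d)‖) + I := by
      rw [← mul_le_mul_iff_right₀ hh]
      calc h * ‖f x‖ ≤ _ := hmean
        _ = _ := by field_simp
    nlinarith
  rw [← ofReal_norm]
  refine (ENNReal.ofReal_le_ofReal hfin).trans ?_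
  rw [ofReal_integral_eq_lintegral_ofReal]
  · refine lintegral_mono fun s => ?_
    rw [ENNReal.ofReal_mul hC0.le, ENNReal.ofReal_add (norm_nonneg _) (norm_nonneg _),
      ofReal_norm, ofReal_norm]
  · simp_rw [mul_add]
    exact (hint2.const_mul C).add hint1
  · exact ae_of_all _ fun s => by positivity

/-- A linear isomorphism transports integrals with respect to Haar measures, up to a factor. -/
lemma exists_lintegral_comp_linearEquiv {V W : Type*}
    [NormedAddCommGroup V] [NormedSpace ℝ V] [FiniteDimensional ℝ V] [MeasurableSpace V]
    [BorelSpace V] [NormedAddCommGroup W] [NormedSpace ℝ W] [FiniteDimensional ℝ W]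
    [MeasurableSpace W] [BorelSpace W] (A : V ≃ₗ[ℝ] W)
    (μ : Measure V) [μ.IsAddHaarMeasure] (ν : Measure W) [ν.IsAddHaarMeasure] :
    (∃ c : ℝ≥0∞, c ≠ ⊤ ∧ ∀ g : W → ℝ≥0∞, Measurable g → ∫⁻ v, g (A v) ∂μ = c * ∫⁻ w, g w ∂ν) ∧
    (∃ c : ℝ≥0∞, c ≠ ⊤ ∧ ∀ g : W → ℝ≥0∞, Measurable g → ∫⁻ w, g w ∂ν = c * ∫⁻ v, g (A v) ∂μ) := by
  have hAm : Measurable A := A.toContinuousLinearEquiv.continuous.measurable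
  have hH : (μ.map A).IsAddHaarMeasure :=
    A.toContinuousLinearEquiv.isAddHaarMeasure_map μ
  constructor
  · refine ⟨(Measure.addHaarScalarFactor (μ.map A) ν : ℝ≥0∞), ENNReal.coe_ne_top, fun g hg => ?_⟩
    rw [← lintegral_map hg hAm]
    conv_lhs => rw [Measure.isAddLeftInvariant_eq_smul (μ.map A) ν]
    rw [lintegral_smul_measure]
    rfl
  · refine ⟨(Measure.addHaarScalarFactor ν (μ.map A) : ℝ≥0∞), ENNReal.coe_ne_top, fun g hg => ?_⟩
    rw [← lintegral_map hg hAm]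
    conv_lhs => rw [Measure.isAddLeftInvariant_eq_smul ν (μ.map A)]
    rw [lintegral_smul_measure]
    rfl

/-- Near `x₀`, every segment of length `h` issuing from a point of `U` in a direction close to `e`
stays in `U`. -/
def HasConeAt {n : ℕ} (U : Set (E n)) (x₀ : E n) : Prop :=
  ∃ r > 0, ∃ h > 0, ∃ ε > 0, ∃ e : E n, ∀ d : E n, ‖d - e‖ < ε →
    ∀ y ∈ U ∩ Metric.ball x₀ r, ∀ s ∈ Icc (0:ℝ) h, y + s • d ∈ U

lemma hasConeAt_of_mem {n : ℕ} {U : Set (E n)} (hU : IsOpen U) {x₀ : E n} (hx : x₀ ∈ U) :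
    HasConeAt U x₀ := by
  obtain ⟨r, hr, hrU⟩ := Metric.isOpen_iff.1 hU x₀ hx
  refine ⟨r / 2, by positivity, r / 2, by positivity, 1, one_pos, 0, fun d hd y hy s hs => ?_⟩
  apply hrU
  rw [sub_zero] at hd
  have h1 : dist y x₀ < r / 2 := hy.2
  rw [Metric.mem_ball, dist_eq_norm] at *
  calc ‖y + s • d - x₀‖ = ‖(y - x₀) + s • d‖ := by congr 1; abel
    _ ≤ ‖y - x₀‖ + ‖s • d‖ := norm_add_le _ _
    _ < r / 2 + r / 2 := by
      rw [norm_smul, Real.norm_of_nonneg hs.1]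
      have : s * ‖d‖ ≤ r / 2 * 1 :=
        mul_le_mul hs.2 hd.le (norm_nonneg _) (by positivity)
      linarith
    _ = r := by ring

/-- Every ball of `ℝⁿ` contains a basis. -/
lemma exists_linearEquiv_mem_ball {n : ℕ} (e : E n) {ε : ℝ} (hε : 0 < ε) :
    ∃ A : (Fin n → ℝ) ≃ₗ[ℝ] E n, ∀ i, ‖A (Pi.single i 1) - e‖ < ε := by
  -- `e + η bᵢ` is a basis as soon as `η + ∑ eᵢ ≠ 0`
  obtain ⟨η, hη0, hηε, hηs⟩ : ∃ η : ℝ, 0 < η ∧ η < ε ∧ η + ∑ i, e i ≠ 0 := by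
    by_cases h : ε / 2 + ∑ i, e i = 0
    · exact ⟨ε / 3, by positivity, by linarith, fun h' => by linarith⟩
    · exact ⟨ε / 2, by positivity, by linarith, h⟩
  let A₀ : (Fin n → ℝ) →ₗ[ℝ] E n :=
    { toFun := fun c => (∑ i, c i) • e + η • WithLp.toLp 2 c
      map_add' := fun c c' => by
        simp only [Pi.add_apply, Finset.sum_add_distrib, add_smul, WithLp.toLp_add, smul_add]
        abel
      map_smul' := fun k c => by
        simp only [Pi.smul_apply, smul_eq_mul, ← Finset.mul_sum, WithLp.toLp_smul, smul_add,
          RingHom.id_apply, mul_smul]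
        rw [smul_comm k η] }
  have hinj : Function.Injective A₀ := by
    rw [injective_iff_map_eq_zero]
    intro c hc
    have hc' : ∀ j, (∑ i, c i) * e j + η * c j = 0 := fun j => by
      have := congrArg (fun v : E n => v j) hc
      simpa [A₀] using this
    have hsum : (∑ i, c i) * (η + ∑ i, e i) = 0 := by
      have h := Finset.sum_congr rfl (fun j (_ : j ∈ Finset.univ) => hc' j)
      rw [Finset.sum_add_distrib, ← Finset.mul_sum, ← Finset.mul_sum] at h
      simp only [Finset.sum_const_zero] at h
      linarith
    have hs0 : ∑ i, c i = 0 := (mul_eq_zero.1 hsum).resolve_right hηs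
    funext j
    have := hc' j
    rw [hs0, zero_mul, zero_add] at this
    exact (mul_eq_zero.1 this).resolve_left hη0.ne'
  refine ⟨LinearEquiv.ofInjectiveOfFinrankEq A₀ hinj (by simp), fun i => ?_⟩
  have : A₀ (Pi.single i 1) - e = η • WithLp.toLp 2 (Pi.single i (1:ℝ)) := by
    simp [A₀]
  change ‖A₀ (Pi.single i 1) - e‖ < ε
  rw [this, norm_smul, Real.norm_of_nonneg hη0.le]
  have h1 : ‖(WithLp.toLp 2 (Pi.single i (1:ℝ)) : E n)‖ = 1 := by
    simp
  rw [h1, mul_one]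
  exact hηε

/-- The Sobolev inequality `W^{1,1} ⊂ L^{n/(n-1)}` near a point with the cone property.  Each value
of `f` is bounded by line integrals in `n` independent directions, and the Loomis–Whitney
inequality applies. -/
lemma exists_sobolev_local {n : ℕ} {q : ℝ} (hq : Real.HolderConjugate n q) {U : Set (E n)}
    (hU : MeasurableSet U) {x₀ : E n} (hx : HasConeAt U x₀) :
    ∃ r > 0, ∃ C : ℝ≥0∞, C ≠ ⊤ ∧ ∀ f : E n → ℝ, ContDiff ℝ 1 f →
      ∫⁻ x in U ∩ Metric.ball x₀ r, ‖f x‖ₑ ^ q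
        ≤ C * (∫⁻ x in U, (‖f x‖ₑ + ‖fderiv ℝ f x‖ₑ)) ^ q := by
  obtain ⟨r, hr, h, hh, ε, hε, e, hcone⟩ := hx
  obtain ⟨A, hA⟩ := exists_linearEquiv_mem_ball e hε
  obtain ⟨⟨c₁, hc₁, hmap₁⟩, ⟨c₂, hc₂, hmap₂⟩⟩ :=
    exists_lintegral_comp_linearEquiv A (volume : Measure (Fin n → ℝ)) (volume : Measure (E n))
  set C : ℝ := max (1 / h) (‖e‖ + ε) with hC
  have hq0 : 0 ≤ q := hq.symm.nonneg
  have hn1 : (1:ℝ) < n := hq.lt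
  refine ⟨r, hr, c₂ * (ENNReal.ofReal C * c₁) ^ q,
    ENNReal.mul_ne_top hc₂ (ENNReal.rpow_ne_top_of_nonneg hq0
      (ENNReal.mul_ne_top ENNReal.ofReal_ne_top hc₁)), fun f hf => ?_⟩
  have hfd : Continuous (fderiv ℝ f) := hf.continuous_fderiv one_ne_zero
  set G : E n → ℝ≥0∞ := U.indicator fun x => ENNReal.ofReal C * (‖f x‖ₑ + ‖fderiv ℝ f x‖ₑ) with hG
  have hGm : Measurable G := by
    refine Measurable.indicator ?_ hU
    exact ((hf.continuous.enorm.add hfd.enorm).measurable).const_mul _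
  have hAm : Measurable A := A.toContinuousLinearEquiv.continuous.measurable
  have hbase : ∀ i (c : Fin n → ℝ), A c ∈ U ∩ Metric.ball x₀ r →
      ‖f (A c)‖ₑ ≤ ∫⁻ s, G (A (Function.update c i s)) := by
    intro i c hc
    have hdn : ‖A (Pi.single i 1)‖ ≤ C := by
      refine le_trans ?_ (le_max_right _ _)
      have := norm_add_le (A (Pi.single i 1) - e) e
      rw [sub_add_cancel] at this
      linarith [hA i]
    calc ‖f (A c)‖ₑ ≤ ∫⁻ s in Ioc 0 h, ENNReal.ofReal C *
          (‖f (A c + s • A (Pi.single i 1))‖ₑ + ‖fderiv ℝ f (A c + s • A (Pi.single i 1))‖ₑ) :=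
          enorm_le_lintegral_segment hf _ _ hh (le_max_left _ _) hdn
      _ ≤ ∫⁻ s in Ioc 0 h, G (A c + s • A (Pi.single i 1)) := by
          refine setLIntegral_mono' measurableSet_Ioc fun s hs => ?_
          rw [hG, indicator_of_mem (hcone _ (hA i) _ hc s ⟨hs.1.le, hs.2⟩)]
      _ ≤ ∫⁻ s, G (A c + s • A (Pi.single i 1)) := setLIntegral_le_lintegral _ _
      _ = ∫⁻ s, G (A (Function.update c i (c i + s))) := by
          refine lintegral_congr fun s => ?_
          congr 1
          rw [← map_smul, ← map_add]
          congr 1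
          funext j
          by_cases hj : j = i
          · subst hj; simp
          · simp [hj]
      _ = ∫⁻ s, G (A (Function.update c i s)) :=
          lintegral_add_left_eq_self (μ := volume) (fun s => G (A (Function.update c i s))) (c i)
  have hmeasf : Measurable fun x => (U ∩ Metric.ball x₀ r).indicator (fun x => ‖f x‖ₑ ^ q) x :=
    (hf.continuous.enorm.measurable.pow_const q).indicator (hU.inter measurableSet_ball)
  rw [← lintegral_indicator (hU.inter measurableSet_ball), hmap₂ _ hmeasf, mul_assoc]
  gcongr
  calc ∫⁻ c, (U ∩ Metric.ball x₀ r).indicator (fun x => ‖f x‖ₑ ^ q) (A c)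
      ≤ ∫⁻ c, ∏ i, (∫⁻ s, G (A (Function.update c i s))) ^ ((1:ℝ) / (Fintype.card (Fin n) - 1 : ℝ)) := by
        refine lintegral_mono fun c => ?_
        by_cases hc : A c ∈ U ∩ Metric.ball x₀ r
        · rw [indicator_of_mem hc]
          have : ‖f (A c)‖ₑ ^ q
              = ∏ _i : Fin n, ‖f (A c)‖ₑ ^ ((1:ℝ) / (Fintype.card (Fin n) - 1 : ℝ)) := by
            rw [Finset.prod_const, Finset.card_univ, Fintype.card_fin, ← ENNReal.rpow_natCast,
              ← ENNReal.rpow_mul, hq.conjugate_eq]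
            congr 1
            field_simp
          rw [this]
          refine Finset.prod_le_prod' fun i _ => ?_
          refine ENNReal.rpow_le_rpow (hbase i c hc) ?_
          rw [Fintype.card_fin]
          exact one_div_nonneg.2 (by linarith)
        · rw [indicator_of_notMem hc]
          exact zero_le
    _ ≤ (∫⁻ c, G (A c)) ^ q := by
        refine lintegral_prod_lintegral_pow_le (fun _ : Fin n => (volume : Measure ℝ)) ?_
          (f := fun c => G (A c)) (hGm.comp hAm)
        rwa [Fintype.card_fin]
    _ = (ENNReal.ofReal C * c₁) ^ q * (∫⁻ x in U, (‖f x‖ₑ + ‖fderiv ℝ f x‖ₑ)) ^ q := by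
        rw [hmap₁ G hGm, hG, lintegral_indicator hU, lintegral_const_mul,
          ← ENNReal.mul_rpow_of_nonneg _ _ hq0]
        · congr 1; ring
        · exact (hf.continuous.enorm.add hfd.enorm).measurable

lemma exists_sobolev_of_cone {n : ℕ} {q : ℝ} (hq : Real.HolderConjugate n q) {U : Set (E n)}
    (hU : MeasurableSet U) (hUb : Bornology.IsBounded U) (hx : ∀ x ∈ closure U, HasConeAt U x) :
    ∃ C : ℝ≥0∞, C ≠ ⊤ ∧ ∀ f : E n → ℝ, ContDiff ℝ 1 f →
      ∫⁻ x in U, ‖f x‖ₑ ^ q ≤ C * (∫⁻ x in U, (‖f x‖ₑ + ‖fderiv ℝ f x‖ₑ)) ^ q := by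
  have hK : IsCompact (closure U) := hUb.isCompact_closure
  have key : ∃ C : ℝ≥0∞, C ≠ ⊤ ∧ ∀ f : E n → ℝ, ContDiff ℝ 1 f →
      ∫⁻ x in U ∩ closure U, ‖f x‖ₑ ^ q
        ≤ C * (∫⁻ x in U, (‖f x‖ₑ + ‖fderiv ℝ f x‖ₑ)) ^ q := by
    refine hK.induction_on (p := fun s => ∃ C : ℝ≥0∞, C ≠ ⊤ ∧ ∀ f : E n → ℝ, ContDiff ℝ 1 f →
      ∫⁻ x in U ∩ s, ‖f x‖ₑ ^ q ≤ C * (∫⁻ x in U, (‖f x‖ₑ + ‖fderiv ℝ f x‖ₑ)) ^ q) ?_ ?_ ?_ ?_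
    · exact ⟨0, by simp, fun f _ => by simp⟩
    · rintro s t hst ⟨C, hC, hf⟩
      exact ⟨C, hC, fun f hf' =>
        (lintegral_mono_set (inter_subset_inter_right _ hst)).trans (hf f hf')⟩
    · rintro s t ⟨C, hC, hf⟩ ⟨C', hC', hf'⟩
      refine ⟨C + C', ENNReal.add_ne_top.2 ⟨hC, hC'⟩, fun f h => ?_⟩
      rw [inter_union_distrib_left, add_mul]
      exact (lintegral_union_le _ _ _).trans (add_le_add (hf f h) (hf' f h))
    · intro x hxU
      obtain ⟨r, hr, C, hC, hf⟩ := exists_sobolev_local hq hU (hx x hxU)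
      exact ⟨Metric.ball x r, mem_nhdsWithin_of_mem_nhds (Metric.ball_mem_nhds x hr), C, hC, hf⟩
  rwa [inter_eq_left.2 subset_closure] at key

/-! ### The boundary -/

/-- The hyperplane `e^⊥`. -/
abbrev Hyper {n : ℕ} (e : E n) : Submodule ℝ (E n) := (Submodule.span ℝ {e})ᗮ

lemma proj_add_inner_smul {n : ℕ} {e : E n} (he : ‖e‖ = 1) (y : E n) :
    ((Hyper e).orthogonalProjectionOnto y : E n) + inner ℝ e y • e = y := by
  have h := Submodule.starProjection_add_starProjection_orthogonal (K := Submodule.span ℝ {e}) y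
  rw [Submodule.starProjection_unit_singleton ℝ he y] at h
  rw [add_comm]
  exact h

lemma proj_self {n : ℕ} (e : E n) : (Hyper e).orthogonalProjectionOnto e = 0 := by
  rw [Submodule.orthogonalProjectionOnto_eq_zero_iff]
  exact (Submodule.le_orthogonal_orthogonal _) (Submodule.mem_span_singleton_self e)

lemma norm_proj_le {n : ℕ} (e y : E n) : ‖(Hyper e).orthogonalProjectionOnto y‖ ≤ ‖y‖ :=
  Submodule.norm_orthogonalProjectionOnto_apply_le _ y

/-- Near a boundary point `U` is the region above a Lipschitz graph: `U` contains short segments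
issuing from its points in directions close to `e`, the boundary lies in the graph, and `U` contains
short segments issuing from boundary points in the direction `e`. -/
lemma exists_boundary_chart {n : ℕ} {U : Set (E n)} (hU : IsOpen U) (hC : HasC1Boundary U)
    {x : E n} (hx : x ∈ frontier U) :
    ∃ r > 0, ∃ h > 0, ∃ ε > 0, ∃ e : E n, ‖e‖ = 1 ∧ ∃ γ : Hyper e → ℝ, Continuous γ ∧
      ∃ (L : NNReal) (ρ : ℝ), LipschitzOnWith L γ
          (Metric.ball ((Hyper e).orthogonalProjectionOnto x) ρ) ∧
        (∀ y ∈ Metric.ball x r, (Hyper e).orthogonalProjectionOnto y ∈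
          Metric.ball ((Hyper e).orthogonalProjectionOnto x) ρ) ∧
        (∀ d : E n, ‖d - e‖ < ε → ∀ y ∈ U ∩ Metric.ball x r, ∀ s ∈ Icc (0:ℝ) h, y + s • d ∈ U) ∧
        (∀ y ∈ frontier U ∩ Metric.ball x r,
          γ ((Hyper e).orthogonalProjectionOnto y) = inner ℝ e y ∧
            ∀ s ∈ Ioc (0:ℝ) h, y + s • e ∈ U) := by
  obtain ⟨r₀, hr₀, e, he, γ, hγ, hiff⟩ := hC x hx
  obtain ⟨L, N, hN, hL⟩ :=
    (hγ.contDiffAt (x := (Hyper e).orthogonalProjectionOnto x)).exists_lipschitzOnWith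
  obtain ⟨ρ, hρ, hρN⟩ := Metric.mem_nhds_iff.1 hN
  set R := min r₀ ρ with hR
  have hR0 : 0 < R := lt_min hr₀ hρ
  have hRr : R ≤ r₀ := min_le_left _ _
  have hRρ : R ≤ ρ := min_le_right _ _
  have hproj : ∀ y ∈ Metric.ball x R, (Hyper e).orthogonalProjectionOnto y ∈
      Metric.ball ((Hyper e).orthogonalProjectionOnto x) ρ := by
    intro y hy
    rw [Metric.mem_ball, dist_eq_norm, ← map_sub]
    rw [Metric.mem_ball, dist_eq_norm] at hy
    exact (norm_proj_le e _).trans_lt (hy.trans_le hRρ)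
  have hLip : LipschitzOnWith L γ (Metric.ball ((Hyper e).orthogonalProjectionOnto x) ρ) :=
    hL.mono hρN
  set ε : ℝ := 1 / (L + 2) with hε
  have hL0 : (0:ℝ) ≤ L := L.2
  have hε0 : 0 < ε := by positivity
  have hε1 : ε < 1 := by rw [hε, div_lt_one (by positivity)]; linarith
  have hLε : L * ε ≤ 1 - ε := by
    rw [hε]; field_simp; linarith
  have hstep : ∀ d : E n, ‖d - e‖ < ε → ∀ y ∈ Metric.ball x (R / 2), ∀ s ∈ Icc (0:ℝ) (R / 4),
      y + s • d ∈ Metric.ball x R := by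
    intro d hd y hy s hs
    rw [Metric.mem_ball, dist_eq_norm] at *
    have h1 : ‖d‖ ≤ 2 := by
      have := norm_add_le (d - e) e
      rw [sub_add_cancel, he] at this
      linarith
    calc ‖y + s • d - x‖ = ‖(y - x) + s • d‖ := by congr 1; abel
      _ ≤ ‖y - x‖ + ‖s • d‖ := norm_add_le _ _
      _ < R / 2 + R / 2 := by
        rw [norm_smul, Real.norm_of_nonneg hs.1]
        have : s * ‖d‖ ≤ R / 4 * 2 := mul_le_mul hs.2 h1 (norm_nonneg _) (by positivity)
        linarith
      _ = R := by ring
  refine ⟨R / 2, by positivity, R / 4, by positivity, ε, hε0, e, he, γ, hγ.continuous, L, ρ, hLip,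
    fun y hy => hproj y (Metric.ball_subset_ball (by linarith) hy), ?_, ?_⟩
  · intro d hd y hy s hs
    have hyR : y ∈ Metric.ball x R := Metric.ball_subset_ball (by linarith) hy.2
    have hz := hstep d hd y hy.2 s hs
    rw [hiff _ (Metric.ball_subset_ball hRr hz)]
    have hyγ := (hiff y (Metric.ball_subset_ball hRr hyR)).1 hy.1
    have hpd : ‖(Hyper e).orthogonalProjectionOnto d‖ ≤ ε := by
      have h1 : (Hyper e).orthogonalProjectionOnto d = (Hyper e).orthogonalProjectionOnto (d - e) := by
        rw [map_sub, proj_self, sub_zero]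
      rw [h1]
      exact (norm_proj_le e _).trans hd.le
    have h1 : γ ((Hyper e).orthogonalProjectionOnto (y + s • d))
        ≤ γ ((Hyper e).orthogonalProjectionOnto y) + s * (L * ε) := by
      have h2 := hLip.dist_le_mul _ (hproj _ hz) _ (hproj _ hyR)
      rw [dist_eq_norm, dist_eq_norm, ← map_sub, add_sub_cancel_left, map_smul, norm_smul,
        Real.norm_of_nonneg hs.1] at h2
      have h3 : (L:ℝ) * (s * ‖(Hyper e).orthogonalProjectionOnto d‖) ≤ s * (L * ε) := by
        have := mul_le_mul_of_nonneg_left hpd (mul_nonneg hL0 hs.1)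
        linarith
      have h4 := le_abs_self (γ ((Hyper e).orthogonalProjectionOnto (y + s • d))
        - γ ((Hyper e).orthogonalProjectionOnto y))
      rw [Real.norm_eq_abs] at h2
      linarith
    have h2 : 1 - ε ≤ inner ℝ e d := by
      have h3 : inner ℝ e d = 1 + inner ℝ e (d - e) := by
        rw [inner_sub_right, real_inner_self_eq_norm_sq, he]; ring
      have h4 := neg_le_of_abs_le (abs_real_inner_le_norm e (d - e))
      rw [he, one_mul] at h4
      linarith
    rw [inner_add_right, inner_smul_right]
    have h5 := mul_le_mul_of_nonneg_left (hLε.trans h2) hs.1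
    linarith
  · intro y hy
    have hyR : y ∈ Metric.ball x R := Metric.ball_subset_ball (by linarith) hy.2
    have hyr := Metric.ball_subset_ball hRr hyR
    have hγc : Continuous fun z : E n => γ ((Hyper e).orthogonalProjectionOnto z) :=
      hγ.continuous.comp (ContinuousLinearMap.continuous _)
    have hic : Continuous fun z : E n => (inner ℝ e z : ℝ) := by fun_prop
    have heq : γ ((Hyper e).orthogonalProjectionOnto y) = inner ℝ e y := by
      apply le_antisymm
      · by_contra! hlt
        -- points below the graph are not limits of points of `U`
        have hopen : IsOpen {z : E n | inner ℝ e z < γ ((Hyper e).orthogonalProjectionOnto z)} :=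
          isOpen_lt hic hγc
        obtain ⟨z, ⟨hz1, hz2⟩, hzU⟩ := mem_closure_iff.1 hy.1.1 _
          (hopen.inter Metric.isOpen_ball) ⟨hlt, hyr⟩
        have := (hiff z hz2).1 hzU
        exact absurd hz1 (not_lt.2 this.le)
      · by_contra! hlt
        exact hy.1.2 (by rw [hU.interior_eq]; exact (hiff y hyr).2 hlt)
    refine ⟨heq, fun s hs => ?_⟩
    have hz := hstep e (by simpa using hε0) y hy.2 s ⟨hs.1.le, hs.2⟩
    rw [hiff _ (Metric.ball_subset_ball hRr hz), map_add, map_smul, proj_self, smul_zero, add_zero,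
      heq, inner_add_right, inner_smul_right, real_inner_self_eq_norm_sq, he]
    linarith [hs.1]

lemma hasConeAt_of_mem_closure {n : ℕ} {U : Set (E n)} (hU : IsOpen U) (hC : HasC1Boundary U)
    {x : E n} (hx : x ∈ closure U) : HasConeAt U x := by
  by_cases hxU : x ∈ U
  · exact hasConeAt_of_mem hU hxU
  · obtain ⟨r, hr, h, hh, ε, hε, e, -, -, -, -, -, -, -, hcone, -⟩ :=
      exists_boundary_chart hU hC (x := x) ⟨hx, by rwa [hU.interior_eq]⟩
    exact ⟨r, hr, h, hh, ε, hε, e, hcone⟩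

/-- The Sobolev inequality `W^{1,1}(U) ⊂ L^{n/(n-1)}(U)`, for functions which are `C¹` up to the
boundary. -/
lemma exists_sobolev {n : ℕ} {q : ℝ} (hq : Real.HolderConjugate n q) {U : Set (E n)}
    (hU : IsOpen U) (hUb : Bornology.IsBounded U) (hC : HasC1Boundary U) :
    ∃ C : ℝ≥0∞, C ≠ ⊤ ∧ ∀ f : E n → ℝ, ContDiff ℝ 1 f →
      ∫⁻ x in U, ‖f x‖ₑ ^ q ≤ C * (∫⁻ x in U, (‖f x‖ₑ + ‖fderiv ℝ f x‖ₑ)) ^ q :=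
  exists_sobolev_of_cone hq hU.measurableSet hUb fun _ hx => hasConeAt_of_mem_closure hU hC hx

lemma finrank_hyper {n : ℕ} {e : E n} (he : ‖e‖ = 1) : Module.finrank ℝ (Hyper e) = n - 1 := by
  have hne : e ≠ 0 := fun h => by simp [h] at he
  have h := Submodule.finrank_add_finrank_orthogonal (Submodule.span ℝ {e})
  rw [finrank_span_singleton hne, finrank_euclideanSpace_fin] at h
  change Module.finrank ℝ ((Submodule.span ℝ {e})ᗮ : Submodule ℝ (E n)) = n - 1
  omega

/-- The splitting `ℝⁿ = e^⊥ ⊕ ℝ e`. -/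
def splitEquiv {n : ℕ} (e : E n) (he : ‖e‖ = 1) : (Hyper e × ℝ) ≃ₗ[ℝ] E n where
  toFun z := (z.1 : E n) + z.2 • e
  map_add' z w := by simp only [Prod.fst_add, Prod.snd_add, Submodule.coe_add, add_smul]; abel
  map_smul' c z := by simp [mul_smul]
  invFun y := ((Hyper e).orthogonalProjectionOnto y, inner ℝ e y)
  left_inv z := by
    have h1 : inner ℝ e (z.1 : E n) = 0 :=
      Submodule.mem_orthogonal_singleton_iff_inner_right.1 z.1.2
    ext1
    · simp only [map_add, map_smul, proj_self, smul_zero, add_zero]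
      exact Submodule.orthogonalProjectionOnto_mem_subspace_eq_self z.1
    · simp [inner_add_right, inner_smul_right, h1, he]
  right_inv y := proj_add_inner_smul he y

/-- The trace inequality near a boundary point.  The surface measure is bounded by the image of
Lebesgue measure on `e^⊥` under the Lipschitz parametrization of the boundary by its graph, and
boundary values are bounded by integrals along segments in the direction `e`. -/
lemma exists_trace_local {n : ℕ} {U : Set (E n)} (hU : IsOpen U) (hC : HasC1Boundary U)
    {x₀ : E n} (hx : x₀ ∈ frontier U) :
    ∃ r > 0, ∃ C : ℝ≥0∞, C ≠ ⊤ ∧ ∀ f : E n → ℝ, ContDiff ℝ 1 f →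
      ∫⁻ x in Metric.ball x₀ r, ‖f x‖ₑ ∂(surfaceMeasure U)
        ≤ C * ∫⁻ x in U, (‖f x‖ₑ + ‖fderiv ℝ f x‖ₑ) := by
  obtain ⟨r, hr, h, hh, -, -, e, he, γ, hγ, L, ρ, hLip, hproj, -, hfr⟩ :=
    exists_boundary_chart hU hC hx
  set ψ : Hyper e → E n := fun p => (p : E n) + γ p • e with hψ
  have hψc : Continuous ψ := by fun_prop
  set N := Metric.ball ((Hyper e).orthogonalProjectionOnto x₀) ρ ∩
    ψ ⁻¹' (frontier U ∩ Metric.ball x₀ r) with hN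
  have hNm : MeasurableSet N := measurableSet_ball.inter
    (hψc.measurable (isClosed_frontier.measurableSet.inter measurableSet_ball))
  have hψL : LipschitzOnWith (1 + L) ψ N := by
    refine LipschitzOnWith.of_dist_le_mul fun p hp p' hp' => ?_
    have h1 := hLip.dist_le_mul p hp.1 p' hp'.1
    rw [dist_eq_norm] at *
    have h2 : ψ p - ψ p' = ((p - p' : Hyper e) : E n) + (γ p - γ p') • e := by
      simp only [hψ, Submodule.coe_sub, sub_smul]; abel
    rw [h2]
    refine (norm_add_le _ _).trans ?_
    rw [norm_smul, he, mul_one, NNReal.coe_add, NNReal.coe_one, add_mul, one_mul, dist_eq_norm] at *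
    exact add_le_add le_rfl h1
  let ν : Measure (Hyper e) := Measure.euclideanHausdorffMeasure (n - 1)
  have hν : ν.IsAddHaarMeasure := by
    have := MeasureTheory.isAddHaarMeasure_euclideanHausdorffMeasure (E := Hyper e)
    rwa [finrank_hyper he] at this
  set K : ℝ≥0∞ := ((1 + L : NNReal) : ℝ≥0∞) ^ ((n - 1 : ℕ) : ℝ) with hK
  have hKt : K ≠ ⊤ := ENNReal.rpow_ne_top_of_nonneg (by positivity) ENNReal.coe_ne_top
  have hmeas : (surfaceMeasure U).restrict (Metric.ball x₀ r)
      ≤ K • (ν.restrict N).map ψ := by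
    refine Measure.le_iff.2 fun A hA => ?_
    rw [Measure.restrict_apply hA, surfaceMeasure,
      Measure.restrict_apply (hA.inter measurableSet_ball), Measure.smul_apply,
      Measure.map_apply hψc.measurable hA, Measure.restrict_apply (hψc.measurable hA)]
    have hsub : A ∩ Metric.ball x₀ r ∩ frontier U ⊆ ψ '' (ψ ⁻¹' A ∩ N) := by
      rintro y ⟨⟨hyA, hyB⟩, hyF⟩
      have hy : ψ ((Hyper e).orthogonalProjectionOnto y) = y := by
        simp only [hψ]
        rw [(hfr y ⟨hyF, hyB⟩).1]
        exact proj_add_inner_smul he y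
      exact ⟨_, ⟨by rw [mem_preimage, hy]; exact hyA, hproj y hyB,
        by rw [mem_preimage, hy]; exact ⟨hyF, hyB⟩⟩, hy⟩
    refine (measure_mono hsub).trans ?_
    simp only [ν, Measure.euclideanHausdorffMeasure_def, Measure.smul_apply]
    have h1 := (hψL.mono inter_subset_right).hausdorffMeasure_image_le
      (d := ((n - 1 : ℕ) : ℝ)) (by positivity) (s := ψ ⁻¹' A ∩ N)
    rw [smul_comm]
    gcongr
    exact h1
  obtain ⟨⟨c, hc, hmap⟩, -⟩ := exists_lintegral_comp_linearEquiv (splitEquiv e he)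
    (ν.prod volume) (volume : Measure (E n))
  set C : ℝ := max (1 / h) 1 with hCdef
  refine ⟨r, hr, K * (c * ENNReal.ofReal C), ENNReal.mul_ne_top hKt
    (ENNReal.mul_ne_top hc ENNReal.ofReal_ne_top), fun f hf => ?_⟩
  have hfd : Continuous (fderiv ℝ f) := hf.continuous_fderiv one_ne_zero
  set G : E n → ℝ≥0∞ := U.indicator fun x => ENNReal.ofReal C * (‖f x‖ₑ + ‖fderiv ℝ f x‖ₑ) with hG
  have hGm : Measurable G := by
    refine Measurable.indicator ?_ hU.measurableSet
    exact ((hf.continuous.enorm.add hfd.enorm).measurable).const_mul _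
  have hsplit : Continuous (splitEquiv e he) := (splitEquiv e he).toContinuousLinearEquiv.continuous
  calc ∫⁻ x in Metric.ball x₀ r, ‖f x‖ₑ ∂(surfaceMeasure U)
      ≤ ∫⁻ x, ‖f x‖ₑ ∂(K • (ν.restrict N).map ψ) := lintegral_mono' hmeas le_rfl
    _ = K * ∫⁻ p in N, ‖f (ψ p)‖ₑ ∂ν := by
        rw [lintegral_smul_measure, lintegral_map hf.continuous.enorm.measurable hψc.measurable]
        rfl
    _ ≤ K * ∫⁻ p in N, (∫⁻ s, G (splitEquiv e he (p, s))) ∂ν := by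
        refine mul_le_mul_right (setLIntegral_mono' hNm fun p hp => ?_) K
        calc ‖f (ψ p)‖ₑ ≤ ∫⁻ s in Ioc 0 h, ENNReal.ofReal C *
              (‖f (ψ p + s • e)‖ₑ + ‖fderiv ℝ f (ψ p + s • e)‖ₑ) :=
              enorm_le_lintegral_segment hf _ _ hh (le_max_left _ _)
                (he.le.trans (le_max_right _ _))
          _ ≤ ∫⁻ s in Ioc 0 h, G (ψ p + s • e) := by
              refine setLIntegral_mono' measurableSet_Ioc fun s hs => ?_
              rw [hG, indicator_of_mem ((hfr _ hp.2).2 s hs)]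
          _ ≤ ∫⁻ s, G (ψ p + s • e) := setLIntegral_le_lintegral _ _
          _ = ∫⁻ s, G (splitEquiv e he (p, γ p + s)) := by
              refine lintegral_congr fun s => ?_
              congr 1
              change (p : E n) + γ p • e + s • e = (p : E n) + (γ p + s) • e
              rw [add_smul, add_assoc]
          _ = ∫⁻ s, G (splitEquiv e he (p, s)) :=
              lintegral_add_left_eq_self (μ := volume) (fun s => G (splitEquiv e he (p, s))) (γ p)
    _ ≤ K * ∫⁻ p, (∫⁻ s, G (splitEquiv e he (p, s))) ∂ν := by
        gcongr
        exact Measure.restrict_le_self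
    _ = K * (c * ENNReal.ofReal C) * ∫⁻ x in U, (‖f x‖ₑ + ‖fderiv ℝ f x‖ₑ) := by
        rw [← lintegral_prod (fun z => G (splitEquiv e he z))
          (hGm.comp hsplit.measurable).aemeasurable, hmap G hGm, hG,
          lintegral_indicator hU.measurableSet, lintegral_const_mul]
        · ring
        · exact (hf.continuous.enorm.add hfd.enorm).measurable

/-- The trace inequality `∫_Γ |f| dσ ≤ C ∫_U (|f| + |∇f|) dx`, for functions which are `C¹` up to
the boundary. -/
lemma exists_trace {n : ℕ} {U : Set (E n)} (hU : IsOpen U) (hUb : Bornology.IsBounded U)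
    (hC : HasC1Boundary U) :
    ∃ C : ℝ≥0∞, C ≠ ⊤ ∧ ∀ f : E n → ℝ, ContDiff ℝ 1 f →
      ∫⁻ x, ‖f x‖ₑ ∂(surfaceMeasure U) ≤ C * ∫⁻ x in U, (‖f x‖ₑ + ‖fderiv ℝ f x‖ₑ) := by
  have hK : IsCompact (frontier U) :=
    Metric.isCompact_of_isClosed_isBounded isClosed_frontier
      (hUb.closure.subset frontier_subset_closure)
  have key : ∃ C : ℝ≥0∞, C ≠ ⊤ ∧ ∀ f : E n → ℝ, ContDiff ℝ 1 f →
      ∫⁻ x in frontier U, ‖f x‖ₑ ∂(surfaceMeasure U)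
        ≤ C * ∫⁻ x in U, (‖f x‖ₑ + ‖fderiv ℝ f x‖ₑ) := by
    refine hK.induction_on (p := fun s => ∃ C : ℝ≥0∞, C ≠ ⊤ ∧ ∀ f : E n → ℝ, ContDiff ℝ 1 f →
      ∫⁻ x in s, ‖f x‖ₑ ∂(surfaceMeasure U)
        ≤ C * ∫⁻ x in U, (‖f x‖ₑ + ‖fderiv ℝ f x‖ₑ)) ?_ ?_ ?_ ?_
    · exact ⟨0, by simp, fun f _ => by simp⟩
    · rintro s t hst ⟨C, hC, hf⟩
      exact ⟨C, hC, fun f hf' => (lintegral_mono_set hst).trans (hf f hf')⟩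
    · rintro s t ⟨C, hC, hf⟩ ⟨C', hC', hf'⟩
      refine ⟨C + C', ENNReal.add_ne_top.2 ⟨hC, hC'⟩, fun f h => ?_⟩
      rw [add_mul]
      exact (lintegral_union_le _ _ _).trans (add_le_add (hf f h) (hf' f h))
    · intro x hxU
      obtain ⟨r, hr, C, hC, hf⟩ := exists_trace_local hU hC hxU
      exact ⟨Metric.ball x r, mem_nhdsWithin_of_mem_nhds (Metric.ball_mem_nhds x hr), C, hC, hf⟩
  obtain ⟨C, hC, hf⟩ := key
  refine ⟨C, hC, fun f h => ?_⟩
  have h1 : (surfaceMeasure U).restrict (frontier U) = surfaceMeasure U := by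
    rw [surfaceMeasure, Measure.restrict_restrict isClosed_frontier.measurableSet, inter_self]
  rw [← h1]
  exact hf f h

lemma isFiniteMeasure_surfaceMeasure {n : ℕ} {U : Set (E n)} (hU : IsOpen U)
    (hUb : Bornology.IsBounded U) (hC : HasC1Boundary U) : IsFiniteMeasure (surfaceMeasure U) := by
  obtain ⟨C, hC, hf⟩ := exists_trace hU hUb hC
  refine ⟨?_⟩
  have h := hf (fun _ => 1) contDiff_const
  simp only [enorm_one, lintegral_const, one_mul, fderiv_fun_const, Pi.zero_apply,
    Measure.restrict_apply MeasurableSet.univ, univ_inter] at h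
  exact h.trans_lt (ENNReal.mul_lt_top hC.lt_top (ENNReal.mul_lt_top
    (ENNReal.add_lt_top.2 ⟨ENNReal.one_lt_top, enorm_lt_top⟩) hUb.measure_lt_top))

/-! ### The Sobolev inequality with an exponent -/

lemma enorm_gradient {n : ℕ} (f : E n → ℝ) (x : E n) : ‖gradient f x‖ₑ = ‖fderiv ℝ f x‖ₑ := by
  rw [gradient, ← ofReal_norm, ← ofReal_norm, LinearIsometryEquiv.norm_map]

lemma continuous_gradient {n : ℕ} {f : E n → ℝ} (hf : ContDiff ℝ 1 f) :
    Continuous (gradient f) :=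
  (LinearIsometryEquiv.continuous _).comp (hf.continuous_fderiv one_ne_zero)

lemma gradient_comp {n : ℕ} {Θ : ℝ → ℝ} (hΘ : ContDiff ℝ 1 Θ) {f : E n → ℝ}
    (hf : ContDiff ℝ 1 f) (x : E n) :
    gradient (fun y => Θ (f y)) x = deriv Θ (f x) • gradient f x := by
  have h1 : HasFDerivAt (fun y => Θ (f y)) (deriv Θ (f x) • fderiv ℝ f x) x :=
    ((hΘ.differentiable one_ne_zero _).hasDerivAt).comp_hasFDerivAt x
      (hf.differentiable one_ne_zero x).hasFDerivAt
  rw [gradient, h1.fderiv, gradient]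
  simp

lemma eLpNorm_ofReal_eq {X F : Type*} [MeasurableSpace X] [NormedAddCommGroup F] {μ : Measure X}
    {p : ℝ} (hp : 0 < p) (f : X → F) :
    eLpNorm f (ENNReal.ofReal p) μ = (∫⁻ x, ‖f x‖ₑ ^ p ∂μ) ^ (1 / p) := by
  rw [eLpNorm_eq_lintegral_rpow_enorm_toReal (by simpa using hp) ENNReal.ofReal_ne_top,
    ENNReal.toReal_ofReal hp.le]

/-- The Sobolev inequality `W^{1,p}(U) ⊂ L^{np/(n-p)}(U)`, for functions which are `C¹` up to the
boundary: apply the case `p = 1` to a power of `|f|`. -/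
lemma exists_sobolev_rpow {n : ℕ} {U : Set (E n)}
    (hU : IsOpen U) (hUb : Bornology.IsBounded U) (hC : HasC1Boundary U) {p : ℝ} (hp : 1 < p)
    (hpn : p < n) :
    ∃ C : ℝ≥0∞, C ≠ ⊤ ∧ ∀ f : E n → ℝ, ContDiff ℝ 1 f →
      (∫⁻ x in U, ‖f x‖ₑ ^ (n * p / (n - p))) ^ ((n - p) / (n * p))
        ≤ C * (eLpNorm f (ENNReal.ofReal p) (volume.restrict U)
          + eLpNorm (gradient f) (ENNReal.ofReal p) (volume.restrict U)) := by
  have hn1 : (1:ℝ) < n := hp.trans hpn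
  have hn0 : (0:ℝ) < n := by linarith
  have hp0 : 0 < p := by linarith
  have hnp : (0:ℝ) < n - p := by linarith
  set q : ℝ := n / (n - 1) with hq
  set p' : ℝ := p / (p - 1) with hp'
  set γ : ℝ := p * (n - 1) / (n - p) with hγ
  set s : ℝ := n * p / (n - p) with hs
  have hqc : Real.HolderConjugate n q := Real.HolderConjugate.conjExponent hn1
  have hpc : Real.HolderConjugate p p' := Real.HolderConjugate.conjExponent hp
  have hn1' : (0:ℝ) < n - 1 := by linarith
  have hp1' : 0 < p - 1 := by linarith
  have hs0 : 0 < s := by positivity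
  have hγ1 : 1 < γ := by
    rw [hγ, lt_div_iff₀ hnp]; nlinarith
  have hγq : γ * q = s := by rw [hγ, hq, hs]; field_simp
  have hγp : (γ - 1) * p' = s := by rw [hγ, hp', hs]; field_simp; ring
  have hexp : 1 / q - 1 / p' = 1 / s := by rw [hq, hp', hs]; field_simp; ring
  have hq0 : 0 < q := hqc.symm.pos
  have hp'0 : 0 < p' := hpc.symm.pos
  obtain ⟨C, hCt, hsob⟩ := exists_sobolev hqc hU hUb hC
  refine ⟨C ^ (1 / q) * ENNReal.ofReal γ, ENNReal.mul_ne_top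
    (ENNReal.rpow_ne_top_of_nonneg (by positivity) hCt) ENNReal.ofReal_ne_top, fun f hf => ?_⟩
  have hfd : Continuous (fderiv ℝ f) := hf.continuous_fderiv one_ne_zero
  rw [show ((n:ℝ) - p) / (n * p) = 1 / s by rw [hs]; field_simp]
  set S := ∫⁻ x in U, ‖f x‖ₑ ^ s with hS
  set N := eLpNorm f (ENNReal.ofReal p) (volume.restrict U)
          + eLpNorm (gradient f) (ENNReal.ofReal p) (volume.restrict U) with hN
  have hSt : S ≠ ⊤ := by
    obtain ⟨M, hM⟩ := hUb.isCompact_closure.exists_bound_of_continuousOn hf.continuous.continuousOn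
    have : S ≤ ∫⁻ x in U, ENNReal.ofReal M ^ s := by
      refine setLIntegral_mono' hU.measurableSet fun x hx => ?_
      refine ENNReal.rpow_le_rpow ?_ hs0.le
      rw [← ofReal_norm]
      exact ENNReal.ofReal_le_ofReal (hM x (subset_closure hx))
    refine ne_top_of_le_ne_top ?_ this
    rw [setLIntegral_const]
    exact ENNReal.mul_ne_top (ENNReal.rpow_ne_top_of_nonneg hs0.le ENNReal.ofReal_ne_top)
      hUb.measure_lt_top.ne
  have h1 : S ≤ C * (∫⁻ x in U, (‖f x‖ₑ ^ (γ - 1) *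
      (ENNReal.ofReal γ * (‖f x‖ₑ + ‖fderiv ℝ f x‖ₑ)))) ^ q := by
    have h2 := hsob (fun x => ‖f x‖ ^ γ) (hf.norm_rpow hγ1)
    have e1 : ∀ x, ‖(‖f x‖ ^ γ)‖ₑ = ‖f x‖ₑ ^ γ := fun x => by
      rw [Real.enorm_rpow_of_nonneg (norm_nonneg _) (by linarith), enorm_norm]
    simp_rw [e1, ← ENNReal.rpow_mul, hγq] at h2
    refine h2.trans ?_
    refine mul_le_mul_right (ENNReal.rpow_le_rpow (lintegral_mono fun x => ?_) hq0.le) C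
    have h3 := enorm_fderiv_norm_rpow_le (hf.differentiable one_ne_zero) (x := x)
      (p := γ.toNNReal) (by simpa using hγ1)
    rw [Real.coe_toNNReal γ (by linarith)] at h3
    have h4 : ‖f x‖ₑ ^ γ ≤ ENNReal.ofReal γ * ‖f x‖ₑ ^ (γ - 1) * ‖f x‖ₑ := by
      have : ‖f x‖ₑ ^ γ = ‖f x‖ₑ ^ (γ - 1) * ‖f x‖ₑ := by
        conv_rhs => rw [← ENNReal.rpow_one ‖f x‖ₑ, ← ENNReal.rpow_mul, one_mul]
        rw [← ENNReal.rpow_add_of_nonneg _ _ (by linarith) (by norm_num)]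
        simp
      rw [this, mul_assoc]
      exact le_mul_of_one_le_left zero_le (by simpa using hγ1.le)
    calc _ ≤ ENNReal.ofReal γ * ‖f x‖ₑ ^ (γ - 1) * ‖f x‖ₑ
          + ENNReal.ofReal γ * ‖f x‖ₑ ^ (γ - 1) * ‖fderiv ℝ f x‖ₑ := add_le_add h4 h3
      _ = _ := by ring
  have h2 : ∫⁻ x in U, (‖f x‖ₑ ^ (γ - 1) * (ENNReal.ofReal γ * (‖f x‖ₑ + ‖fderiv ℝ f x‖ₑ)))
      ≤ ENNReal.ofReal γ * (S ^ (1 / p') * N) := by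
    have hm1 : AEMeasurable (fun x => ‖f x‖ₑ ^ (γ - 1)) (volume.restrict U) :=
      (hf.continuous.enorm.measurable.pow_const _).aemeasurable
    have hm2 : AEMeasurable (fun x => ‖f x‖ₑ) (volume.restrict U) :=
      hf.continuous.enorm.measurable.aemeasurable
    have hm3 : AEMeasurable (fun x => ‖fderiv ℝ f x‖ₑ) (volume.restrict U) :=
      hfd.enorm.measurable.aemeasurable
    have h3 := ENNReal.lintegral_mul_le_Lp_mul_Lq (volume.restrict U) hpc.symm hm1 (hm2.add hm3)
    have h4 : (∫⁻ x in U, (‖f x‖ₑ + ‖fderiv ℝ f x‖ₑ) ^ p) ^ (1 / p) ≤ N := by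
      refine (ENNReal.lintegral_Lp_add_le hm2 hm3 hp.le).trans (le_of_eq ?_)
      rw [hN, eLpNorm_ofReal_eq hp0, eLpNorm_ofReal_eq hp0]
      simp_rw [enorm_gradient]
    calc _ = ENNReal.ofReal γ * ∫⁻ x in U, (‖f x‖ₑ ^ (γ - 1) * (‖f x‖ₑ + ‖fderiv ℝ f x‖ₑ)) := by
          rw [← lintegral_const_mul' _ _ ENNReal.ofReal_ne_top]
          refine lintegral_congr fun x => ?_
          ring
      _ ≤ ENNReal.ofReal γ * (S ^ (1 / p') * N) := by
          refine mul_le_mul_right (h3.trans ?_) _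
          simp_rw [← ENNReal.rpow_mul, hγp]
          exact mul_le_mul_right h4 _
  have h3 : S ^ (1 / q) ≤ C ^ (1 / q) * ENNReal.ofReal γ * (S ^ (1 / p') * N) := by
    have h4 := ENNReal.rpow_le_rpow (h1.trans (mul_le_mul_right (ENNReal.rpow_le_rpow h2 hq0.le) C))
      (one_div_nonneg.2 hq0.le)
    rw [ENNReal.mul_rpow_of_nonneg _ _ (one_div_nonneg.2 hq0.le), ← ENNReal.rpow_mul,
      mul_one_div_cancel hq0.ne', ENNReal.rpow_one] at h4
    rwa [mul_assoc]
  rcases eq_or_ne S 0 with hS0 | hS0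
  · rw [hS0, ENNReal.zero_rpow_of_pos (by positivity)]
    exact zero_le
  · have hp1 : S ^ (1 / p') ≠ 0 := (ENNReal.rpow_pos hS0.bot_lt hSt).ne'
    have hp2 : S ^ (1 / p') ≠ ⊤ := ENNReal.rpow_ne_top_of_nonneg (by positivity) hSt
    have h5 : S ^ (1 / q) = S ^ (1 / p') * S ^ (1 / s) := by
      rw [← ENNReal.rpow_add _ _ hS0 hSt, ← hexp]
      congr 1; ring
    rw [h5] at h3
    rw [← ENNReal.mul_le_mul_iff_right hp1 hp2]
    calc _ ≤ _ := h3
      _ = _ := by ring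

/-! ### Passing to functions with weak derivatives -/

/-- A sequence of functions, `C¹` up to the boundary, which converges almost everywhere in `U` and
on the boundary, and whose gradients converge in `L^p(U)`. -/
structure Approximates {n : ℕ} (U : Set (E n)) (p : ℝ) (v : ℕ → E n → ℝ) (w : E n → ℝ)
    (G : E n → E n) (h : E n → ℝ) : Prop where
  contDiff : ∀ k, ContDiff ℝ 1 (v k)
  tendsto : Tendsto (fun k => eLpNorm (fun x => v k x - w x) (ENNReal.ofReal p)
    (volume.restrict U)) atTop (𝓝 0)
  tendsto_gradient : Tendsto (fun k => eLpNorm (fun x => gradient (v k) x - G x)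
    (ENNReal.ofReal p) (volume.restrict U)) atTop (𝓝 0)
  ae_tendsto : ∀ᵐ x ∂(volume.restrict U), Tendsto (fun k => v k x) atTop (𝓝 (w x))
  ae_tendsto_boundary : ∀ᵐ x ∂(surfaceMeasure U), Tendsto (fun k => v k x) atTop (𝓝 (h x))

lemma HasTrace.exists_approximates {n : ℕ} {U : Set (E n)} {p : ℝ} (hp : 0 < p)
    {w : E n → ℝ} {G : E n → E n} {h : E n → ℝ} (hT : HasTrace U p w G h)
    (hw : AEStronglyMeasurable w (volume.restrict U))
    (hh : AEStronglyMeasurable h (surfaceMeasure U)) :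
    ∃ v, Approximates U p v w G h := by
  obtain ⟨v, hv, h1, h2, h3⟩ := hT
  have hp' : ENNReal.ofReal p ≠ 0 := by simpa using hp
  obtain ⟨k₁, hk₁, hae₁⟩ := (tendstoInMeasure_of_tendsto_eLpNorm (f := v) hp'
    (fun k => (hv k).continuous.aestronglyMeasurable) hw h1).exists_seq_tendsto_ae
  obtain ⟨k₂, hk₂, hae₂⟩ := (tendstoInMeasure_of_tendsto_eLpNorm (f := fun k => v (k₁ k)) hp'
    (fun k => (hv _).continuous.aestronglyMeasurable) hh
    (h3.comp hk₁.tendsto_atTop)).exists_seq_tendsto_ae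
  have hk : Tendsto (fun k => k₁ (k₂ k)) atTop atTop := hk₁.tendsto_atTop.comp hk₂.tendsto_atTop
  refine ⟨fun k => v (k₁ (k₂ k)), fun k => hv _, h1.comp hk, h2.comp hk, ?_, hae₂⟩
  filter_upwards [hae₁] with x hx using hx.comp hk₂.tendsto_atTop

/-- The chain rule: composition with a `C¹` function with bounded derivative. -/
lemma Approximates.comp {n : ℕ} {U : Set (E n)} {p : ℝ} (hp : 1 ≤ p)
    {v : ℕ → E n → ℝ} {w : E n → ℝ} {G : E n → E n} {h : E n → ℝ} (hA : Approximates U p v w G h)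
    (hw : AEStronglyMeasurable w (volume.restrict U))
    (hG : MemLp G (ENNReal.ofReal p) (volume.restrict U))
    {Θ : ℝ → ℝ} (hΘ : ContDiff ℝ 1 Θ) {L : ℝ} (hL : ∀ z, |deriv Θ z| ≤ L) :
    Approximates U p (fun k x => Θ (v k x)) (fun x => Θ (w x)) (fun x => deriv Θ (w x) • G x)
      (fun x => Θ (h x)) := by
  have hp0 : 0 < p := by linarith
  have hpE : (1 : ℝ≥0∞) ≤ ENNReal.ofReal p := by simpa using hp
  have hL0 : 0 ≤ L := (abs_nonneg _).trans (hL 0)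
  have hΘ' : Continuous (deriv Θ) := hΘ.continuous_deriv le_rfl
  have hLip : ∀ a b, |Θ a - Θ b| ≤ L * |a - b| := fun a b =>
    Convex.norm_image_sub_le_of_norm_deriv_le (f := Θ) (s := univ)
      (fun x _ => hΘ.differentiable one_ne_zero x) (fun x _ => hL x) convex_univ
      (mem_univ b) (mem_univ a)
  refine ⟨fun k => hΘ.comp (hA.contDiff k), ?_, ?_, ?_, ?_⟩
  · refine tendsto_of_tendsto_of_tendsto_of_le_of_le tendsto_const_nhds
      (h := fun k => ENNReal.ofReal L * eLpNorm (fun x => v k x - w x) (ENNReal.ofReal p)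
        (volume.restrict U)) ?_ (fun k => zero_le) fun k => ?_
    · simpa using ENNReal.Tendsto.const_mul hA.tendsto (Or.inr ENNReal.ofReal_ne_top)
    · exact eLpNorm_le_mul_eLpNorm_of_ae_le_mul (ae_of_all _ fun x => hLip _ _) _
  · have hlim : Tendsto (fun k => eLpNorm (fun x => (deriv Θ (v k x) - deriv Θ (w x)) • G x)
        (ENNReal.ofReal p) (volume.restrict U)) atTop (𝓝 0) := by
      simp_rw [eLpNorm_ofReal_eq hp0]
      have hz : (0:ℝ≥0∞) = (∫⁻ x in U, 0) ^ (1 / p) := by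
        rw [lintegral_zero, ENNReal.zero_rpow_of_pos (by positivity)]
      rw [hz]
      refine Tendsto.ennrpow_const _ ?_
      refine tendsto_lintegral_of_dominated_convergence'
        (fun x => (ENNReal.ofReal (2 * L) * ‖G x‖ₑ) ^ p) ?_ ?_ ?_ ?_
      · intro k
        refine AEMeasurable.pow_const (AEStronglyMeasurable.enorm ?_) _
        exact ((hΘ'.comp (hA.contDiff k).continuous).aestronglyMeasurable.sub
          (hΘ'.comp_aestronglyMeasurable hw)).smul hG.1
      · intro k
        refine ae_of_all _ fun x => ENNReal.rpow_le_rpow ?_ hp0.le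
        rw [enorm_smul]
        refine mul_le_mul_left ?_ _
        rw [← ofReal_norm]
        refine ENNReal.ofReal_le_ofReal ((norm_sub_le _ _).trans ?_)
        have := hL (v k x)
        have := hL (w x)
        simp only [Real.norm_eq_abs]
        linarith
      · have h1 := hG.2
        rw [eLpNorm_ofReal_eq hp0, ENNReal.rpow_lt_top_iff_of_pos (by positivity)] at h1
        simp_rw [ENNReal.mul_rpow_of_nonneg _ _ hp0.le]
        rw [lintegral_const_mul'' _ (hG.1.enorm.pow_const _)]
        exact ENNReal.mul_ne_top (ENNReal.rpow_ne_top_of_nonneg hp0.le ENNReal.ofReal_ne_top) h1.ne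
      · filter_upwards [hA.ae_tendsto] with x hx
        have h1 : Tendsto (fun k => (deriv Θ (v k x) - deriv Θ (w x)) • G x) atTop (𝓝 0) := by
          have h2 := (((hΘ'.tendsto _).comp hx).sub_const (deriv Θ (w x))).smul_const (G x)
          simpa using h2
        have h3 := (h1.enorm).ennrpow_const p
        rwa [enorm_zero, ENNReal.zero_rpow_of_pos hp0] at h3
    refine tendsto_of_tendsto_of_tendsto_of_le_of_le tendsto_const_nhds
      (h := fun k => ENNReal.ofReal L * eLpNorm (fun x => gradient (v k) x - G x)
        (ENNReal.ofReal p) (volume.restrict U)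
        + eLpNorm (fun x => (deriv Θ (v k x) - deriv Θ (w x)) • G x)
        (ENNReal.ofReal p) (volume.restrict U)) ?_ (fun k => zero_le) fun k => ?_
    · simpa using (ENNReal.Tendsto.const_mul hA.tendsto_gradient
        (Or.inr ENNReal.ofReal_ne_top)).add hlim
    · have hvm : AEStronglyMeasurable (fun x => deriv Θ (v k x)) (volume.restrict U) :=
        (hΘ'.comp (hA.contDiff k).continuous).aestronglyMeasurable
      have heq : (fun x => gradient (fun x => Θ (v k x)) x - deriv Θ (w x) • G x)
          = (fun x => deriv Θ (v k x) • (gradient (v k) x - G x))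
            + fun x => (deriv Θ (v k x) - deriv Θ (w x)) • G x := by
        funext x
        rw [gradient_comp hΘ (hA.contDiff k)]
        simp only [Pi.add_apply, smul_sub, sub_smul]
        abel
      rw [heq]
      refine (eLpNorm_add_le ?_ ?_ hpE).trans (add_le_add ?_ le_rfl)
      · exact hvm.smul
          ((continuous_gradient (hA.contDiff k)).aestronglyMeasurable.sub hG.1)
      · exact (hvm.sub (hΘ'.comp_aestronglyMeasurable hw)).smul hG.1
      · refine eLpNorm_le_mul_eLpNorm_of_ae_le_mul (ae_of_all _ fun x => ?_) _
        rw [norm_smul]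
        exact mul_le_mul_of_nonneg_right (hL _) (norm_nonneg _)
  · filter_upwards [hA.ae_tendsto] with x hx using (hΘ.continuous.tendsto _).comp hx
  · filter_upwards [hA.ae_tendsto_boundary] with x hx using (hΘ.continuous.tendsto _).comp hx

/-! ### Functions `∫₀^w ρ` of a weakly differentiable function -/

/-- The primitive `z ↦ ∫₀^z ρ`. -/
def prim (ρ : ℝ → ℝ) (z : ℝ) : ℝ := ∫ y in (0:ℝ)..z, ρ y

lemma hasDerivAt_prim {ρ : ℝ → ℝ} (hρ : Continuous ρ) (z : ℝ) : HasDerivAt (prim ρ) (ρ z) z :=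
  intervalIntegral.integral_hasDerivAt_right (hρ.intervalIntegrable _ _)
    hρ.aestronglyMeasurable.stronglyMeasurableAtFilter hρ.continuousAt

lemma deriv_prim {ρ : ℝ → ℝ} (hρ : Continuous ρ) : deriv (prim ρ) = ρ :=
  funext fun z => (hasDerivAt_prim hρ z).deriv

lemma contDiff_prim {ρ : ℝ → ℝ} (hρ : Continuous ρ) : ContDiff ℝ 1 (prim ρ) := by
  rw [contDiff_one_iff_deriv]
  exact ⟨fun z => (hasDerivAt_prim hρ z).differentiableAt, by rwa [deriv_prim hρ]⟩

lemma continuous_prim {ρ : ℝ → ℝ} (hρ : Continuous ρ) : Continuous (prim ρ) :=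
  (contDiff_prim hρ).continuous

@[simp] lemma prim_zero (ρ : ℝ → ℝ) : prim ρ 0 = 0 := by simp [prim]

lemma prim_nonneg {ρ : ℝ → ℝ} (h0 : ∀ z, 0 ≤ ρ z) {z : ℝ} (hz : 0 ≤ z) : 0 ≤ prim ρ z :=
  intervalIntegral.integral_nonneg hz fun _ _ => h0 _

lemma abs_prim_le {ρ ρ' : ℝ → ℝ} (hρ : Continuous ρ) (hρ' : Continuous ρ') (h0 : ∀ z, 0 ≤ ρ z)
    (h : ∀ z, ρ z ≤ ρ' z) (z : ℝ) : |prim ρ z| ≤ |prim ρ' z| := by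
  have h0' : ∀ z, 0 ≤ ρ' z := fun z => (h0 z).trans (h z)
  rcases le_total 0 z with hz | hz
  · rw [abs_of_nonneg (prim_nonneg h0 hz), abs_of_nonneg (prim_nonneg h0' hz)]
    exact intervalIntegral.integral_mono_on hz (hρ.intervalIntegrable _ _)
      (hρ'.intervalIntegrable _ _) fun y _ => h y
  · have e : ∀ σ : ℝ → ℝ, (∀ z, 0 ≤ σ z) → |prim σ z| = ∫ y in z..0, σ y := fun σ hσ => by
      rw [prim, intervalIntegral.integral_symm, abs_neg, abs_of_nonneg]
      exact intervalIntegral.integral_nonneg hz fun _ _ => hσ _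
    rw [e ρ h0, e ρ' h0']
    exact intervalIntegral.integral_mono_on hz (hρ.intervalIntegrable _ _)
      (hρ'.intervalIntegrable _ _) fun y _ => h y

/-- Truncating the density from above at level `j`, the primitive converges as `j → ∞`. -/
lemma tendsto_prim_min {ρ : ℝ → ℝ} (hρ : Continuous ρ) (z : ℝ) :
    Tendsto (fun j : ℕ => prim (fun y => min (ρ y) j) z) atTop (𝓝 (prim ρ z)) := by
  obtain ⟨M, hM⟩ := (isCompact_uIcc (a := (0:ℝ)) (b := z)).exists_bound_of_continuousOn
    hρ.continuousOn
  obtain ⟨J, hJ⟩ := exists_nat_ge M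
  refine tendsto_const_nhds.congr' ?_
  filter_upwards [eventually_ge_atTop J] with j hj
  refine intervalIntegral.integral_congr fun y hy => ?_
  have h1 := (le_abs_self _).trans (hM y hy)
  have h2 : (J:ℝ) ≤ j := by exact_mod_cast hj
  exact (min_eq_left (h1.trans (hJ.trans h2))).symm

variable {n : ℕ} {U : Set (E n)} {p : ℝ} {v : ℕ → E n → ℝ} {w : E n → ℝ} {G : E n → E n}
  {h : E n → ℝ}

lemma tendsto_eLpNorm_one [IsFiniteMeasure (volume.restrict U)] (hp : 1 ≤ p) {F : Type*}
    [NormedAddCommGroup F] {a : ℕ → E n → F}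
    (ham : ∀ k, AEStronglyMeasurable (a k) (volume.restrict U))
    (ha : Tendsto (fun k => eLpNorm (a k) (ENNReal.ofReal p) (volume.restrict U)) atTop (𝓝 0)) :
    Tendsto (fun k => eLpNorm (a k) 1 (volume.restrict U)) atTop (𝓝 0) := by
  have hp0 : 0 < p := by linarith
  refine tendsto_of_tendsto_of_tendsto_of_le_of_le tendsto_const_nhds
    (h := fun k => eLpNorm (a k) (ENNReal.ofReal p) (volume.restrict U)
      * (volume.restrict U) univ ^ (1 / (1:ℝ≥0∞).toReal - 1 / (ENNReal.ofReal p).toReal)) ?_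
    (fun k => zero_le) fun k => ?_
  · have h1 : (0:ℝ) ≤ 1 / (1:ℝ≥0∞).toReal - 1 / (ENNReal.ofReal p).toReal := by
      rw [ENNReal.toReal_ofReal hp0.le, ENNReal.toReal_one]
      have : 1 / p ≤ 1 := by rw [div_le_one hp0]; exact hp
      linarith
    simpa using ENNReal.Tendsto.mul_const ha (b := (volume.restrict U) univ ^
      (1 / (1:ℝ≥0∞).toReal - 1 / (ENNReal.ofReal p).toReal))
      (Or.inr (ENNReal.rpow_ne_top_of_nonneg h1 (measure_ne_top _ _)))
  · exact eLpNorm_le_eLpNorm_mul_rpow_measure_univ (by simpa using hp) (ham k)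

/-- A bound which holds along an approximating sequence passes to the limit, by Fatou's lemma. -/
lemma lintegral_le_of_tendsto {X : Type*} [MeasurableSpace X] {μ : Measure X} {s : ℝ}
    {a : ℕ → X → ℝ} {b : X → ℝ} (ham : ∀ k, AEStronglyMeasurable (a k) μ)
    (hab : ∀ᵐ x ∂μ, Tendsto (fun k => a k x) atTop (𝓝 (b x))) {R : ℕ → ℝ≥0∞} {R₀ : ℝ≥0∞}
    (hR : Tendsto R atTop (𝓝 R₀)) (hle : ∀ k, ∫⁻ x, ‖a k x‖ₑ ^ s ∂μ ≤ R k) :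
    ∫⁻ x, ‖b x‖ₑ ^ s ∂μ ≤ R₀ := by
  calc ∫⁻ x, ‖b x‖ₑ ^ s ∂μ = ∫⁻ x, liminf (fun k => ‖a k x‖ₑ ^ s) atTop ∂μ := by
        refine lintegral_congr_ae ?_
        filter_upwards [hab] with x hx
        exact ((hx.enorm).ennrpow_const s).liminf_eq.symm
    _ ≤ liminf (fun k => ∫⁻ x, ‖a k x‖ₑ ^ s ∂μ) atTop :=
        lintegral_liminf_le' fun k => (ham k).enorm.pow_const s
    _ ≤ liminf R atTop := liminf_le_liminf (Eventually.of_forall hle)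
    _ = R₀ := hR.liminf_eq

/-- The trace inequality for functions `∫₀^w ρ` of a weakly differentiable function `w`. -/
lemma Approximates.trace_le [IsFiniteMeasure (volume.restrict U)] (hp : 1 ≤ p)
    (hA : Approximates U p v w G h)
    (hw : AEStronglyMeasurable w (volume.restrict U))
    (hG : MemLp G (ENNReal.ofReal p) (volume.restrict U)) {C : ℝ≥0∞} (hCt : C ≠ ⊤)
    (hC : ∀ f : E n → ℝ, ContDiff ℝ 1 f →
      ∫⁻ x, ‖f x‖ₑ ∂(surfaceMeasure U) ≤ C * ∫⁻ x in U, (‖f x‖ₑ + ‖fderiv ℝ f x‖ₑ))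
    {ρ : ℝ → ℝ} (hρ : Continuous ρ) (hρ0 : ∀ z, 0 ≤ ρ z)
    (hh : AEStronglyMeasurable h (surfaceMeasure U)) :
    ∫⁻ x, ‖prim ρ (h x)‖ₑ ∂(surfaceMeasure U)
      ≤ C * ∫⁻ x in U, (‖prim ρ (w x)‖ₑ + ‖ρ (w x)‖ₑ * ‖G x‖ₑ) := by
  -- the case of bounded densities, by approximation
  have hbdd : ∀ ρ : ℝ → ℝ, Continuous ρ → (∃ L, ∀ z, |ρ z| ≤ L) →
      ∫⁻ x, ‖prim ρ (h x)‖ₑ ^ (1:ℝ) ∂(surfaceMeasure U)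
        ≤ C * ∫⁻ x in U, (‖prim ρ (w x)‖ₑ + ‖ρ (w x)‖ₑ * ‖G x‖ₑ) := by
    rintro ρ hρ ⟨L, hL⟩
    have hΘ := contDiff_prim hρ
    have hB := hA.comp hp hw hG hΘ (L := L) (by rwa [deriv_prim hρ])
    rw [deriv_prim hρ] at hB
    have hm1 : AEStronglyMeasurable (fun x => prim ρ (w x)) (volume.restrict U) :=
      hΘ.continuous.comp_aestronglyMeasurable hw
    have hm2 : AEStronglyMeasurable (fun x => ρ (w x) • G x) (volume.restrict U) :=
      (hρ.comp_aestronglyMeasurable hw).smul hG.1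
    have hmk1 : ∀ k, AEStronglyMeasurable (fun x => prim ρ (v k x)) (volume.restrict U) :=
      fun k => (hB.contDiff k).continuous.aestronglyMeasurable
    have hmk2 : ∀ k, AEStronglyMeasurable (gradient fun x => prim ρ (v k x)) (volume.restrict U) :=
      fun k => (continuous_gradient (hB.contDiff k)).aestronglyMeasurable
    have h1 := tendsto_eLpNorm_one hp (fun k => (hmk1 k).sub hm1) hB.tendsto
    have h2 := tendsto_eLpNorm_one hp (fun k => (hmk2 k).sub hm2) hB.tendsto_gradient
    set Y := ∫⁻ x in U, (‖prim ρ (w x)‖ₑ + ‖ρ (w x)‖ₑ * ‖G x‖ₑ) with hY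
    have hR : Tendsto (fun k => C * (Y
        + (eLpNorm (fun x => prim ρ (v k x) - prim ρ (w x)) 1 (volume.restrict U)
        + eLpNorm (fun x => gradient (fun x => prim ρ (v k x)) x - ρ (w x) • G x) 1
          (volume.restrict U)))) atTop (𝓝 (C * Y)) := by
      have := ENNReal.Tendsto.const_mul (tendsto_const_nhds (x := Y) |>.add (h1.add h2))
        (Or.inr hCt)
      rwa [add_zero, add_zero] at this
    refine lintegral_le_of_tendsto
      (fun k => (hB.contDiff k).continuous.aestronglyMeasurable) hB.ae_tendsto_boundary hR
      fun k => ?_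
    simp_rw [ENNReal.rpow_one]
    refine (hC _ (hB.contDiff k)).trans (mul_le_mul_right ?_ C)
    have hd1 : AEMeasurable (fun x => ‖prim ρ (v k x) - prim ρ (w x)‖ₑ) (volume.restrict U) :=
      ((hmk1 k).sub hm1).enorm
    have hd2 : AEMeasurable (fun x => ‖prim ρ (w x)‖ₑ + ‖ρ (w x)‖ₑ * ‖G x‖ₑ)
      (volume.restrict U) :=
      hm1.enorm.add ((hρ.comp_aestronglyMeasurable hw).enorm.mul hG.1.enorm)
    rw [eLpNorm_one_eq_lintegral_enorm, eLpNorm_one_eq_lintegral_enorm,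
      ← lintegral_add_left' hd1, hY, ← lintegral_add_left' hd2]
    refine lintegral_mono fun x => ?_
    have e1 : ‖prim ρ (v k x)‖ₑ ≤ ‖prim ρ (w x)‖ₑ + ‖prim ρ (v k x) - prim ρ (w x)‖ₑ := by
      conv_lhs => rw [← add_sub_cancel (prim ρ (w x)) (prim ρ (v k x))]
      exact enorm_add_le _ _
    have e2 : ‖fderiv ℝ (fun x => prim ρ (v k x)) x‖ₑ
        ≤ ‖ρ (w x)‖ₑ * ‖G x‖ₑ + ‖gradient (fun x => prim ρ (v k x)) x - ρ (w x) • G x‖ₑ := by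
      rw [← enorm_gradient, ← enorm_smul]
      conv_lhs => rw [← add_sub_cancel (ρ (w x) • G x) (gradient (fun x => prim ρ (v k x)) x)]
      exact enorm_add_le _ _
    refine (add_le_add e1 e2).trans (le_of_eq ?_)
    ring
  have hρj : ∀ j : ℕ, Continuous fun z => min (ρ z) (j:ℝ) := fun j => hρ.min continuous_const
  have hρj0 : ∀ (j : ℕ) z, 0 ≤ min (ρ z) (j:ℝ) := fun j z => le_min (hρ0 z) j.cast_nonneg
  have := lintegral_le_of_tendsto (s := 1) (μ := surfaceMeasure U)
    (a := fun j x => prim (fun z => min (ρ z) (j:ℝ)) (h x)) (b := fun x => prim ρ (h x))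
    (fun j => (continuous_prim (hρj j)).comp_aestronglyMeasurable hh)
    (ae_of_all _ fun x => tendsto_prim_min hρ _) (tendsto_const_nhds
      (x := C * ∫⁻ x in U, (‖prim ρ (w x)‖ₑ + ‖ρ (w x)‖ₑ * ‖G x‖ₑ))) fun j => ?_
  · simpa using this
  · refine (hbdd _ (hρj j) ⟨j, fun z => ?_⟩).trans ?_
    · rw [abs_of_nonneg (hρj0 j z)]
      exact min_le_right _ _
    · refine mul_le_mul_right (lintegral_mono fun x => ?_) C
      refine add_le_add ?_ (mul_le_mul_left ?_ _)
      · rw [enorm_le_iff_norm_le]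
        exact abs_prim_le (hρj j) hρ (hρj0 j) (fun z => min_le_left _ _) _
      · rw [enorm_le_iff_norm_le, Real.norm_of_nonneg (hρj0 j _), Real.norm_of_nonneg (hρ0 _)]
        exact min_le_left _ _

/-- The Sobolev inequality for functions `∫₀^w ρ` of a weakly differentiable function `w`. -/
lemma Approximates.sobolev_le (hp : 1 ≤ p) {s : ℝ} (hs : 0 < s)
    (hA : Approximates U p v w G h)
    (hw : AEStronglyMeasurable w (volume.restrict U))
    (hG : MemLp G (ENNReal.ofReal p) (volume.restrict U)) {C : ℝ≥0∞} (hCt : C ≠ ⊤)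
    (hC : ∀ f : E n → ℝ, ContDiff ℝ 1 f →
      (∫⁻ x in U, ‖f x‖ₑ ^ s) ^ (1 / s)
        ≤ C * (eLpNorm f (ENNReal.ofReal p) (volume.restrict U)
          + eLpNorm (gradient f) (ENNReal.ofReal p) (volume.restrict U)))
    {ρ : ℝ → ℝ} (hρ : Continuous ρ) (hρ0 : ∀ z, 0 ≤ ρ z) :
    ∫⁻ x in U, ‖prim ρ (w x)‖ₑ ^ s
      ≤ (C * (eLpNorm (fun x => prim ρ (w x)) (ENNReal.ofReal p) (volume.restrict U)
          + eLpNorm (fun x => ρ (w x) • G x) (ENNReal.ofReal p) (volume.restrict U))) ^ s := by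
  have hpE : (1 : ℝ≥0∞) ≤ ENNReal.ofReal p := by simpa using hp
  have hbdd : ∀ ρ : ℝ → ℝ, Continuous ρ → (∃ L, ∀ z, |ρ z| ≤ L) →
      ∫⁻ x in U, ‖prim ρ (w x)‖ₑ ^ s
        ≤ (C * (eLpNorm (fun x => prim ρ (w x)) (ENNReal.ofReal p) (volume.restrict U)
          + eLpNorm (fun x => ρ (w x) • G x) (ENNReal.ofReal p) (volume.restrict U))) ^ s := by
    rintro ρ hρ ⟨L, hL⟩
    have hΘ := contDiff_prim hρ
    have hB := hA.comp hp hw hG hΘ (L := L) (by rwa [deriv_prim hρ])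
    rw [deriv_prim hρ] at hB
    have hm1 : AEStronglyMeasurable (fun x => prim ρ (w x)) (volume.restrict U) :=
      hΘ.continuous.comp_aestronglyMeasurable hw
    have hm2 : AEStronglyMeasurable (fun x => ρ (w x) • G x) (volume.restrict U) :=
      (hρ.comp_aestronglyMeasurable hw).smul hG.1
    have hmk1 : ∀ k, AEStronglyMeasurable (fun x => prim ρ (v k x)) (volume.restrict U) :=
      fun k => (hB.contDiff k).continuous.aestronglyMeasurable
    have hmk2 : ∀ k, AEStronglyMeasurable (gradient fun x => prim ρ (v k x)) (volume.restrict U) :=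
      fun k => (continuous_gradient (hB.contDiff k)).aestronglyMeasurable
    have hR := (ENNReal.Tendsto.const_mul (((tendsto_const_nhds (x := eLpNorm
      (fun x => prim ρ (w x)) (ENNReal.ofReal p) (volume.restrict U))).add hB.tendsto).add
      ((tendsto_const_nhds (x := eLpNorm (fun x => ρ (w x) • G x) (ENNReal.ofReal p)
        (volume.restrict U))).add hB.tendsto_gradient)) (Or.inr hCt)).ennrpow_const s
    rw [add_zero, add_zero] at hR
    refine lintegral_le_of_tendsto
      (fun k => (hB.contDiff k).continuous.aestronglyMeasurable) hB.ae_tendsto hR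
      fun k => ?_
    have h1 := ENNReal.rpow_le_rpow (hC _ (hB.contDiff k)) hs.le
    rw [← ENNReal.rpow_mul, one_div_mul_cancel hs.ne', ENNReal.rpow_one] at h1
    refine h1.trans (ENNReal.rpow_le_rpow (mul_le_mul_right (add_le_add ?_ ?_) C) hs.le)
    · refine le_trans (le_of_eq ?_) (eLpNorm_add_le hm1 ((hmk1 k).sub hm1) hpE)
      congr 1
      funext x
      simp
    · refine le_trans (le_of_eq ?_) (eLpNorm_add_le hm2 ((hmk2 k).sub hm2) hpE)
      congr 1
      funext x
      simp
  have hρj : ∀ j : ℕ, Continuous fun z => min (ρ z) (j:ℝ) := fun j => hρ.min continuous_const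
  have hρj0 : ∀ (j : ℕ) z, 0 ≤ min (ρ z) (j:ℝ) := fun j z => le_min (hρ0 z) j.cast_nonneg
  refine lintegral_le_of_tendsto (s := s) (μ := volume.restrict U)
    (a := fun j x => prim (fun z => min (ρ z) (j:ℝ)) (w x)) (b := fun x => prim ρ (w x))
    (fun j => (continuous_prim (hρj j)).comp_aestronglyMeasurable hw)
    (ae_of_all _ fun x => tendsto_prim_min hρ _) tendsto_const_nhds fun j => ?_
  refine (hbdd _ (hρj j) ⟨j, fun z => ?_⟩).trans
    (ENNReal.rpow_le_rpow (mul_le_mul_right (add_le_add ?_ ?_) C) hs.le)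
  · rw [abs_of_nonneg (hρj0 j z)]
    exact min_le_right _ _
  · exact eLpNorm_mono fun x => abs_prim_le (hρj j) hρ (hρj0 j) (fun z => min_le_left _ _) _
  · refine eLpNorm_mono fun x => ?_
    rw [norm_smul, norm_smul, Real.norm_of_nonneg (hρj0 j _), Real.norm_of_nonneg (hρ0 _)]
    exact mul_le_mul_of_nonneg_right (min_le_left _ _) (norm_nonneg _)

/-- The trace of a non-negative function is non-negative. -/
lemma Approximates.trace_nonneg [IsFiniteMeasure (volume.restrict U)] (hp : 1 ≤ p)
    (hA : Approximates U p v w G h)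
    (hw : AEStronglyMeasurable w (volume.restrict U))
    (hG : MemLp G (ENNReal.ofReal p) (volume.restrict U)) {C : ℝ≥0∞} (hCt : C ≠ ⊤)
    (hC : ∀ f : E n → ℝ, ContDiff ℝ 1 f →
      ∫⁻ x, ‖f x‖ₑ ∂(surfaceMeasure U) ≤ C * ∫⁻ x in U, (‖f x‖ₑ + ‖fderiv ℝ f x‖ₑ))
    (hh : AEStronglyMeasurable h (surfaceMeasure U)) (hw0 : ∀ᵐ x ∂(volume.restrict U), 0 ≤ w x) :
    ∀ᵐ x ∂(surfaceMeasure U), 0 ≤ h x := by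
  -- apply the trace inequality to a function of `w` which vanishes where `w ≥ 0`
  set ρ : ℝ → ℝ := fun z => max (-z) 0 with hρ
  have hρc : Continuous ρ := by fun_prop
  have h1 := hA.trace_le hp hw hG hCt hC hρc (fun z => le_max_right _ _) hh
  have hz : ∀ z, 0 ≤ z → ρ z = 0 := fun z hz => max_eq_right (by linarith)
  have hpz : ∀ z, 0 ≤ z → prim ρ z = 0 := fun z hz' => by
    rw [prim, intervalIntegral.integral_congr (g := fun _ => 0), intervalIntegral.integral_zero]
    intro y hy
    rw [uIcc_of_le hz'] at hy
    exact hz y hy.1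
  have hpn : ∀ z, z < 0 → prim ρ z ≠ 0 := fun z hz' => by
    rw [prim, intervalIntegral.integral_symm, neg_ne_zero]
    refine (intervalIntegral.intervalIntegral_pos_of_pos_on (hρc.intervalIntegrable _ _)
      (fun y hy => ?_) hz').ne'
    exact lt_max_of_lt_left (by linarith [hy.2])
  have h2 : ∫⁻ x in U, (‖prim ρ (w x)‖ₑ + ‖ρ (w x)‖ₑ * ‖G x‖ₑ) = 0 := by
    rw [← lintegral_zero (μ := volume.restrict U)]
    refine lintegral_congr_ae ?_
    filter_upwards [hw0] with x hx
    rw [hz _ hx, hpz _ hx]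
    simp
  rw [h2, mul_zero, nonpos_iff_eq_zero, lintegral_eq_zero_iff'
    ((continuous_prim hρc).comp_aestronglyMeasurable hh).enorm] at h1
  filter_upwards [h1] with x hx
  by_contra! hlt
  exact hpn _ hlt (by simpa using hx)

/-! ### Averages in time -/

lemma tendsto_average {J : ℝ → ℝ} {c η₀ : ℝ} (hη₀ : 0 < η₀)
    (hJi : IntegrableOn J (Ioc 0 η₀)) (hJ : Tendsto J (𝓝[>] 0) (𝓝 c)) :
    Tendsto (fun η => η⁻¹ * ∫ r in Ioc 0 η, J r) (𝓝[>] 0) (𝓝 c) := by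
  rw [Metric.tendsto_nhds] at hJ ⊢
  intro ε hε
  obtain ⟨d, hd, hdb⟩ := mem_nhdsGT_iff_exists_Ioo_subset.1 (hJ (ε / 2) (by positivity))
  filter_upwards [Ioo_mem_nhdsGT (lt_min hd hη₀)] with η hη
  have hηd : η < d := hη.2.trans_le (min_le_left _ _)
  have hη0 : 0 < η := hη.1
  have hi : IntegrableOn J (Ioc 0 η) :=
    hJi.mono_set (Ioc_subset_Ioc le_rfl (hη.2.trans_le (min_le_right _ _)).le)
  have h1 : ‖∫ r in Ioc 0 η, (J r - c)‖ ≤ ε / 2 * η := by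
    have := norm_setIntegral_le_of_norm_le_const (μ := volume) (s := Ioc 0 η)
      (f := fun r => J r - c) (C := ε / 2) (by simp) fun r hr => by
        have := hdb ⟨hr.1, hr.2.trans_lt hηd⟩
        exact (le_of_lt this)
    simpa [hη0.le] using this
  have h2 : η⁻¹ * (∫ r in Ioc 0 η, J r) - c = η⁻¹ * ∫ r in Ioc 0 η, (J r - c) := by
    rw [integral_sub hi (by simp), setIntegral_const]
    simp only [Real.volume_real_Ioc_of_le hη0.le, smul_eq_mul, sub_zero]
    field_simp
  rw [Real.dist_eq, h2, abs_mul, abs_of_pos (inv_pos.2 hη0)]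
  calc η⁻¹ * |∫ r in Ioc 0 η, (J r - c)| ≤ η⁻¹ * (ε / 2 * η) :=
        mul_le_mul_of_nonneg_left h1 (inv_pos.2 hη0).le
    _ = ε / 2 := by field_simp
    _ < ε := by linarith

variable {n : ℕ} {V : Type*} [NormedAddCommGroup V] [InnerProductSpace ℝ V]

lemma measurePreserving_translate (μ : Measure (E n)) [IsFiniteMeasure μ] (r : ℝ) :
    MeasurePreserving (fun z : ℝ × E n => (z.1 - r, z.2)) ((volume : Measure ℝ).prod μ)
      ((volume : Measure ℝ).prod μ) :=
  (measurePreserving_sub_right volume r).prod (MeasurePreserving.id μ)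

/-- Translations in time are continuous in `L^q`, `1 ≤ q < ∞`. -/
lemma tendsto_translate {μ : Measure (E n)} [IsFiniteMeasure μ] {q : ℝ} (hq : 1 ≤ q)
    {F : ℝ × E n → V} (hF : MemLp F (ENNReal.ofReal q) ((volume : Measure ℝ).prod μ)) :
    Tendsto (fun r : ℝ => eLpNorm (fun z : ℝ × E n => F (z.1 - r, z.2) - F z) (ENNReal.ofReal q)
      ((volume : Measure ℝ).prod μ)) (𝓝 0) (𝓝 0) := by
  have hq0 : 0 < q := by linarith
  have hqE : (1 : ℝ≥0∞) ≤ ENNReal.ofReal q := by simpa using hq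
  set ν := (volume : Measure ℝ).prod μ with hν
  -- continuous functions with compact support
  have hcont : ∀ g : ℝ × E n → V, HasCompactSupport g → Continuous g →
      Tendsto (fun r : ℝ => eLpNorm (fun z : ℝ × E n => g (z.1 - r, z.2) - g z) (ENNReal.ofReal q)
        ν) (𝓝 0) (𝓝 0) := by
    intro g hg hgc
    obtain ⟨M, hM⟩ := hg.exists_bound_of_continuous hgc
    have hM0 : 0 ≤ M := (norm_nonneg _).trans (hM 0)
    set K : Set (ℝ × E n) := (fun y : ℝ × (ℝ × E n) => (y.2.1 + y.1, y.2.2)) ''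
      (Icc (-1) 1 ×ˢ tsupport g) with hK
    have hKc : IsCompact K := (isCompact_Icc.prod hg).image (by fun_prop)
    simp_rw [eLpNorm_ofReal_eq hq0]
    have hz : (0:ℝ≥0∞) = (∫⁻ _, 0 ∂ν) ^ (1 / q) := by
      rw [lintegral_zero, ENNReal.zero_rpow_of_pos (by positivity)]
    rw [hz]
    refine Tendsto.ennrpow_const _ ?_
    refine tendsto_lintegral_filter_of_dominated_convergence
      (K.indicator fun _ => ENNReal.ofReal (2 * M) ^ q) ?_ ?_ ?_ ?_
    · refine Eventually.of_forall fun r => ?_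
      have : Continuous fun z : ℝ × E n => ‖g (z.1 - r, z.2) - g z‖ₑ :=
        ((hgc.comp (by fun_prop)).sub hgc).enorm
      exact this.measurable.pow_const _
    · filter_upwards [Icc_mem_nhds (show (-1:ℝ) < 0 by norm_num) one_pos] with r hr
      refine ae_of_all _ fun z => ?_
      by_cases hzK : z ∈ K
      · rw [indicator_of_mem hzK]
        refine ENNReal.rpow_le_rpow ?_ hq0.le
        rw [← ofReal_norm]
        refine ENNReal.ofReal_le_ofReal ((norm_sub_le _ _).trans ?_)
        linarith [hM z, hM (z.1 - r, z.2)]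
      · have h1 : g (z.1 - r, z.2) = 0 := by
          by_contra hne
          exact hzK ⟨(r, (z.1 - r, z.2)), ⟨hr, subset_tsupport _ hne⟩, by simp⟩
        have h2 : g z = 0 := by
          by_contra hne
          exact hzK ⟨(0, z), ⟨⟨by norm_num, by norm_num⟩, subset_tsupport _ hne⟩, by simp⟩
        rw [h1, h2, sub_zero, enorm_zero, ENNReal.zero_rpow_of_pos hq0]
        exact zero_le
    · rw [lintegral_indicator hKc.measurableSet, setLIntegral_const]
      exact ENNReal.mul_ne_top (ENNReal.rpow_ne_top_of_nonneg hq0.le ENNReal.ofReal_ne_top)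
        hKc.measure_lt_top.ne
    · refine ae_of_all _ fun z => ?_
      have h1 : Continuous fun r : ℝ => ‖g (z.1 - r, z.2) - g z‖ₑ :=
        ((hgc.comp (by fun_prop)).sub continuous_const).enorm
      have h2 := (h1.tendsto 0).ennrpow_const q
      simpa [ENNReal.zero_rpow_of_pos hq0] using h2
  rw [ENNReal.tendsto_nhds_zero]
  intro ε hε
  have hε3 : ε / 3 ≠ 0 := (ENNReal.div_pos hε.ne' (by norm_num)).ne'
  obtain ⟨g, hg, hFg, hgc, hgm⟩ := hF.exists_hasCompactSupport_eLpNorm_sub_le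
    ENNReal.ofReal_ne_top hε3
  filter_upwards [ENNReal.tendsto_nhds_zero.1 (hcont g hg hgc) (ε / 3) hε3.bot_lt] with r hr
  have hT := measurePreserving_translate μ r
  have hm1 : AEStronglyMeasurable (fun z : ℝ × E n => F (z.1 - r, z.2) - g (z.1 - r, z.2)) ν :=
    (hF.1.sub hgm.1).comp_measurePreserving hT
  have hm2 : AEStronglyMeasurable (fun z : ℝ × E n => g (z.1 - r, z.2) - g z) ν :=
    (hgm.1.comp_measurePreserving hT).sub hgm.1
  have hm3 : AEStronglyMeasurable (fun z : ℝ × E n => g z - F z) ν := hgm.1.sub hF.1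
  have heq : (fun z : ℝ × E n => F (z.1 - r, z.2) - F z)
      = (fun z => F (z.1 - r, z.2) - g (z.1 - r, z.2)) + ((fun z => g (z.1 - r, z.2) - g z)
        + fun z => g z - F z) := by
    funext z; simp only [Pi.add_apply]; abel
  rw [heq]
  calc _ ≤ _ := eLpNorm_add_le hm1 (hm2.add hm3) hqE
    _ ≤ ε / 3 + (ε / 3 + ε / 3) := by
      refine add_le_add ?_ ((eLpNorm_add_le hm2 hm3 hqE).trans (add_le_add hr ?_))
      · have := eLpNorm_comp_measurePreserving (p := ENNReal.ofReal q) (hF.1.sub hgm.1) hT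
        exact (le_of_eq this).trans hFg
      · have := eLpNorm_sub_comm g F (ENNReal.ofReal q) ν
        exact (le_of_eq this).trans hFg
    _ = ε := by rw [← add_assoc]; exact ENNReal.add_thirds ε

lemma lintegral_enorm_inner_le {X : Type*} [MeasurableSpace X] {ν : Measure X} {q q' : ℝ≥0∞}
    [ENNReal.HolderConjugate q q'] {F G : X → V} (hF : AEStronglyMeasurable F ν)
    (hG : AEStronglyMeasurable G ν) :
    ∫⁻ z, ‖(inner ℝ (F z) (G z) : ℝ)‖ₑ ∂ν ≤ eLpNorm F q ν * eLpNorm G q' ν := by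
  have h := eLpNorm_le_eLpNorm_mul_eLpNorm_of_nnnorm (p := q) (q := q') (r := 1) hF hG
    (fun x y => (inner ℝ x y : ℝ)) 1 (ae_of_all _ fun x => by
      rw [one_mul]; exact nnnorm_inner_le_nnnorm _ _)
  rwa [eLpNorm_one_eq_lintegral_enorm, ENNReal.coe_one, one_mul] at h

lemma integrable_inner_of_memLp {X : Type*} [MeasurableSpace X] {ν : Measure X} {q q' : ℝ≥0∞}
    [ENNReal.HolderConjugate q q'] {F G : X → V} (hF : MemLp F q ν) (hG : MemLp G q' ν) :
    Integrable (fun z => (inner ℝ (F z) (G z) : ℝ)) ν :=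
  ⟨hF.1.inner hG.1, (lintegral_enorm_inner_le (q := q) (q' := q') hF.1 hG.1).trans_lt
    (ENNReal.mul_lt_top hF.2 hG.2)⟩

/-- The pairing of `G` with the time averages of `F`: it is integrable in time, and converges to the
pairing of `F` and `G`. -/
lemma tendsto_average_inner {μ : Measure (E n)} [IsFiniteMeasure μ] {q : ℝ} (hq : 1 ≤ q)
    {q' : ℝ≥0∞} [ENNReal.HolderConjugate (ENNReal.ofReal q) q'] {F G : ℝ × E n → V}
    (hFs : StronglyMeasurable F) (hGs : StronglyMeasurable G)
    (hF : MemLp F (ENNReal.ofReal q) ((volume : Measure ℝ).prod μ))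
    (hG : MemLp G q' ((volume : Measure ℝ).prod μ)) :
    (∀ η > 0, Integrable (fun τ : ℝ => ∫ r in Ioc (0:ℝ) η, ∫ x,
      (inner ℝ (F (τ - r, x)) (G (τ, x)) : ℝ) ∂μ)) ∧
    Tendsto (fun η : ℝ => η⁻¹ * ∫ τ : ℝ, ∫ r in Ioc (0:ℝ) η, ∫ x,
      (inner ℝ (F (τ - r, x)) (G (τ, x)) : ℝ) ∂μ) (𝓝[>] 0)
      (𝓝 (∫ z, (inner ℝ (F z) (G z) : ℝ) ∂((volume : Measure ℝ).prod μ))) := by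
  set ν := (volume : Measure ℝ).prod μ with hν
  set J : ℝ → ℝ := fun r => ∫ z : ℝ × E n, (inner ℝ (F (z.1 - r, z.2)) (G z) : ℝ) ∂ν with hJ
  have hFr : ∀ r : ℝ, MemLp (fun z : ℝ × E n => F (z.1 - r, z.2)) (ENNReal.ofReal q) ν := fun r =>
    hF.comp_measurePreserving (measurePreserving_translate μ r)
  have hFn : ∀ r : ℝ, eLpNorm (fun z : ℝ × E n => F (z.1 - r, z.2)) (ENNReal.ofReal q) ν
      = eLpNorm F (ENNReal.ofReal q) ν := fun r =>
    eLpNorm_comp_measurePreserving hF.1 (measurePreserving_translate μ r)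
  have hJint : ∀ r, Integrable (fun z : ℝ × E n => (inner ℝ (F (z.1 - r, z.2)) (G z) : ℝ)) ν :=
    fun r => integrable_inner_of_memLp (q := ENNReal.ofReal q) (q' := q') (hFr r) hG
  -- the integrand as a function of all three variables
  set Φ : (ℝ × ℝ) × E n → ℝ := fun y => inner ℝ (F (y.1.1 - y.1.2, y.2)) (G (y.1.1, y.2)) with hΦ
  have hΦm : StronglyMeasurable Φ := by
    refine StronglyMeasurable.inner (hFs.comp_measurable ?_) (hGs.comp_measurable ?_) <;> fun_prop
  have hΦi : ∀ η : ℝ, Integrable Φ (((volume : Measure ℝ).prod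
      ((volume : Measure ℝ).restrict (Ioc 0 η))).prod μ) := by
    intro η
    refine ⟨hΦm.aestronglyMeasurable, ?_⟩
    have hm : Measurable fun y => ‖Φ y‖ₑ := hΦm.enorm
    rw [HasFiniteIntegral, lintegral_prod _ hm.aemeasurable,
      lintegral_prod _ hm.lintegral_prod_right'.aemeasurable,
      lintegral_lintegral_swap hm.lintegral_prod_right'.aemeasurable]
    calc ∫⁻ r in Ioc 0 η, ∫⁻ τ : ℝ, ∫⁻ x, ‖Φ ((τ, r), x)‖ₑ ∂μ
        ≤ ∫⁻ r in Ioc 0 η, eLpNorm F (ENNReal.ofReal q) ν * eLpNorm G q' ν := by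
          refine lintegral_mono fun r => ?_
          have hm' : Measurable fun z : ℝ × E n => ‖Φ ((z.1, r), z.2)‖ₑ := by
            exact hm.comp (by fun_prop)
          rw [← lintegral_prod (fun z : ℝ × E n => ‖Φ ((z.1, r), z.2)‖ₑ) hm'.aemeasurable, ← hFn r]
          exact lintegral_enorm_inner_le (q := ENNReal.ofReal q) (q' := q') (hFr r).1 hG.1
      _ < ⊤ := by
          rw [setLIntegral_const]
          exact ENNReal.mul_lt_top (ENNReal.mul_lt_top hF.2 hG.2) (by simp)
  have hΦi2 : ∀ η : ℝ, Integrable (fun y : ℝ × ℝ => ∫ x, Φ (y, x) ∂μ) ((volume : Measure ℝ).prod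
      ((volume : Measure ℝ).restrict (Ioc 0 η))) := fun η => (hΦi η).integral_prod_left
  have hswap : ∀ η : ℝ, ∫ τ : ℝ, ∫ r in Ioc (0:ℝ) η, ∫ x,
      (inner ℝ (F (τ - r, x)) (G (τ, x)) : ℝ) ∂μ = ∫ r in Ioc 0 η, J r := by
    intro η
    have h1 := integral_integral_swap (f := fun τ r => ∫ x, Φ ((τ, r), x) ∂μ) (hΦi2 η)
    refine h1.trans (integral_congr_ae (ae_of_all _ fun r => ?_))
    exact (integral_prod (fun z : ℝ × E n => (inner ℝ (F (z.1 - r, z.2)) (G z) : ℝ))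
      (hJint r)).symm
  have hJi : IntegrableOn J (Ioc 0 1) := by
    have h1 := (hΦi2 1).integral_prod_right
    refine h1.congr (ae_of_all _ fun r => ?_)
    exact (integral_prod (fun z : ℝ × E n => (inner ℝ (F (z.1 - r, z.2)) (G z) : ℝ))
      (hJint r)).symm
  refine ⟨fun η _ => (hΦi2 η).integral_prod_left, ?_⟩
  simp_rw [hswap]
  refine tendsto_average one_pos hJi ?_
  refine Tendsto.mono_left ?_ nhdsWithin_le_nhds
  have h0 : ∫ z, (inner ℝ (F z) (G z) : ℝ) ∂ν = J 0 := by simp [hJ]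
  rw [h0, tendsto_iff_edist_tendsto_0]
  refine tendsto_of_tendsto_of_tendsto_of_le_of_le tendsto_const_nhds
    (h := fun r => eLpNorm (fun z : ℝ × E n => F (z.1 - r, z.2) - F z) (ENNReal.ofReal q) ν
      * eLpNorm G q' ν) ?_ (fun r => zero_le) fun r => ?_
  · simpa using ENNReal.Tendsto.mul_const (tendsto_translate hq hF) (Or.inr hG.2.ne)
  · refine le_trans ?_ (lintegral_enorm_inner_le (q := ENNReal.ofReal q) (q' := q')
      ((hFr r).1.sub hF.1) hG.1)
    rw [edist_eq_enorm_sub, hJ]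
    simp only
    rw [← integral_sub (hJint r) (hJint 0)]
    refine (enorm_integral_le_lintegral_enorm _).trans (le_of_eq ?_)
    refine lintegral_congr fun z => ?_
    simp only [inner_sub_left, sub_zero, Prod.mk.eta]

/-! ### The weak formulation tested with functions of a weakly differentiable function -/

lemma eLpNorm_comp_snd {n : ℕ} {F : Type*} [NormedAddCommGroup F] {m : Measure ℝ}
    {μ : Measure (E n)} [IsFiniteMeasure m] [IsFiniteMeasure μ]
    {q : ℝ} (hq : 0 < q) {b : E n → F} (hb : AEStronglyMeasurable b μ) :
    eLpNorm (fun z : ℝ × E n => b z.2) (ENNReal.ofReal q) (m.prod μ)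
      = m univ ^ (1 / q) * eLpNorm b (ENNReal.ofReal q) μ := by
  have hm : AEMeasurable (fun z : ℝ × E n => ‖b z.2‖ₑ ^ q) (m.prod μ) :=
    (hb.comp_snd.enorm).pow_const q
  rw [eLpNorm_ofReal_eq hq, eLpNorm_ofReal_eq hq, lintegral_prod _ hm]
  simp only [lintegral_const]
  rw [mul_comm, ENNReal.mul_rpow_of_nonneg _ _ (by positivity)]

section Pairing

variable {n : ℕ} {V : Type*} [NormedAddCommGroup V] [InnerProductSpace ℝ V]

/-- Pairings with a fixed `F ∈ L^{q'}` pass to the limit under convergence in `L^q`. -/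
lemma tendsto_integral_inner {m : Measure ℝ} {μ : Measure (E n)} [IsFiniteMeasure m]
    [IsFiniteMeasure μ] {q : ℝ} (hq : 1 ≤ q) {q' : ℝ≥0∞}
    [ENNReal.HolderConjugate q' (ENNReal.ofReal q)] {F : ℝ × E n → V} (hF : MemLp F q' (m.prod μ))
    {b : ℕ → E n → V} {c : E n → V} (hb : ∀ k, AEStronglyMeasurable (b k) μ)
    (hc : MemLp c (ENNReal.ofReal q) μ)
    (hbc : Tendsto (fun k => eLpNorm (fun x => b k x - c x) (ENNReal.ofReal q) μ) atTop (𝓝 0)) :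
    Tendsto (fun k => ∫ σ, ∫ x, (inner ℝ (F (σ, x)) (b k x) : ℝ) ∂μ ∂m) atTop
      (𝓝 (∫ σ, ∫ x, (inner ℝ (F (σ, x)) (c x) : ℝ) ∂μ ∂m)) := by
  have hq0 : 0 < q := by linarith
  have hlift : ∀ d : E n → V, MemLp d (ENNReal.ofReal q) μ →
      MemLp (fun z : ℝ × E n => d z.2) (ENNReal.ofReal q) (m.prod μ) := fun d hd =>
    ⟨hd.1.comp_snd, by
      rw [eLpNorm_comp_snd hq0 hd.1]
      exact ENNReal.mul_lt_top (ENNReal.rpow_lt_top_of_nonneg (by positivity) (measure_ne_top _ _))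
        hd.2⟩
  have hint : ∀ d : E n → V, MemLp d (ENNReal.ofReal q) μ →
      Integrable (fun z : ℝ × E n => (inner ℝ (F z) (d z.2) : ℝ)) (m.prod μ) := fun d hd =>
    integrable_inner_of_memLp hF (hlift d hd)
  rw [tendsto_iff_edist_tendsto_0]
  have hbound : Tendsto (fun k => eLpNorm F q' (m.prod μ) * (m univ ^ (1 / q) *
      eLpNorm (fun x => b k x - c x) (ENNReal.ofReal q) μ)) atTop (𝓝 0) := by
    have h1 := ENNReal.Tendsto.const_mul (ENNReal.Tendsto.const_mul hbc (a := m univ ^ (1 / q))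
      (Or.inr (ENNReal.rpow_ne_top_of_nonneg (by positivity) (measure_ne_top _ _))))
      (Or.inr hF.2.ne)
    simpa using h1
  refine tendsto_of_tendsto_of_tendsto_of_le_of_le' tendsto_const_nhds hbound
    (Eventually.of_forall fun k => zero_le) ?_
  filter_upwards [hbc.eventually_lt_const one_pos] with k hk
  have hbck : MemLp (fun x => b k x - c x) (ENNReal.ofReal q) μ :=
    ⟨(hb k).sub hc.1, hk.trans ENNReal.one_lt_top⟩
  have hbk : MemLp (b k) (ENNReal.ofReal q) μ := by
    have := hbck.add hc
    refine this.ae_eq (ae_of_all _ fun x => ?_)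
    simp
  have e1 := integral_prod (fun z : ℝ × E n => (inner ℝ (F z) (b k z.2) : ℝ)) (hint _ hbk)
  have e2 := integral_prod (fun z : ℝ × E n => (inner ℝ (F z) (c z.2) : ℝ)) (hint _ hc)
  rw [← e1, ← e2, edist_eq_enorm_sub, ← integral_sub (hint _ hbk) (hint _ hc)]
  refine (enorm_integral_le_lintegral_enorm _).trans ?_
  rw [← eLpNorm_comp_snd hq0 hbck.1]
  refine le_trans (le_of_eq (lintegral_congr fun z => ?_))
    (lintegral_enorm_inner_le hF.1 (hlift _ hbck).1)
  rw [inner_sub_right]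

end Pairing

/-- The regularity of a solution at almost every time: an approximable function, its gradient and
its boundary values. -/
structure IsRegular {n : ℕ} (U : Set (E n)) (p : ℝ) (w : E n → ℝ) (G : E n → E n) (h : E n → ℝ) :
    Prop where
  aesm : AEStronglyMeasurable w (volume.restrict U)
  memLp : MemLp G (ENNReal.ofReal p) (volume.restrict U)
  aesm_boundary : AEStronglyMeasurable h (surfaceMeasure U)
  approx : ∃ v, Approximates U p v w G h

section Solution

variable {n : ℕ} {U : Set (E n)} {g : GenPoly} {lam α T : ℝ} {φ : ℝ → E n → ℝ} {u₀ : E n → ℝ}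
  {u : ℝ → E n → ℝ} {Du : ℝ → E n → E n} {tr : ℝ → E n → ℝ}

/-- The flux `K(|∇u|)∇u` is in the dual space `L^{(2-a)/(1-a)}`. -/
lemma memLp_flux (g : GenPoly) {X : Type*} [MeasurableSpace X] {ν : Measure X} {G : X → E n}
    (hG : MemLp G (ENNReal.ofReal (2 - g.a)) ν) :
    MemLp (fun z => g.K ‖G z‖ • G z) (ENNReal.ofReal ((2 - g.a) / (1 - g.a))) ν := by
  have ha : 0 < 1 - g.a := by linarith [g.a_lt_one]
  obtain ⟨C, hC0, hC⟩ := g.exists_sOf_le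
  have h1 := hG.norm_rpow_div (ENNReal.ofReal (1 - g.a))
  rw [← ENNReal.ofReal_div_of_pos ha, ENNReal.toReal_ofReal ha.le] at h1
  refine MemLp.of_le_mul (c := C) h1 ?_ (ae_of_all _ fun z => ?_)
  · exact ((g.measurable_K.comp_aemeasurable hG.1.norm.aemeasurable).aestronglyMeasurable).smul hG.1
  · rw [norm_smul, Real.norm_of_nonneg (g.K_nonneg _), g.K_mul_self (norm_nonneg _),
      Real.norm_of_nonneg (by positivity)]
    exact hC _ (norm_nonneg _)

lemma holderConjugate_flux (g : GenPoly) :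
    Real.HolderConjugate (2 - g.a) ((2 - g.a) / (1 - g.a)) := by
  have ha : 0 < 1 - g.a := by linarith [g.a_lt_one]
  have h := Real.HolderConjugate.conjExponent (p := 2 - g.a) (by linarith)
  have e : (2 - g.a).conjExponent = (2 - g.a) / (1 - g.a) := by
    rw [Real.conjExponent]; congr 1; ring
  rwa [e] at h

lemma IsWeakSolution.ae_isRegular [IsFiniteMeasure (surfaceMeasure U)]
    (hsol : IsWeakSolution U g lam α T φ u₀ u Du tr) :
    ∀ᵐ τ ∂(volume.restrict (Ioc 0 T)), IsRegular U (2 - g.a) (u τ) (Du τ) (tr τ) := by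
  have hp : 0 < 2 - g.a := by linarith [g.a_lt_one]
  have hslice : ∀ᵐ τ ∂(volume.restrict (Ioc 0 T)),
      MemLp (Du τ) (ENNReal.ofReal (2 - g.a)) (volume.restrict U) := by
    have hk : ∀ k : ℕ, ∀ᵐ τ ∂(volume.restrict (Ioc (1 / ((k:ℝ) + 1)) T)),
        MemLp (Du τ) (ENNReal.ofReal (2 - g.a)) (volume.restrict U) := by
      intro k
      have h1 := hsol.memLp_Du (1 / ((k:ℝ) + 1)) (by positivity)
      have h2 := h1.integrable_norm_rpow (by simpa using hp) ENNReal.ofReal_ne_top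
      filter_upwards [h2.prod_right_ae, h1.1.prodMk_left] with τ h3 h4
      exact (integrable_norm_rpow_iff h4 (by simpa using hp) ENNReal.ofReal_ne_top).1 h3
    have hU : Ioc 0 T ⊆ ⋃ k : ℕ, Ioc (1 / ((k:ℝ) + 1)) T := by
      intro t ht
      obtain ⟨k, hk⟩ := exists_nat_one_div_lt ht.1
      exact mem_iUnion.2 ⟨k, hk, ht.2⟩
    exact ae_restrict_of_ae_restrict_of_subset hU ((ae_restrict_iUnion_iff _ _).2 hk)
  filter_upwards [hslice, hsol.meas_u.prodMk_left, hsol.meas_tr.prodMk_left, hsol.hasTrace]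
    with τ h1 h2 h3 h4
  exact ⟨h2, h1, h3, h4.exists_approximates hp h2 h3⟩

lemma IsWeakSolution.integrable_rpow [IsFiniteMeasure (volume.restrict U)]
    (hsol : IsWeakSolution U g lam α T φ u₀ u Du tr) {β : ℝ} (hβ : 0 < β) (hβα : β ≤ α)
    {t : ℝ} (ht : t ∈ Icc 0 T) : Integrable (fun x => u t x ^ β) (volume.restrict U) := by
  have h1 := hsol.continuousInLp.1 t ht
  have h2 : MemLp (u t) (ENNReal.ofReal β) (volume.restrict U) :=
    h1.mono_exponent (ENNReal.ofReal_le_ofReal hβα)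
  have h3 := h2.integrable_norm_rpow (by simpa using hβ) ENNReal.ofReal_ne_top
  refine h3.congr ?_
  filter_upwards [hsol.nonneg t ht] with x hx
  rw [ENNReal.toReal_ofReal hβ.le, Real.norm_of_nonneg hx]

/-- The weak formulation on `(τ₁, τ₂)` with the test function `∫₀^w ρ`, for a bounded density `ρ`
with bounded primitive, and a weakly differentiable function `w` with gradient `G` and boundary
values `h`. -/
lemma IsWeakSolution.weak_form_prim [IsFiniteMeasure (volume.restrict U)]
    [IsFiniteMeasure (surfaceMeasure U)]
    (hsol : IsWeakSolution U g lam α T φ u₀ u Du tr) (hlam : 0 < lam) (hlamα : lam ≤ α)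
    {τ₁ τ₂ : ℝ} (h1 : 0 < τ₁) (h12 : τ₁ < τ₂) (h2 : τ₂ ≤ T)
    {w : E n → ℝ} {G : E n → E n} {h : E n → ℝ} (hreg : IsRegular U (2 - g.a) w G h)
    {ρ : ℝ → ℝ} (hρ : Continuous ρ) {L B : ℝ} (hL : ∀ z, |ρ z| ≤ L) (hB : ∀ z, |prim ρ z| ≤ B) :
    ∫ x in U, (u τ₂ x ^ lam - u τ₁ x ^ lam) * prim ρ (w x)
      = - (∫ σ in Ioc τ₁ τ₂, ∫ x in U,
            (inner ℝ (g.K ‖Du σ x‖ • Du σ x) (ρ (w x) • G x) : ℝ))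
        - ∫ σ in Ioc τ₁ τ₂, ∫ x, φ σ x * tr σ x ^ lam * prim ρ (h x) ∂(surfaceMeasure U) := by
  have hp1 : 1 ≤ 2 - g.a := by linarith [g.a_lt_one]
  obtain ⟨v, hv⟩ := hreg.approx
  have hΘ := contDiff_prim hρ
  have hA := hv.comp hp1 hreg.aesm hreg.memLp hΘ (L := L) (by rwa [deriv_prim hρ])
  rw [deriv_prim hρ] at hA
  have hI1 := hsol.integrable_rpow hlam hlamα (t := τ₁) ⟨h1.le, h12.le.trans h2⟩
  have hI2 := hsol.integrable_rpow hlam hlamα (t := τ₂) ⟨(h1.trans h12).le, h2⟩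
  -- the weak formulation along the approximating sequence
  have hk : ∀ k, ∫ x in U, (u τ₂ x ^ lam - u τ₁ x ^ lam) * prim ρ (v k x)
      = - (∫ σ in Ioc τ₁ τ₂, ∫ x in U,
            (inner ℝ (g.K ‖Du σ x‖ • Du σ x) (gradient (fun x => prim ρ (v k x)) x) : ℝ))
        - ∫ σ in Ioc τ₁ τ₂, ∫ x, φ σ x * tr σ x ^ lam * prim ρ (v k x) ∂(surfaceMeasure U) := by
    intro k
    have h := hsol.weak_form τ₁ τ₂ h1 h12 h2 _ (hA.contDiff k)
    rw [intervalIntegral.integral_of_le h12.le, intervalIntegral.integral_of_le h12.le] at h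
    simp_rw [real_inner_smul_left]
    rw [← h, ← integral_sub]
    · simp_rw [sub_mul]
    · exact hI2.mul_bdd (hA.contDiff k).continuous.aestronglyMeasurable (ae_of_all _ fun x => hB _)
    · exact hI1.mul_bdd (hA.contDiff k).continuous.aestronglyMeasurable (ae_of_all _ fun x => hB _)
  have hl1 : Tendsto (fun k => ∫ x in U, (u τ₂ x ^ lam - u τ₁ x ^ lam) * prim ρ (v k x)) atTop
      (𝓝 (∫ x in U, (u τ₂ x ^ lam - u τ₁ x ^ lam) * prim ρ (w x))) := by
    refine tendsto_integral_of_dominated_convergence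
      (fun x => ‖u τ₂ x ^ lam - u τ₁ x ^ lam‖ * B) (fun k => ?_) ((hI2.sub hI1).norm.mul_const B)
      (fun k => ae_of_all _ fun x => ?_) ?_
    · exact (hI2.sub hI1).1.mul (hA.contDiff k).continuous.aestronglyMeasurable
    · rw [norm_mul]
      exact mul_le_mul_of_nonneg_left (hB _) (norm_nonneg _)
    · filter_upwards [hA.ae_tendsto] with x hx using hx.const_mul _
  have hconj : ENNReal.HolderConjugate (ENNReal.ofReal ((2 - g.a) / (1 - g.a)))
      (ENNReal.ofReal (2 - g.a)) := (holderConjugate_flux g).symm.ennrealOfReal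
  have hL' : MemLp (fun x => ρ (w x) • G x) (ENNReal.ofReal (2 - g.a)) (volume.restrict U) := by
    refine MemLp.of_le_mul (c := L) hreg.memLp
      ((hρ.comp_aestronglyMeasurable hreg.aesm).smul hreg.memLp.1) (ae_of_all _ fun x => ?_)
    rw [norm_smul]
    exact mul_le_mul_of_nonneg_right (hL _) (norm_nonneg _)
  have hDu : MemLp (Function.uncurry Du) (ENNReal.ofReal (2 - g.a))
      ((volume.restrict (Ioc τ₁ τ₂)).prod (volume.restrict U)) :=
    (hsol.memLp_Du τ₁ h1).mono_measure
      (Measure.prod_mono (Measure.restrict_mono (Ioc_subset_Ioc le_rfl h2) le_rfl) le_rfl)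
  have hl2 := tendsto_integral_inner (m := volume.restrict (Ioc τ₁ τ₂)) (μ := volume.restrict U)
    hp1 (memLp_flux g hDu) (fun k => (continuous_gradient (hA.contDiff k)).aestronglyMeasurable)
    hL' hA.tendsto_gradient
  have hl3 : Tendsto (fun k => ∫ σ in Ioc τ₁ τ₂, ∫ x, φ σ x * tr σ x ^ lam * prim ρ (v k x)
      ∂(surfaceMeasure U)) atTop (𝓝 (∫ σ in Ioc τ₁ τ₂, ∫ x, φ σ x * tr σ x ^ lam * prim ρ (h x)
        ∂(surfaceMeasure U))) := by
    have hfl : Integrable (fun z : ℝ × E n => φ z.1 z.2 * tr z.1 z.2 ^ lam)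
        ((volume.restrict (Ioc τ₁ τ₂)).prod (surfaceMeasure U)) :=
      (hsol.integrable_flux τ₁ h1).mono_measure
        (Measure.prod_mono (Measure.restrict_mono (Ioc_subset_Ioc le_rfl h2) le_rfl) le_rfl)
    have hhm : AEStronglyMeasurable (fun z : ℝ × E n => prim ρ (h z.2))
        ((volume.restrict (Ioc τ₁ τ₂)).prod (surfaceMeasure U)) :=
      (hΘ.continuous.comp_aestronglyMeasurable hreg.aesm_boundary).comp_snd
    have hvm : ∀ k, AEStronglyMeasurable (fun z : ℝ × E n => prim ρ (v k z.2))
        ((volume.restrict (Ioc τ₁ τ₂)).prod (surfaceMeasure U)) := fun k =>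
      ((hA.contDiff k).continuous.comp continuous_snd).aestronglyMeasurable
    have e1 := fun k => integral_prod (fun z : ℝ × E n => φ z.1 z.2 * tr z.1 z.2 ^ lam
      * prim ρ (v k z.2)) (hfl.mul_bdd (hvm k) (ae_of_all _ fun z => hB _))
    have e2 := integral_prod (fun z : ℝ × E n => φ z.1 z.2 * tr z.1 z.2 ^ lam
      * prim ρ (h z.2)) (hfl.mul_bdd hhm (ae_of_all _ fun z => hB _))
    simp only at e1 e2
    rw [← e2]
    simp_rw [← e1]
    refine tendsto_integral_of_dominated_convergence
      (fun z => ‖φ z.1 z.2 * tr z.1 z.2 ^ lam‖ * B) (fun k => hfl.1.mul (hvm k))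
      (hfl.norm.mul_const B) (fun k => ae_of_all _ fun z => ?_) ?_
    · rw [norm_mul]
      exact mul_le_mul_of_nonneg_left (hB _) (norm_nonneg _)
    · filter_upwards [Measure.quasiMeasurePreserving_snd.ae hA.ae_tendsto_boundary] with z hz
        using hz.const_mul _
  exact tendsto_nhds_unique hl1 ((hl2.neg.sub hl3).congr fun k => (hk k).symm)

end Solution

/-! ### The energy inequality -/

lemma prod_restrict_univ {X : Type*} [MeasurableSpace X] (μ : Measure X) [SFinite μ] (S : Set ℝ) :
    ((volume : Measure ℝ).prod μ).restrict (S ×ˢ univ) = (volume.restrict S).prod μ := by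
  rw [← Measure.prod_restrict, Measure.restrict_univ]

/-- `tendsto_average_inner` for functions given on time intervals. -/
lemma tendsto_average_inner_Ioc {n : ℕ} {V : Type*} [NormedAddCommGroup V] [InnerProductSpace ℝ V]
    {μ : Measure (E n)} [IsFiniteMeasure μ] {q : ℝ} (hq : 1 ≤ q)
    {q' : ℝ≥0∞} [ENNReal.HolderConjugate (ENNReal.ofReal q) q'] {ε s t T : ℝ} (hεs : ε < s)
    (htT : t ≤ T) {F G : ℝ × E n → V}
    (hF : MemLp F (ENNReal.ofReal q) ((volume.restrict (Ioc ε T)).prod μ))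
    (hG : MemLp G q' ((volume.restrict (Ioc s t)).prod μ)) :
    (∀ η ∈ Ioo 0 (s - ε), IntegrableOn (fun τ : ℝ => ∫ σ in Ioc (τ - η) τ, ∫ x,
      (inner ℝ (F (σ, x)) (G (τ, x)) : ℝ) ∂μ) (Ioc s t)) ∧
    Tendsto (fun η : ℝ => η⁻¹ * ∫ τ in Ioc s t, ∫ σ in Ioc (τ - η) τ, ∫ x,
      (inner ℝ (F (σ, x)) (G (τ, x)) : ℝ) ∂μ) (𝓝[>] 0)
      (𝓝 (∫ z, (inner ℝ (F z) (G z) : ℝ) ∂((volume.restrict (Ioc s t)).prod μ))) := by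
  set F' := (Ioc ε T ×ˢ univ).indicator (hF.1.mk F) with hF'
  set G' := (Ioc s t ×ˢ univ).indicator (hG.1.mk G) with hG'
  have hS : MeasurableSet (Ioc ε T ×ˢ (univ : Set (E n))) := measurableSet_Ioc.prod .univ
  have hS' : MeasurableSet (Ioc s t ×ˢ (univ : Set (E n))) := measurableSet_Ioc.prod .univ
  have hFs : StronglyMeasurable F' := hF.1.stronglyMeasurable_mk.indicator hS
  have hGs : StronglyMeasurable G' := hG.1.stronglyMeasurable_mk.indicator hS'
  have hFm : MemLp F' (ENNReal.ofReal q) ((volume : Measure ℝ).prod μ) := by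
    rw [hF', memLp_indicator_iff_restrict hS, prod_restrict_univ]
    exact hF.ae_eq hF.1.ae_eq_mk
  have hGm : MemLp G' q' ((volume : Measure ℝ).prod μ) := by
    rw [hG', memLp_indicator_iff_restrict hS', prod_restrict_univ]
    exact hG.ae_eq hG.1.ae_eq_mk
  obtain ⟨hint, hlim⟩ := tendsto_average_inner hq hFs hGs hFm hGm
  have hFae : ∀ᵐ σ ∂(volume.restrict (Ioc ε T)), ∀ᵐ x ∂μ, F (σ, x) = F' (σ, x) := by
    filter_upwards [Measure.ae_ae_of_ae_prod hF.1.ae_eq_mk,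
      ae_restrict_mem (μ := (volume : Measure ℝ)) (measurableSet_Ioc (a := ε) (b := T))] with σ h1 h2
    filter_upwards [h1] with x hx
    rw [hF', indicator_of_mem (show (σ, x) ∈ Ioc ε T ×ˢ univ from ⟨h2, mem_univ _⟩), hx]
  have hGae : ∀ᵐ τ ∂(volume.restrict (Ioc s t)), ∀ᵐ x ∂μ, G (τ, x) = G' (τ, x) := by
    filter_upwards [Measure.ae_ae_of_ae_prod hG.1.ae_eq_mk,
      ae_restrict_mem (μ := (volume : Measure ℝ)) (measurableSet_Ioc (a := s) (b := t))] with σ h1 h2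
    filter_upwards [h1] with x hx
    rw [hG', indicator_of_mem (show (σ, x) ∈ Ioc s t ×ˢ univ from ⟨h2, mem_univ _⟩), hx]
  have heq : ∀ η ∈ Ioo 0 (s - ε), ∀ᵐ τ ∂(volume.restrict (Ioc s t)),
      (∫ r in Ioc (0:ℝ) η, ∫ x, (inner ℝ (F' (τ - r, x)) (G' (τ, x)) : ℝ) ∂μ)
        = ∫ σ in Ioc (τ - η) τ, ∫ x, (inner ℝ (F (σ, x)) (G (τ, x)) : ℝ) ∂μ := by
    intro η hη
    filter_upwards [hGae,
      ae_restrict_mem (μ := (volume : Measure ℝ)) (measurableSet_Ioc (a := s) (b := t))] with τ h1 h2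
    have e1 : ∫ r in Ioc (0:ℝ) η, ∫ x, (inner ℝ (F' (τ - r, x)) (G' (τ, x)) : ℝ) ∂μ
        = ∫ σ in Ioc (τ - η) τ, ∫ x, (inner ℝ (F' (σ, x)) (G' (τ, x)) : ℝ) ∂μ := by
      rw [← intervalIntegral.integral_of_le hη.1.le,
        ← intervalIntegral.integral_of_le (by linarith [hη.1])]
      have := intervalIntegral.integral_comp_sub_left (a := 0) (b := η)
        (fun σ => ∫ x, (inner ℝ (F' (σ, x)) (G' (τ, x)) : ℝ) ∂μ) τ
      rwa [sub_zero] at this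
    rw [e1]
    refine integral_congr_ae ?_
    have hsub : Ioc (τ - η) τ ⊆ Ioc ε T :=
      Ioc_subset_Ioc (by linarith [hη.2, h2.1]) (h2.2.trans htT)
    filter_upwards [ae_restrict_of_ae_restrict_of_subset hsub hFae] with σ h3
    refine integral_congr_ae ?_
    filter_upwards [h1, h3] with x h4 h5
    rw [h4, h5]
  have hz : ∀ η τ, τ ∉ Ioc s t →
      (∫ r in Ioc (0:ℝ) η, ∫ x, (inner ℝ (F' (τ - r, x)) (G' (τ, x)) : ℝ) ∂μ) = 0 := by
    intro η τ hτ
    have : ∀ x, G' (τ, x) = 0 := fun x => by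
      rw [hG', indicator_of_notMem]
      exact fun h => hτ h.1
    simp [this]
  refine ⟨fun η hη => (hint η hη.1).integrableOn.congr (heq η hη), ?_⟩
  have hval : ∫ z, (inner ℝ (F' z) (G' z) : ℝ) ∂((volume : Measure ℝ).prod μ)
      = ∫ z, (inner ℝ (F z) (G z) : ℝ) ∂((volume.restrict (Ioc s t)).prod μ) := by
    have h1 : (fun z => (inner ℝ (F' z) (G' z) : ℝ))
        = (Ioc s t ×ˢ univ).indicator fun z => (inner ℝ (F' z) (hG.1.mk G z) : ℝ) := by
      funext z
      by_cases hzS : z ∈ Ioc s t ×ˢ (univ : Set (E n))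
      · rw [indicator_of_mem hzS, hG', indicator_of_mem hzS]
      · rw [indicator_of_notMem hzS, hG', indicator_of_notMem hzS, inner_zero_right]
    rw [h1, integral_indicator hS', prod_restrict_univ]
    refine integral_congr_ae ?_
    have hle : (volume.restrict (Ioc s t)).prod μ ≤ (volume.restrict (Ioc ε T)).prod μ :=
      Measure.prod_mono (Measure.restrict_mono (Ioc_subset_Ioc hεs.le htT) le_rfl) le_rfl
    have hmem : ∀ᵐ z ∂((volume.restrict (Ioc s t)).prod μ), z ∈ Ioc s t ×ˢ (univ : Set (E n)) := by
      rw [← prod_restrict_univ]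
      exact ae_restrict_mem hS'
    filter_upwards [hG.1.ae_eq_mk, (Measure.absolutelyContinuous_of_le hle).ae_le hF.1.ae_eq_mk,
      hmem] with z h2 h3 h4
    rw [hF', indicator_of_mem (show z ∈ Ioc ε T ×ˢ univ from
      ⟨⟨hεs.trans h4.1.1, h4.1.2.trans htT⟩, mem_univ _⟩), ← h2, ← h3]
  rw [hval] at hlim
  refine hlim.congr' ?_
  filter_upwards [Ioo_mem_nhdsGT (sub_pos.2 hεs)] with η hη
  congr 1
  rw [← setIntegral_eq_integral_of_forall_compl_eq_zero (hz η)]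
  exact integral_congr_ae (heq η hη)

/-- The storage function: the convex function `y ↦ ∫₀^y (∫₀^{·^{1/λ}} ρ)` evaluated at `z^λ`. Its
derivative with respect to `z^λ` is `∫₀^z ρ`. -/
def storage (lam : ℝ) (ρ : ℝ → ℝ) (z : ℝ) : ℝ := prim (fun y => prim ρ (y ^ (1 / lam))) (z ^ lam)

section Storage

variable {lam : ℝ} {ρ : ℝ → ℝ}

lemma continuous_prim_rpow (hlam : 0 < lam) (hρ : Continuous ρ) :
    Continuous fun y : ℝ => prim ρ (y ^ (1 / lam)) :=
  (continuous_prim hρ).comp (Real.continuous_rpow_const (by positivity))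

lemma continuous_storage (hlam : 0 < lam) (hρ : Continuous ρ) : Continuous (storage lam ρ) :=
  (continuous_prim (continuous_prim_rpow hlam hρ)).comp (Real.continuous_rpow_const hlam.le)

lemma prim_mono (hρ : Continuous ρ) (h0 : ∀ z, 0 ≤ ρ z) : Monotone (prim ρ) :=
  monotone_of_deriv_nonneg ((contDiff_prim hρ).differentiable one_ne_zero)
    (by rw [deriv_prim hρ]; exact h0)

lemma storage_nonneg (h0 : ∀ z, 0 ≤ ρ z) {z : ℝ} (hz : 0 ≤ z) :
    0 ≤ storage lam ρ z :=
  intervalIntegral.integral_nonneg (Real.rpow_nonneg hz _) fun _ hy =>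
    prim_nonneg h0 (Real.rpow_nonneg hy.1 _)

lemma storage_sub (hlam : 0 < lam) (hρ : Continuous ρ) (x y : ℝ) :
    storage lam ρ x - storage lam ρ y
      = ∫ z in (y ^ lam)..(x ^ lam), prim ρ (z ^ (1 / lam)) := by
  have hc := continuous_prim_rpow hlam hρ
  rw [storage, storage, prim, prim, intervalIntegral.integral_interval_sub_left] <;>
    exact hc.intervalIntegrable _ _

/-- Convexity of the storage function. -/
lemma storage_sub_le (hlam : 0 < lam) (hρ : Continuous ρ) (h0 : ∀ z, 0 ≤ ρ z) {x y : ℝ}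
    (hx : 0 ≤ x) (hy : 0 ≤ y) :
    storage lam ρ x - storage lam ρ y ≤ (x ^ lam - y ^ lam) * prim ρ x := by
  have hc := continuous_prim_rpow hlam hρ
  have hxx : (x ^ lam) ^ (1 / lam) = x := by
    rw [← Real.rpow_mul hx, mul_one_div_cancel hlam.ne', Real.rpow_one]
  have hm : ∀ a b : ℝ, 0 ≤ a → a ≤ b → prim ρ (a ^ (1 / lam)) ≤ prim ρ (b ^ (1 / lam)) :=
    fun a b ha hab => prim_mono hρ h0 (Real.rpow_le_rpow ha hab (by positivity))
  rw [storage_sub hlam hρ]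
  have hx' : 0 ≤ x ^ lam := Real.rpow_nonneg hx _
  have hy' : 0 ≤ y ^ lam := Real.rpow_nonneg hy _
  rcases le_total (y ^ lam) (x ^ lam) with h | h
  · calc _ ≤ ∫ _ in (y ^ lam)..(x ^ lam), prim ρ x := by
          refine intervalIntegral.integral_mono_on h (hc.intervalIntegrable _ _) (by simp)
            fun z hz => ?_
          have := hm z (x ^ lam) (hy'.trans hz.1) hz.2
          rwa [hxx] at this
      _ = _ := by simp
  · rw [intervalIntegral.integral_symm]
    have : ∫ _ in (x ^ lam)..(y ^ lam), prim ρ x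
        ≤ ∫ z in (x ^ lam)..(y ^ lam), prim ρ (z ^ (1 / lam)) := by
      refine intervalIntegral.integral_mono_on h (by simp) (hc.intervalIntegrable _ _)
        fun z hz => ?_
      have := hm (x ^ lam) z hx' hz.1
      rwa [hxx] at this
    rw [intervalIntegral.integral_const, smul_eq_mul] at this
    linarith

lemma abs_storage_sub_le (hlam : 0 < lam) (hρ : Continuous ρ) {B : ℝ} (hB : ∀ z, |prim ρ z| ≤ B)
    (x y : ℝ) : |storage lam ρ x - storage lam ρ y| ≤ B * |x ^ lam - y ^ lam| := by
  rw [storage_sub hlam hρ]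
  exact intervalIntegral.norm_integral_le_of_norm_le_const (C := B)
    (f := fun z => prim ρ (z ^ (1 / lam))) fun z _ => hB (z ^ (1 / lam))

end Storage

lemma abs_rpow_sub_rpow_le {lam : ℝ} (h0 : 0 < lam) (h1 : lam ≤ 1) {x y : ℝ} (hx : 0 ≤ x)
    (hy : 0 ≤ y) : |x ^ lam - y ^ lam| ≤ |x - y| ^ lam := by
  wlog h : y ≤ x generalizing x y
  · rw [abs_sub_comm, abs_sub_comm x y]
    exact this hy hx (le_of_not_ge h)
  rw [abs_of_nonneg (sub_nonneg.2 (Real.rpow_le_rpow hy h h0.le)), abs_of_nonneg (sub_nonneg.2 h)]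
  have := Real.rpow_add_le_add_rpow (sub_nonneg.2 h) hy h0.le h1
  rw [sub_add_cancel] at this
  linarith

section Solution

variable {n : ℕ} {U : Set (E n)} {g : GenPoly} {lam α T : ℝ} {φ : ℝ → E n → ℝ} {u₀ : E n → ℝ}
  {u : ℝ → E n → ℝ} {Du : ℝ → E n → E n} {tr : ℝ → E n → ℝ}

lemma IsWeakSolution.aesm (hsol : IsWeakSolution U g lam α T φ u₀ u Du tr) {t : ℝ}
    (ht : t ∈ Icc 0 T) : AEStronglyMeasurable (u t) (volume.restrict U) :=
  (hsol.continuousInLp.1 t ht).1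

/-- If `∫₀^z ρ` is bounded, then the storage function is at most a multiple of `z^λ`. -/
lemma IsWeakSolution.integrable_storage [IsFiniteMeasure (volume.restrict U)]
    (hsol : IsWeakSolution U g lam α T φ u₀ u Du tr) (hlam : 0 < lam) (hlamα : lam ≤ α)
    {ρ : ℝ → ℝ} (hρ : Continuous ρ) {B : ℝ} (hB : ∀ z, |prim ρ z| ≤ B) {t : ℝ}
    (ht : t ∈ Icc 0 T) : Integrable (fun x => storage lam ρ (u t x)) (volume.restrict U) := by
  refine ((hsol.integrable_rpow hlam hlamα ht).const_mul B).mono'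
    ((continuous_storage hlam hρ).comp_aestronglyMeasurable (hsol.aesm ht)) ?_
  filter_upwards [hsol.nonneg t ht] with x hx
  have h := abs_storage_sub_le hlam hρ hB (u t x) 0
  have h0 : storage lam ρ 0 = 0 := by simp [storage, Real.zero_rpow hlam.ne']
  rw [h0, sub_zero, Real.zero_rpow hlam.ne', sub_zero, abs_of_nonneg (Real.rpow_nonneg hx _)] at h
  exact h

/-- The total storage is continuous in time, since `z ↦ z^λ` is Hölder continuous of exponent `λ`. -/
lemma IsWeakSolution.continuousOn_storage [IsFiniteMeasure (volume.restrict U)]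
    (hsol : IsWeakSolution U g lam α T φ u₀ u Du tr) (hlam : 0 < lam) (hlam1 : lam ≤ 1)
    (hα : 1 ≤ α) {ρ : ℝ → ℝ} (hρ : Continuous ρ) {B : ℝ} (hB : ∀ z, |prim ρ z| ≤ B) :
    ContinuousOn (fun t => ∫ x in U, storage lam ρ (u t x)) (Icc 0 T) := by
  have hlamα : lam ≤ α := hlam1.trans hα
  have hB0 : 0 ≤ B := (abs_nonneg _).trans (hB 0)
  intro t ht
  rw [ContinuousWithinAt, tendsto_iff_edist_tendsto_0]
  have hexp : (0:ℝ) ≤ 1 / lam - 1 / α := sub_nonneg.2 (one_div_le_one_div_of_le hlam hlamα)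
  set c : ℝ≥0∞ := (volume.restrict U) univ ^ (1 / lam - 1 / α) with hc
  have hct : c ≠ ⊤ := ENNReal.rpow_ne_top_of_nonneg hexp (measure_ne_top _ _)
  have hlim : Tendsto (fun s => ENNReal.ofReal B * (eLpNorm (fun x => u s x - u t x)
      (ENNReal.ofReal α) (volume.restrict U) * c) ^ lam) (𝓝[Icc 0 T] t) (𝓝 0) := by
    have h1 := ENNReal.Tendsto.const_mul ((ENNReal.Tendsto.mul_const
      (hsol.continuousInLp.2 t ht) (b := c) (Or.inr hct)).ennrpow_const lam)
      (a := ENNReal.ofReal B) (Or.inr ENNReal.ofReal_ne_top)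
    simpa [ENNReal.zero_rpow_of_pos hlam] using h1
  refine tendsto_of_tendsto_of_tendsto_of_le_of_le' tendsto_const_nhds hlim
    (Eventually.of_forall fun _ => zero_le) ?_
  filter_upwards [self_mem_nhdsWithin] with s hs
  rw [edist_eq_enorm_sub, ← integral_sub (hsol.integrable_storage hlam hlamα hρ hB hs)
    (hsol.integrable_storage hlam hlamα hρ hB ht)]
  refine (enorm_integral_le_lintegral_enorm _).trans ?_
  have hm : AEStronglyMeasurable (fun x => u s x - u t x) (volume.restrict U) :=
    (hsol.aesm hs).sub (hsol.aesm ht)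
  calc ∫⁻ x in U, ‖storage lam ρ (u s x) - storage lam ρ (u t x)‖ₑ
      ≤ ∫⁻ x in U, ENNReal.ofReal B * ‖u s x - u t x‖ₑ ^ lam := by
        refine lintegral_mono_ae ?_
        filter_upwards [hsol.nonneg s hs, hsol.nonneg t ht] with x h1 h2
        have h3 := (abs_storage_sub_le hlam hρ hB (u s x) (u t x)).trans
          (mul_le_mul_of_nonneg_left (abs_rpow_sub_rpow_le hlam hlam1 h1 h2) hB0)
        rw [← ofReal_norm, ← ofReal_norm (u s x - u t x),
          ENNReal.ofReal_rpow_of_nonneg (norm_nonneg _) hlam.le, ← ENNReal.ofReal_mul hB0]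
        exact ENNReal.ofReal_le_ofReal h3
    _ = ENNReal.ofReal B * eLpNorm (fun x => u s x - u t x) (ENNReal.ofReal lam)
          (volume.restrict U) ^ lam := by
        rw [lintegral_const_mul' _ _ ENNReal.ofReal_ne_top, eLpNorm_ofReal_eq hlam,
          ← ENNReal.rpow_mul, one_div_mul_cancel hlam.ne', ENNReal.rpow_one]
    _ ≤ _ := by
        gcongr
        have := eLpNorm_le_eLpNorm_mul_rpow_measure_univ (ENNReal.ofReal_le_ofReal hlamα) hm
        rwa [ENNReal.toReal_ofReal hlam.le, ENNReal.toReal_ofReal (by linarith)] at this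

lemma flux_prod_mono {X : Type*} [MeasurableSpace X] (μ : Measure X) [SFinite μ] {a b c d : ℝ}
    (h1 : c ≤ a) (h2 : b ≤ d) :
    (volume.restrict (Ioc a b)).prod μ ≤ (volume.restrict (Ioc c d)).prod μ :=
  Measure.prod_mono (Measure.restrict_mono (Ioc_subset_Ioc h1 h2) le_rfl) le_rfl

/-- The energy inequality for a bounded non-negative density `ρ` with bounded primitive.  The weak
formulation on `(τ - η, τ)` is tested with `∫₀^{u(τ)} ρ` and integrated in `τ`; the convexity of the
storage function takes care of the time derivative, and then `η → 0`. -/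
theorem IsWeakSolution.energy_le [IsFiniteMeasure (volume.restrict U)]
    [IsFiniteMeasure (surfaceMeasure U)]
    (hsol : IsWeakSolution U g lam α T φ u₀ u Du tr) (hlam : 0 < lam) (hlam1 : lam ≤ 1)
    (hα : 1 ≤ α) {s t : ℝ} (hs : 0 < s) (hst : s < t) (htT : t ≤ T)
    {ρ : ℝ → ℝ} (hρ : Continuous ρ) (hρ0 : ∀ z, 0 ≤ ρ z) {L B : ℝ} (hL : ∀ z, |ρ z| ≤ L)
    (hB : ∀ z, |prim ρ z| ≤ B) :
    (∫ x in U, storage lam ρ (u t x)) - ∫ x in U, storage lam ρ (u s x)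
      ≤ - (∫ z, (inner ℝ (g.K ‖Du z.1 z.2‖ • Du z.1 z.2) (ρ (u z.1 z.2) • Du z.1 z.2) : ℝ)
            ∂((volume.restrict (Ioc s t)).prod (volume.restrict U)))
        - ∫ z, φ z.1 z.2 * tr z.1 z.2 ^ lam * prim ρ (tr z.1 z.2)
            ∂((volume.restrict (Ioc s t)).prod (surfaceMeasure U)) := by
  have hlamα : lam ≤ α := hlam1.trans hα
  have ha : 0 < 1 - g.a := by linarith [g.a_lt_one]
  set ε := s / 2 with hε
  have hε0 : 0 < ε := by positivity
  have hεs : ε < s := by rw [hε]; linarith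
  set Φ : ℝ → ℝ := fun τ => ∫ x in U, storage lam ρ (u τ x) with hΦ
  have hΦc : ContinuousOn Φ (Icc 0 T) := hsol.continuousOn_storage hlam hlam1 hα hρ hB
  -- the interior pairing
  have hF : MemLp (fun z : ℝ × E n => g.K ‖Du z.1 z.2‖ • Du z.1 z.2)
      (ENNReal.ofReal ((2 - g.a) / (1 - g.a)))
      ((volume.restrict (Ioc ε T)).prod (volume.restrict U)) :=
    memLp_flux g (hsol.memLp_Du ε hε0)
  have hum : AEStronglyMeasurable (fun z : ℝ × E n => u z.1 z.2)
      ((volume.restrict (Ioc s t)).prod (volume.restrict U)) :=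
    hsol.meas_u.mono_measure (flux_prod_mono _ hs.le htT)
  have htm : AEStronglyMeasurable (fun z : ℝ × E n => tr z.1 z.2)
      ((volume.restrict (Ioc s t)).prod (surfaceMeasure U)) :=
    hsol.meas_tr.mono_measure (flux_prod_mono _ hs.le htT)
  have hG : MemLp (fun z : ℝ × E n => ρ (u z.1 z.2) • Du z.1 z.2) (ENNReal.ofReal (2 - g.a))
      ((volume.restrict (Ioc s t)).prod (volume.restrict U)) := by
    have hD := (hsol.memLp_Du ε hε0).mono_measure
      (flux_prod_mono (volume.restrict U) hεs.le htT)
    refine MemLp.of_le_mul (c := L) hD ((hρ.comp_aestronglyMeasurable hum).smul hD.1)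
      (ae_of_all _ fun z => ?_)
    rw [norm_smul]
    exact mul_le_mul_of_nonneg_right (hL _) (norm_nonneg _)
  have hconj : ENNReal.HolderConjugate (ENNReal.ofReal ((2 - g.a) / (1 - g.a)))
      (ENNReal.ofReal (2 - g.a)) := (holderConjugate_flux g).symm.ennrealOfReal
  obtain ⟨hAi, hAl⟩ := tendsto_average_inner_Ioc (V := E n)
    ((holderConjugate_flux g).symm.lt.le) hεs htT hF hG
  -- the boundary pairing
  have hfb : MemLp (fun z : ℝ × E n => φ z.1 z.2 * tr z.1 z.2 ^ lam) (ENNReal.ofReal 1)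
      ((volume.restrict (Ioc ε T)).prod (surfaceMeasure U)) := by
    rw [ENNReal.ofReal_one, memLp_one_iff_integrable]
    exact hsol.integrable_flux ε hε0
  have hHb : MemLp (fun z : ℝ × E n => prim ρ (tr z.1 z.2)) ⊤
      ((volume.restrict (Ioc s t)).prod (surfaceMeasure U)) :=
    memLp_top_of_bound ((continuous_prim hρ).comp_aestronglyMeasurable htm) B
      (ae_of_all _ fun z => hB _)
  have hconj1 : ENNReal.HolderConjugate (ENNReal.ofReal 1) ⊤ := by
    rw [ENNReal.ofReal_one]; infer_instance
  obtain ⟨hBi, hBl⟩ := tendsto_average_inner_Ioc (V := ℝ) le_rfl hεs htT hfb hHb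
  set A : ℝ → ℝ → ℝ := fun η τ => ∫ σ in Ioc (τ - η) τ, ∫ x in U,
    (inner ℝ (g.K ‖Du σ x‖ • Du σ x) (ρ (u τ x) • Du τ x) : ℝ) with hAdef
  set Bd : ℝ → ℝ → ℝ := fun η τ => ∫ σ in Ioc (τ - η) τ, ∫ x,
    (inner ℝ (φ σ x * tr σ x ^ lam) (prim ρ (tr τ x)) : ℝ) ∂(surfaceMeasure U) with hBdef
  -- the inequality at almost every time
  have hpt : ∀ η ∈ Ioo 0 (s - ε), ∀ᵐ τ ∂(volume.restrict (Ioc s t)),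
      Φ τ - Φ (τ - η) ≤ - A η τ - Bd η τ := by
    intro η hη
    have hsub : Ioc s t ⊆ Ioc 0 T := Ioc_subset_Ioc hs.le htT
    filter_upwards [ae_restrict_of_ae_restrict_of_subset hsub hsol.ae_isRegular,
      ae_restrict_mem (μ := (volume : Measure ℝ)) (measurableSet_Ioc (a := s) (b := t))]
      with τ hreg hτ
    have h1 : 0 < τ - η := by linarith [hη.2, hτ.1]
    have hτI : τ ∈ Icc 0 T := ⟨by linarith [hτ.1], hτ.2.trans htT⟩
    have hτI' : τ - η ∈ Icc 0 T := ⟨h1.le, by linarith [hη.1, hτI.2]⟩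
    have hw := hsol.weak_form_prim hlam hlamα h1 (by linarith [hη.1]) hτI.2 hreg hρ hL hB
    have hbeq : Bd η τ = ∫ σ in Ioc (τ - η) τ, ∫ x, φ σ x * tr σ x ^ lam * prim ρ (tr τ x)
        ∂(surfaceMeasure U) := by
      simp only [hBdef, RCLike.inner_apply, conj_trivial]
      simp_rw [mul_comm (prim ρ (tr τ _))]
    rw [hbeq]
    rw [← hw, hΦ]
    simp only
    rw [← integral_sub (hsol.integrable_storage hlam hlamα hρ hB hτI)
      (hsol.integrable_storage hlam hlamα hρ hB hτI')]
    refine integral_mono_ae ((hsol.integrable_storage hlam hlamα hρ hB hτI).sub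
      (hsol.integrable_storage hlam hlamα hρ hB hτI')) ?_ ?_
    · exact ((hsol.integrable_rpow hlam hlamα hτI).sub
        (hsol.integrable_rpow hlam hlamα hτI')).mul_bdd
        ((continuous_prim hρ).comp_aestronglyMeasurable hreg.aesm) (ae_of_all _ fun x => hB _)
    · filter_upwards [hsol.nonneg _ hτI, hsol.nonneg _ hτI'] with x h2 h3
      exact storage_sub_le hlam hρ hρ0 h2 h3
  -- integration in time
  have hshift : ∀ η ∈ Ioo 0 (s - ε), ∫ τ in Ioc s t, (Φ τ - Φ (τ - η))
      = (∫ r in Ioc 0 η, Φ (t - r)) - ∫ r in Ioc 0 η, Φ (s - r) := by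
    intro η hη
    have hii : ∀ a b, 0 ≤ a → a ≤ b → b ≤ T → IntervalIntegrable Φ volume a b := by
      intro a b h1 h2 h3
      refine ContinuousOn.intervalIntegrable_of_Icc h2 (hΦc.mono (Icc_subset_Icc h1 h3))
    have hη0 := hη.1
    have hηs : η < s := by linarith [hη.2]
    have i1 := hii s t hs.le hst.le htT
    have i2 := hii (s - η) (t - η) (by linarith) (by linarith) (by linarith)
    have i2' : IntervalIntegrable (fun τ => Φ (τ - η)) volume s t := by
      simpa using i2.comp_sub_right η
    rw [← intervalIntegral.integral_of_le hst.le, ← intervalIntegral.integral_of_le hη0.le,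
      ← intervalIntegral.integral_of_le hη0.le, intervalIntegral.integral_sub i1 i2',
      intervalIntegral.integral_comp_sub_right, intervalIntegral.integral_comp_sub_left,
      intervalIntegral.integral_comp_sub_left, sub_zero, sub_zero]
    have i3 := hii (s - η) s (by linarith) (by linarith) (by linarith)
    have i4 := hii (t - η) t (by linarith) (by linarith) htT
    have e1 := intervalIntegral.integral_add_adjacent_intervals i3 i1
    have e2 := intervalIntegral.integral_add_adjacent_intervals i2 i4
    linarith
  have hineq : ∀ η ∈ Ioo 0 (s - ε),
      η⁻¹ * (∫ r in Ioc 0 η, Φ (t - r)) - η⁻¹ * (∫ r in Ioc 0 η, Φ (s - r))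
        ≤ - (η⁻¹ * ∫ τ in Ioc s t, A η τ) - η⁻¹ * ∫ τ in Ioc s t, Bd η τ := by
    intro η hη
    have hii : IntegrableOn (fun τ => Φ τ - Φ (τ - η)) (Ioc s t) := by
      rw [← integrableOn_Icc_iff_integrableOn_Ioc]
      refine ContinuousOn.integrableOn_Icc ((hΦc.mono (Icc_subset_Icc hs.le htT)).sub ?_)
      refine hΦc.comp (by fun_prop) fun τ hτ => ?_
      exact ⟨by linarith [hτ.1, hη.2], by linarith [hτ.2, hη.1]⟩
    have hAη : Integrable (fun τ => A η τ) (volume.restrict (Ioc s t)) := hAi η hη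
    have hBη : Integrable (fun τ => Bd η τ) (volume.restrict (Ioc s t)) := hBi η hη
    have hAn : Integrable (fun τ => - A η τ) (volume.restrict (Ioc s t)) := hAη.neg
    have h1 := integral_mono_ae hii (hAn.sub hBη) (hpt η hη)
    rw [hshift η hη] at h1
    have h2 : ∫ τ in Ioc s t, (- A η τ - Bd η τ)
        = - (∫ τ in Ioc s t, A η τ) - ∫ τ in Ioc s t, Bd η τ := by
      rw [integral_sub hAn hBη, integral_neg]
    have h3 : (∫ r in Ioc 0 η, Φ (t - r)) - ∫ r in Ioc 0 η, Φ (s - r)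
        ≤ - (∫ τ in Ioc s t, A η τ) - ∫ τ in Ioc s t, Bd η τ := by
      rw [← h2]; exact h1
    have h4 := mul_le_mul_of_nonneg_left h3 (inv_pos.2 hη.1).le
    linarith
  have hΦlim : ∀ b ∈ Ioc 0 T, Tendsto (fun η => η⁻¹ * ∫ r in Ioc 0 η, Φ (b - r)) (𝓝[>] 0)
      (𝓝 (Φ b)) := by
    intro b hb
    have hmaps : MapsTo (fun r => b - r) (Icc 0 b) (Icc 0 T) := fun r hr =>
      ⟨by linarith [hr.2], by linarith [hr.1, hb.2]⟩
    have hc : ContinuousOn (fun r => Φ (b - r)) (Icc 0 b) := hΦc.comp (by fun_prop) hmaps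
    refine tendsto_average hb.1 ?_ ?_
    · rw [← integrableOn_Icc_iff_integrableOn_Ioc]
      exact hc.integrableOn_Icc
    · have h1 := hc 0 ⟨le_rfl, hb.1.le⟩
      rw [ContinuousWithinAt, sub_zero] at h1
      refine h1.mono_left (nhdsWithin_le_iff.2 ?_)
      exact mem_of_superset (Ioo_mem_nhdsGT hb.1) Ioo_subset_Icc_self
  have hBval : ∫ z, (inner ℝ (φ z.1 z.2 * tr z.1 z.2 ^ lam) (prim ρ (tr z.1 z.2)) : ℝ)
      ∂((volume.restrict (Ioc s t)).prod (surfaceMeasure U))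
      = ∫ z, φ z.1 z.2 * tr z.1 z.2 ^ lam * prim ρ (tr z.1 z.2)
            ∂((volume.restrict (Ioc s t)).prod (surfaceMeasure U)) := by
    refine integral_congr_ae (ae_of_all _ fun z => ?_)
    simp [mul_comm]
  rw [hBval] at hBl
  refine le_of_tendsto_of_tendsto ((hΦlim t ⟨hs.trans hst, htT⟩).sub
    (hΦlim s ⟨hs, hst.le.trans htT⟩)) (hAl.neg.sub hBl) ?_
  filter_upwards [Ioo_mem_nhdsGT (sub_pos.2 hεs)] with η hη using hineq η hη

end Solution

/-! ### The energy inequality for general densities -/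

lemma ae_prod_nonneg {X Y : Type*} [MeasurableSpace X] [MeasurableSpace Y] {μ : Measure X}
    {ν : Measure Y} [SFinite μ] [SFinite ν] {f : X × Y → ℝ} (hf : AEStronglyMeasurable f (μ.prod ν))
    (h : ∀ᵐ x ∂μ, ∀ᵐ y ∂ν, 0 ≤ f (x, y)) : ∀ᵐ z ∂(μ.prod ν), 0 ≤ f z := by
  have hS : MeasurableSet {z | 0 ≤ hf.mk f z} :=
    measurableSet_le measurable_const hf.stronglyMeasurable_mk.measurable
  have h1 : ∀ᵐ z ∂(μ.prod ν), z ∈ {z | 0 ≤ hf.mk f z} := by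
    rw [Measure.ae_prod_mem_iff_ae_ae_mem hS]
    filter_upwards [h, Measure.ae_ae_of_ae_prod hf.ae_eq_mk] with x h2 h3
    filter_upwards [h2, h3] with y h4 h5
    show 0 ≤ hf.mk f (x, y)
    rw [← h5]
    exact h4
  filter_upwards [h1, hf.ae_eq_mk] with z h2 h3
  rw [h3]
  exact h2

/-- The sup norm over the boundary of the negative part of `φ(τ)`. -/
def negSup {n : ℕ} (U : Set (E n)) (φ : ℝ → E n → ℝ) (τ : ℝ) : ℝ≥0∞ :=
  eLpNorm (fun x => max (-φ τ x) 0) ⊤ (surfaceMeasure U)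

lemma prim_le_prim {ρ ρ' : ℝ → ℝ} (hρ : Continuous ρ) (hρ' : Continuous ρ')
    (h : ∀ z, ρ z ≤ ρ' z) {z : ℝ} (hz : 0 ≤ z) : prim ρ z ≤ prim ρ' z :=
  intervalIntegral.integral_mono_on hz (hρ.intervalIntegrable _ _) (hρ'.intervalIntegrable _ _)
    fun y _ => h y

lemma prim_congr {ρ ρ' : ℝ → ℝ} {R z : ℝ} (h : ∀ y, |y| ≤ R → ρ y = ρ' y) (hz : 0 ≤ z)
    (hzR : z ≤ R) : prim ρ z = prim ρ' z := by
  refine intervalIntegral.integral_congr fun y hy => ?_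
  rw [uIcc_of_le hz] at hy
  exact h y (by rw [abs_of_nonneg hy.1]; exact hy.2.trans hzR)

lemma storage_le_storage {lam : ℝ} (hlam : 0 < lam) {ρ ρ' : ℝ → ℝ} (hρ : Continuous ρ)
    (hρ' : Continuous ρ') (h : ∀ z, ρ z ≤ ρ' z) {z : ℝ} (hz : 0 ≤ z) :
    storage lam ρ z ≤ storage lam ρ' z :=
  intervalIntegral.integral_mono_on (Real.rpow_nonneg hz _)
    ((continuous_prim_rpow hlam hρ).intervalIntegrable _ _)
    ((continuous_prim_rpow hlam hρ').intervalIntegrable _ _)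
    fun _ hy => prim_le_prim hρ hρ' h (Real.rpow_nonneg hy.1 _)

lemma storage_congr {lam : ℝ} (hlam : 0 < lam) {ρ ρ' : ℝ → ℝ} {R z : ℝ}
    (h : ∀ y, |y| ≤ R → ρ y = ρ' y) (hz : 0 ≤ z) (hzR : z ≤ R) :
    storage lam ρ z = storage lam ρ' z := by
  refine intervalIntegral.integral_congr fun y hy => ?_
  rw [uIcc_of_le (Real.rpow_nonneg hz _)] at hy
  refine prim_congr h (Real.rpow_nonneg hy.1 _) (le_trans ?_ hzR)
  calc y ^ (1 / lam) ≤ (z ^ lam) ^ (1 / lam) := Real.rpow_le_rpow hy.1 hy.2 (by positivity)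
    _ = z := by rw [← Real.rpow_mul hz, mul_one_div_cancel hlam.ne', Real.rpow_one]

/-- A bound on energy and dissipation passes to the limit along an increasing sequence of densities
which is eventually constant on bounded sets. -/
lemma energy_le_of_exhaustion {X Y : Type*} [MeasurableSpace X] [MeasurableSpace Y] {μ : Measure X}
    {ν : Measure Y} {lam : ℝ} (hlam : 0 < lam) {ρ : ℝ → ℝ} {ρj : ℕ → ℝ → ℝ}
    (hρj : ∀ j, Continuous (ρj j))
    (hmono : ∀ z, Monotone fun j => ρj j z)
    (hev : ∀ R : ℝ, ∀ᶠ j in atTop, ∀ z, |z| ≤ R → ρj j z = ρ z)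
    {w : X → ℝ} (hw : AEStronglyMeasurable w μ) (hw0 : ∀ᵐ x ∂μ, 0 ≤ w x)
    {w' : Y → ℝ} (hw' : AEStronglyMeasurable w' ν)
    {k : Y → ℝ≥0∞} (hk : AEMeasurable k ν) {R : ℝ≥0∞}
    (hle : ∀ j, ∫⁻ x, ENNReal.ofReal (storage lam (ρj j) (w x)) ∂μ
      + ∫⁻ y, ENNReal.ofReal (ρj j (w' y)) * k y ∂ν ≤ R) :
    ∫⁻ x, ENNReal.ofReal (storage lam ρ (w x)) ∂μ
      + ∫⁻ y, ENNReal.ofReal (ρ (w' y)) * k y ∂ν ≤ R := by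
  have h1 : Tendsto (fun j => ∫⁻ x, ENNReal.ofReal (storage lam (ρj j) (w x)) ∂μ) atTop
      (𝓝 (∫⁻ x, ENNReal.ofReal (storage lam ρ (w x)) ∂μ)) := by
    refine lintegral_tendsto_of_tendsto_of_monotone (fun j => ?_) ?_ ?_
    · exact ((continuous_storage hlam (hρj j)).comp_aestronglyMeasurable hw).aemeasurable.ennreal_ofReal
    · filter_upwards [hw0] with x hx i j hij
      exact ENNReal.ofReal_le_ofReal
        (storage_le_storage hlam (hρj i) (hρj j) (fun z => hmono z hij) hx)
    · filter_upwards [hw0] with x hx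
      refine tendsto_const_nhds.congr' ?_
      filter_upwards [hev (w x)] with j hj
      rw [storage_congr hlam hj hx le_rfl]
  have h2 : Tendsto (fun j => ∫⁻ y, ENNReal.ofReal (ρj j (w' y)) * k y ∂ν) atTop
      (𝓝 (∫⁻ y, ENNReal.ofReal (ρ (w' y)) * k y ∂ν)) := by
    refine lintegral_tendsto_of_tendsto_of_monotone (fun j => ?_) ?_ ?_
    · exact ((hρj j).comp_aestronglyMeasurable hw').aemeasurable.ennreal_ofReal.mul hk
    · refine ae_of_all _ fun y i j hij => ?_
      exact mul_le_mul_left (ENNReal.ofReal_le_ofReal (hmono _ hij)) _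
    · refine ae_of_all _ fun y => tendsto_const_nhds.congr' ?_
      filter_upwards [hev |w' y|] with j hj
      rw [hj _ le_rfl]
  exact le_of_tendsto (h1.add h2) (Eventually.of_forall hle)

section Solution

variable {n : ℕ} {U : Set (E n)} {g : GenPoly} {lam α T : ℝ} {φ : ℝ → E n → ℝ} {u₀ : E n → ℝ}
  {u : ℝ → E n → ℝ} {Du : ℝ → E n → E n} {tr : ℝ → E n → ℝ}

lemma IsWeakSolution.ae_trace_nonneg [IsFiniteMeasure (volume.restrict U)]
    [IsFiniteMeasure (surfaceMeasure U)]
    (hsol : IsWeakSolution U g lam α T φ u₀ u Du tr) {C : ℝ≥0∞} (hCt : C ≠ ⊤)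
    (hC : ∀ f : E n → ℝ, ContDiff ℝ 1 f →
      ∫⁻ x, ‖f x‖ₑ ∂(surfaceMeasure U) ≤ C * ∫⁻ x in U, (‖f x‖ₑ + ‖fderiv ℝ f x‖ₑ)) :
    ∀ᵐ z ∂((volume.restrict (Ioc 0 T)).prod (surfaceMeasure U)), 0 ≤ tr z.1 z.2 := by
  refine ae_prod_nonneg hsol.meas_tr ?_
  filter_upwards [hsol.ae_isRegular,
    ae_restrict_mem (μ := (volume : Measure ℝ)) (measurableSet_Ioc (a := 0) (b := T))] with τ h1 h2
  obtain ⟨v, hv⟩ := h1.approx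
  exact hv.trace_nonneg (by linarith [g.a_lt_one]) h1.aesm h1.memLp hCt hC h1.aesm_boundary
    (hsol.nonneg τ ⟨h2.1.le, h2.2⟩)

/-- The energy inequality, in terms of lower integrals, for bounded densities. -/
lemma IsWeakSolution.energy_lintegral_le_of_bounded [IsFiniteMeasure (volume.restrict U)]
    [IsFiniteMeasure (surfaceMeasure U)]
    (hsol : IsWeakSolution U g lam α T φ u₀ u Du tr) (hlam : 0 < lam) (hlam1 : lam ≤ 1)
    (hα : 1 ≤ α)
    (htr : ∀ᵐ z ∂((volume.restrict (Ioc 0 T)).prod (surfaceMeasure U)), 0 ≤ tr z.1 z.2)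
    (hφ : AEStronglyMeasurable (Function.uncurry φ)
      ((volume.restrict (Ioc 0 T)).prod (surfaceMeasure U)))
    {s t : ℝ} (hs : 0 < s) (hst : s < t) (htT : t ≤ T)
    {ρ : ℝ → ℝ} (hρ : Continuous ρ) (hρ0 : ∀ z, 0 ≤ ρ z) {L B : ℝ} (hL : ∀ z, |ρ z| ≤ L)
    (hB : ∀ z, |prim ρ z| ≤ B) :
    (∫⁻ x in U, ENNReal.ofReal (storage lam ρ (u t x)))
      + ∫⁻ z, ENNReal.ofReal (ρ (u z.1 z.2)) * ENNReal.ofReal (g.K ‖Du z.1 z.2‖ * ‖Du z.1 z.2‖ ^ 2)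
          ∂((volume.restrict (Ioc s t)).prod (volume.restrict U))
      ≤ (∫⁻ x in U, ENNReal.ofReal (storage lam ρ (u s x)))
        + ∫⁻ τ in Ioc s t, negSup U φ τ
          * ∫⁻ x, ENNReal.ofReal (tr τ x ^ lam * prim ρ (tr τ x)) ∂(surfaceMeasure U) := by
  have hlamα : lam ≤ α := hlam1.trans hα
  set νU := (volume.restrict (Ioc s t)).prod (volume.restrict U) with hνU
  set νΓ := (volume.restrict (Ioc s t)).prod (surfaceMeasure U) with hνΓ
  have hleΓ : νΓ ≤ (volume.restrict (Ioc 0 T)).prod (surfaceMeasure U) :=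
    flux_prod_mono _ hs.le htT
  have htr' : ∀ᵐ z ∂νΓ, 0 ≤ tr z.1 z.2 := (Measure.absolutelyContinuous_of_le hleΓ).ae_le htr
  have htm : AEStronglyMeasurable (fun z : ℝ × E n => tr z.1 z.2) νΓ := hsol.meas_tr.mono_measure hleΓ
  have hφm : AEStronglyMeasurable (fun z : ℝ × E n => φ z.1 z.2) νΓ := hφ.mono_measure hleΓ
  have hpm : AEStronglyMeasurable (fun z : ℝ × E n => prim ρ (tr z.1 z.2)) νΓ :=
    (continuous_prim hρ).comp_aestronglyMeasurable htm
  have htI : t ∈ Icc 0 T := ⟨(hs.trans hst).le, htT⟩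
  have hsI : s ∈ Icc 0 T := ⟨hs.le, hst.le.trans htT⟩
  have hE := hsol.energy_le hlam hlam1 hα hs hst htT hρ hρ0 hL hB
  have hst0 : ∀ r ∈ Icc 0 T, 0 ≤ᵐ[volume.restrict U] fun x => storage lam ρ (u r x) := by
    intro r hr
    filter_upwards [hsol.nonneg r hr] with x hx using storage_nonneg hρ0 hx
  have e1 : ∀ r ∈ Icc 0 T, ∫⁻ x in U, ENNReal.ofReal (storage lam ρ (u r x))
      = ENNReal.ofReal (∫ x in U, storage lam ρ (u r x)) := fun r hr =>
    (ofReal_integral_eq_lintegral_ofReal (hsol.integrable_storage hlam hlamα hρ hB hr)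
      (hst0 r hr)).symm
  -- the dissipation
  have hDi : Integrable (fun z : ℝ × E n =>
      (inner ℝ (g.K ‖Du z.1 z.2‖ • Du z.1 z.2) (ρ (u z.1 z.2) • Du z.1 z.2) : ℝ)) νU := by
    have hD := (hsol.memLp_Du s hs).mono_measure (flux_prod_mono (volume.restrict U) le_rfl htT)
    have hconj : ENNReal.HolderConjugate (ENNReal.ofReal ((2 - g.a) / (1 - g.a)))
      (ENNReal.ofReal (2 - g.a)) := (holderConjugate_flux g).symm.ennrealOfReal
    refine integrable_inner_of_memLp (memLp_flux g hD) (MemLp.of_le_mul (c := L) hD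
      ((hρ.comp_aestronglyMeasurable
        (hsol.meas_u.mono_measure (flux_prod_mono _ hs.le htT))).smul hD.1)
      (ae_of_all _ fun z => ?_))
    rw [norm_smul]
    exact mul_le_mul_of_nonneg_right (hL _) (norm_nonneg _)
  have hDeq : ∀ z : ℝ × E n,
      (inner ℝ (g.K ‖Du z.1 z.2‖ • Du z.1 z.2) (ρ (u z.1 z.2) • Du z.1 z.2) : ℝ)
      = ρ (u z.1 z.2) * (g.K ‖Du z.1 z.2‖ * ‖Du z.1 z.2‖ ^ 2) := fun z => by
    rw [real_inner_smul_left, real_inner_smul_right, real_inner_self_eq_norm_sq]; ring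
  have hK0 : ∀ z : ℝ × E n, 0 ≤ g.K ‖Du z.1 z.2‖ * ‖Du z.1 z.2‖ ^ 2 := fun z =>
    mul_nonneg (g.K_nonneg _) (sq_nonneg _)
  simp_rw [hDeq] at hE hDi
  have e2 : ∫⁻ z, ENNReal.ofReal (ρ (u z.1 z.2))
        * ENNReal.ofReal (g.K ‖Du z.1 z.2‖ * ‖Du z.1 z.2‖ ^ 2) ∂νU
      = ENNReal.ofReal (∫ z, ρ (u z.1 z.2) * (g.K ‖Du z.1 z.2‖ * ‖Du z.1 z.2‖ ^ 2) ∂νU) := by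
    rw [ofReal_integral_eq_lintegral_ofReal hDi
      (ae_of_all _ fun z => mul_nonneg (hρ0 _) (hK0 z))]
    exact lintegral_congr fun z => (ENNReal.ofReal_mul (hρ0 _)).symm
  -- the boundary term
  have hfl : Integrable (fun z : ℝ × E n => φ z.1 z.2 * tr z.1 z.2 ^ lam) νΓ :=
    (hsol.integrable_flux s hs).mono_measure (flux_prod_mono _ le_rfl htT)
  have hbi : Integrable (fun z : ℝ × E n => φ z.1 z.2 * tr z.1 z.2 ^ lam * prim ρ (tr z.1 z.2)) νΓ :=
    hfl.mul_bdd hpm (ae_of_all _ fun z => hB _)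
  have hqm : AEStronglyMeasurable (fun z : ℝ × E n => tr z.1 z.2 ^ lam * prim ρ (tr z.1 z.2)) νΓ :=
    ((Real.continuous_rpow_const hlam.le).comp_aestronglyMeasurable htm).mul hpm
  have hneg : Integrable (fun z : ℝ × E n =>
      max (-φ z.1 z.2) 0 * (tr z.1 z.2 ^ lam * prim ρ (tr z.1 z.2))) νΓ := by
    refine hbi.mono (((hφm.neg.sup aestronglyMeasurable_const)).mul hqm) (ae_of_all _ fun z => ?_)
    rw [mul_assoc, norm_mul, norm_mul (φ z.1 z.2)]
    refine mul_le_mul_of_nonneg_right ?_ (norm_nonneg _)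
    rw [Real.norm_of_nonneg (le_max_right _ _), Real.norm_eq_abs]
    exact max_le (neg_le_abs _) (abs_nonneg _)
  have hble : - (∫ z, φ z.1 z.2 * tr z.1 z.2 ^ lam * prim ρ (tr z.1 z.2) ∂νΓ)
      ≤ ∫ z, max (-φ z.1 z.2) 0 * (tr z.1 z.2 ^ lam * prim ρ (tr z.1 z.2)) ∂νΓ := by
    rw [← integral_neg]
    refine integral_mono_ae hbi.neg hneg ?_
    filter_upwards [htr'] with z hz
    have h1 : 0 ≤ tr z.1 z.2 ^ lam * prim ρ (tr z.1 z.2) :=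
      mul_nonneg (Real.rpow_nonneg hz _) (prim_nonneg hρ0 hz)
    have h2 := mul_le_mul_of_nonneg_right (le_max_left (-φ z.1 z.2) 0) h1
    calc -(φ z.1 z.2 * tr z.1 z.2 ^ lam * prim ρ (tr z.1 z.2))
        = -φ z.1 z.2 * (tr z.1 z.2 ^ lam * prim ρ (tr z.1 z.2)) := by ring
      _ ≤ _ := h2
  have hbE : ENNReal.ofReal (∫ z, max (-φ z.1 z.2) 0 * (tr z.1 z.2 ^ lam * prim ρ (tr z.1 z.2)) ∂νΓ)
      ≤ ∫⁻ τ in Ioc s t, negSup U φ τ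
          * ∫⁻ x, ENNReal.ofReal (tr τ x ^ lam * prim ρ (tr τ x)) ∂(surfaceMeasure U) := by
    refine (Real.ofReal_le_enorm _).trans ((enorm_integral_le_lintegral_enorm _).trans ?_)
    rw [lintegral_prod _ hneg.1.enorm]
    refine lintegral_mono_ae ?_
    filter_upwards [hqm.prodMk_left, Measure.ae_ae_of_ae_prod htr'] with τ h1 h2
    rw [← lintegral_const_mul'' _ h1.aemeasurable.ennreal_ofReal]
    refine lintegral_mono_ae ?_
    filter_upwards [ae_le_eLpNormEssSup (f := fun x => max (-φ τ x) 0) (μ := surfaceMeasure U), h2]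
      with x h3 h4
    rw [enorm_mul]
    have h5 : 0 ≤ tr τ x ^ lam * prim ρ (tr τ x) :=
      mul_nonneg (Real.rpow_nonneg h4 _) (prim_nonneg hρ0 h4)
    rw [Real.enorm_of_nonneg h5]
    refine mul_le_mul_left ?_ _
    rw [negSup, eLpNorm_exponent_top]
    exact h3
  have hD0 : 0 ≤ ∫ z, ρ (u z.1 z.2) * (g.K ‖Du z.1 z.2‖ * ‖Du z.1 z.2‖ ^ 2) ∂νU :=
    integral_nonneg fun z => mul_nonneg (hρ0 _) (hK0 z)
  rw [e1 t htI, e1 s hsI, e2, ← ENNReal.ofReal_add (integral_nonneg_of_ae (hst0 t htI)) hD0]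
  refine le_trans ?_ (add_le_add le_rfl hbE)
  refine le_trans (ENNReal.ofReal_le_ofReal ?_) ENNReal.ofReal_add_le
  linarith

/-- A continuous cut-off function: `1` on `[-j, j]` and `0` outside of `[-(j+1), j+1]`. -/
def cutoff (j : ℕ) (z : ℝ) : ℝ := max 0 (min 1 (j + 1 - |z|))

lemma continuous_cutoff (j : ℕ) : Continuous (cutoff j) := by unfold cutoff; fun_prop

lemma cutoff_nonneg (j : ℕ) (z : ℝ) : 0 ≤ cutoff j z := le_max_left _ _

lemma cutoff_le_one (j : ℕ) (z : ℝ) : cutoff j z ≤ 1 := max_le zero_le_one (min_le_left _ _)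

lemma cutoff_eq_one {j : ℕ} {z : ℝ} (h : |z| ≤ j) : cutoff j z = 1 := by
  rw [cutoff, min_eq_left (by linarith), max_eq_right zero_le_one]

lemma cutoff_eq_zero {j : ℕ} {z : ℝ} (h : (j : ℝ) + 1 ≤ |z|) : cutoff j z = 0 := by
  rw [cutoff, max_eq_left]
  exact (min_le_right _ _).trans (by linarith)

lemma cutoff_mono (z : ℝ) : Monotone fun j => cutoff j z := fun i j hij => by
  have : (i : ℝ) ≤ j := by exact_mod_cast hij
  exact max_le_max le_rfl (min_le_min le_rfl (by linarith))

lemma hasCompactSupport_mul_cutoff (ρ : ℝ → ℝ) (j : ℕ) :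
    HasCompactSupport fun z => ρ z * cutoff j z := by
  refine HasCompactSupport.intro (K := Icc (-((j:ℝ) + 1)) (j + 1)) isCompact_Icc fun z hz => ?_
  rw [cutoff_eq_zero, mul_zero]
  by_contra! h
  exact hz ⟨by linarith [(abs_lt.1 h).1], by linarith [(abs_lt.1 h).2]⟩

/-- The energy inequality for an arbitrary continuous density `ρ ≥ 0`, with possibly infinite
boundary term. -/
theorem IsWeakSolution.energy_lintegral_le [IsFiniteMeasure (volume.restrict U)]
    [IsFiniteMeasure (surfaceMeasure U)]
    (hsol : IsWeakSolution U g lam α T φ u₀ u Du tr) (hlam : 0 < lam) (hlam1 : lam ≤ 1)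
    (hα : 1 ≤ α)
    (htr : ∀ᵐ z ∂((volume.restrict (Ioc 0 T)).prod (surfaceMeasure U)), 0 ≤ tr z.1 z.2)
    (hφ : AEStronglyMeasurable (Function.uncurry φ)
      ((volume.restrict (Ioc 0 T)).prod (surfaceMeasure U)))
    {s t : ℝ} (hs : 0 < s) (hst : s < t) (htT : t ≤ T)
    {ρ : ℝ → ℝ} (hρ : Continuous ρ) (hρ0 : ∀ z, 0 ≤ ρ z) :
    (∫⁻ x in U, ENNReal.ofReal (storage lam ρ (u t x)))
      + ∫⁻ z, ENNReal.ofReal (ρ (u z.1 z.2)) * ENNReal.ofReal (g.K ‖Du z.1 z.2‖ * ‖Du z.1 z.2‖ ^ 2)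
          ∂((volume.restrict (Ioc s t)).prod (volume.restrict U))
      ≤ (∫⁻ x in U, ENNReal.ofReal (storage lam ρ (u s x)))
        + ∫⁻ τ in Ioc s t, negSup U φ τ
          * ∫⁻ x, ENNReal.ofReal (tr τ x ^ lam * prim ρ (tr τ x)) ∂(surfaceMeasure U) := by
  set ρj : ℕ → ℝ → ℝ := fun j z => ρ z * cutoff j z with hρjdef
  have hρj : ∀ j, Continuous (ρj j) := fun j => hρ.mul (continuous_cutoff j)
  have hρj0 : ∀ j z, 0 ≤ ρj j z := fun j z => mul_nonneg (hρ0 z) (cutoff_nonneg j z)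
  have hρjle : ∀ j z, ρj j z ≤ ρ z := fun j z =>
    mul_le_of_le_one_right (hρ0 z) (cutoff_le_one j z)
  have hsI : s ∈ Icc 0 T := ⟨hs.le, hst.le.trans htT⟩
  have htI : t ∈ Icc 0 T := ⟨(hs.trans hst).le, htT⟩
  have hDm : AEStronglyMeasurable (fun z : ℝ × E n => Du z.1 z.2)
      ((volume.restrict (Ioc s t)).prod (volume.restrict U)) :=
    hsol.meas_Du.mono_measure (flux_prod_mono _ hs.le htT)
  refine energy_le_of_exhaustion (w' := fun z : ℝ × E n => u z.1 z.2) hlam hρj (fun z i j hij =>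
    mul_le_mul_of_nonneg_left (cutoff_mono z hij) (hρ0 z)) (fun R => ?_) (hsol.aesm htI)
    (hsol.nonneg t htI) (hsol.meas_u.mono_measure (flux_prod_mono _ hs.le htT)) ?_ fun j => ?_
  · obtain ⟨J, hJ⟩ := exists_nat_ge R
    filter_upwards [eventually_ge_atTop J] with j hj z hz
    have : (J : ℝ) ≤ j := by exact_mod_cast hj
    rw [hρjdef]
    simp only
    rw [cutoff_eq_one (hz.trans (hJ.trans this)), mul_one]
  · exact ((g.measurable_K.comp_aemeasurable hDm.norm.aemeasurable).mul
      (hDm.norm.aemeasurable.pow_const 2)).ennreal_ofReal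
  · obtain ⟨L, hL⟩ :=
      (hρj j).bounded_above_of_compact_support (hasCompactSupport_mul_cutoff ρ j)
    have hint : Integrable (ρj j) :=
      (hρj j).integrable_of_hasCompactSupport (hasCompactSupport_mul_cutoff ρ j)
    have hB : ∀ z, |prim (ρj j) z| ≤ ∫ y, ‖ρj j y‖ := fun z => by
      rw [← Real.norm_eq_abs, prim]
      refine (intervalIntegral.norm_integral_le_integral_norm_uIoc).trans ?_
      exact setIntegral_le_integral hint.norm (ae_of_all _ fun y => norm_nonneg _)
    refine (hsol.energy_lintegral_le_of_bounded hlam hlam1 hα htr hφ hs hst htT (hρj j) (hρj0 j)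
      hL hB).trans (add_le_add ?_ ?_)
    · refine lintegral_mono_ae ?_
      filter_upwards [hsol.nonneg s hsI] with x hx
      exact ENNReal.ofReal_le_ofReal (storage_le_storage hlam (hρj j) hρ (hρjle j) hx)
    · have htr' : ∀ᵐ z ∂((volume.restrict (Ioc s t)).prod (surfaceMeasure U)), 0 ≤ tr z.1 z.2 :=
        (Measure.absolutelyContinuous_of_le (flux_prod_mono _ hs.le htT)).ae_le htr
      refine lintegral_mono_ae ?_
      filter_upwards [Measure.ae_ae_of_ae_prod htr'] with τ hτ
      refine mul_le_mul_right (lintegral_mono_ae ?_) _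
      filter_upwards [hτ] with x hx
      exact ENNReal.ofReal_le_ofReal (mul_le_mul_of_nonneg_left
        (prim_le_prim (hρj j) hρ (hρjle j) hx) (Real.rpow_nonneg hx _))

end Solution

/-! ### Truncated powers as densities -/

/-- The truncated power `min(|z|, M)^e`, for `M ≥ 0`. -/
def truncPow (e M z : ℝ) : ℝ := min |z| M ^ e

lemma continuous_truncPow {e : ℝ} (he : 0 ≤ e) (M : ℝ) : Continuous (truncPow e M) :=
  (continuous_abs.min continuous_const).rpow_const fun _ => Or.inr he

section TruncPow

variable {e M : ℝ}

lemma truncPow_nonneg (hM : 0 ≤ M) (z : ℝ) : 0 ≤ truncPow e M z :=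
  Real.rpow_nonneg (le_min (abs_nonneg z) hM) _

lemma truncPow_le_abs (he : 0 ≤ e) (hM : 0 ≤ M) (z : ℝ) : truncPow e M z ≤ |z| ^ e :=
  Real.rpow_le_rpow (le_min (abs_nonneg z) hM) (min_le_left _ _) he

lemma truncPow_le (he : 0 ≤ e) (hM : 0 ≤ M) (z : ℝ) : truncPow e M z ≤ M ^ e :=
  Real.rpow_le_rpow (le_min (abs_nonneg z) hM) (min_le_right _ _) he

lemma truncPow_eq {z : ℝ} (h : |z| ≤ M) : truncPow e M z = |z| ^ e := by
  rw [truncPow, min_eq_left h]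

lemma truncPow_mono (he : 0 ≤ e) (hM : 0 ≤ M) {M' : ℝ} (h : M ≤ M') (z : ℝ) :
    truncPow e M z ≤ truncPow e M' z :=
  Real.rpow_le_rpow (le_min (abs_nonneg z) hM) (min_le_min le_rfl h) he

lemma truncPow_rpow (hM : 0 ≤ M) (e r z : ℝ) : truncPow e M z ^ r = truncPow (e * r) M z :=
  (Real.rpow_mul (le_min (abs_nonneg z) hM) _ _).symm

/-- For `0 ≤ y ≤ z`, `min(y, M) ≥ (y/z) min(z, M)`. -/
lemma rpow_mul_truncPow_le (he : 0 ≤ e) (hM : 0 ≤ M) {y z : ℝ} (hy : 0 ≤ y) (hyz : y ≤ z) :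
    y ^ e * truncPow e M z ≤ z ^ e * truncPow e M y := by
  have hz := hy.trans hyz
  rw [truncPow, truncPow, abs_of_nonneg hy, abs_of_nonneg hz, ← Real.mul_rpow hy (le_min hz hM),
    ← Real.mul_rpow hz (le_min hy hM)]
  refine Real.rpow_le_rpow (mul_nonneg hy (le_min hz hM)) ?_ he
  rw [mul_min_of_nonneg _ _ hz, le_min_iff]
  exact ⟨by rw [mul_comm z]; exact mul_le_mul_of_nonneg_left (min_le_left _ _) hy,
    mul_le_mul hyz (min_le_right _ _) (le_min hz hM) hz⟩

lemma prim_rpow {k : ℝ} (hk : 0 ≤ k) {z : ℝ} (hz : 0 ≤ z) :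
    prim (fun y => |y| ^ k) z = z ^ (k + 1) / (k + 1) := by
  have h1 : prim (fun y => |y| ^ k) z = ∫ y in (0:ℝ)..z, y ^ k := by
    refine intervalIntegral.integral_congr fun y hy => ?_
    rw [uIcc_of_le hz] at hy
    simp only [abs_of_nonneg hy.1]
  rw [h1, integral_rpow (Or.inl (by linarith)), Real.zero_rpow (by linarith), sub_zero]

lemma continuous_abs_rpow {k : ℝ} (hk : 0 ≤ k) : Continuous fun y : ℝ => |y| ^ k :=
  continuous_abs.rpow_const fun _ => Or.inr hk

lemma prim_truncPow_le (he : 0 ≤ e) (hM : 0 ≤ M) {z : ℝ} (hz : 0 ≤ z) :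
    prim (truncPow e M) z ≤ z * truncPow e M z := by
  have h : prim (truncPow e M) z ≤ ∫ _ in (0:ℝ)..z, truncPow e M z := by
    refine intervalIntegral.integral_mono_on hz ((continuous_truncPow he M).intervalIntegrable _ _)
      (continuous_const.intervalIntegrable _ _) fun y hy => ?_
    refine Real.rpow_le_rpow (le_min (abs_nonneg _) hM) (min_le_min ?_ le_rfl) he
    rw [abs_of_nonneg hy.1, abs_of_nonneg hz]
    exact hy.2
  simpa using h

/-- A lower bound of the primitive of a truncated power, with a constant independent of `M`. -/
lemma mul_truncPow_le_prim {k : ℝ} (hk : 0 ≤ k) (he : 0 ≤ e) (hM : 0 ≤ M) {z : ℝ} (hz : 0 ≤ z) :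
    z ^ (k + 1) * truncPow e M z ≤ (k + e + 1) * prim (fun y => |y| ^ k * truncPow e M y) z := by
  rcases hz.eq_or_lt with rfl | hz'
  · rw [Real.zero_rpow (by linarith), prim, intervalIntegral.integral_same, zero_mul, mul_zero]
  have hc : Continuous fun y => |y| ^ k * truncPow e M y :=
    (continuous_abs_rpow hk).mul (continuous_truncPow he M)
  have h : ∫ y in (0:ℝ)..z, |y| ^ (k + e) * (truncPow e M z / z ^ e)
      ≤ prim (fun y => |y| ^ k * truncPow e M y) z := by
    refine intervalIntegral.integral_mono_on hz
      (((continuous_abs_rpow (add_nonneg hk he)).mul_const _).intervalIntegrable _ _)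
      (hc.intervalIntegrable _ _) fun y hy => ?_
    rw [abs_of_nonneg hy.1, Real.rpow_add_of_nonneg hy.1 hk he, mul_assoc, mul_div_assoc']
    refine mul_le_mul_of_nonneg_left ?_ (Real.rpow_nonneg hy.1 _)
    rw [div_le_iff₀ (Real.rpow_pos_of_pos hz' _), mul_comm (truncPow e M y)]
    exact rpow_mul_truncPow_le he hM hy.1 hy.2
  rw [intervalIntegral.integral_mul_const] at h
  have h2 := prim_rpow (add_nonneg hk he) hz
  rw [prim] at h2
  rw [h2] at h
  have h3 : z ^ (k + e + 1) = z ^ (k + 1) * z ^ e := by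
    rw [← Real.rpow_add hz']; ring_nf
  rw [h3] at h
  have hpos : 0 < z ^ e := Real.rpow_pos_of_pos hz' _
  have h4 : z ^ (k + 1) * z ^ e / (k + e + 1) * (truncPow e M z / z ^ e)
      = z ^ (k + 1) * truncPow e M z / (k + e + 1) := by
    field_simp
  rw [h4, div_le_iff₀ (by linarith)] at h
  linarith

lemma prim_mul_truncPow_le {k : ℝ} (hk : 0 ≤ k) (he : 0 ≤ e) (hM : 0 ≤ M) {z : ℝ} (hz : 0 ≤ z) :
    prim (fun y => |y| ^ k * truncPow e M y) z ≤ z ^ (k + e + 1) := by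
  have h := prim_le_prim (ρ' := fun y => |y| ^ (k + e))
    ((continuous_abs_rpow hk).mul (continuous_truncPow he M))
    (continuous_abs_rpow (add_nonneg hk he)) (fun y => by
      rw [Real.rpow_add_of_nonneg (abs_nonneg y) hk he]
      exact mul_le_mul_of_nonneg_left (truncPow_le_abs he hM y) (by positivity)) hz
  rw [prim_rpow (add_nonneg hk he) hz] at h
  exact h.trans (div_le_self (Real.rpow_nonneg hz _) (by linarith))

/-- The storage function of a power density. -/
lemma storage_rpow {lam : ℝ} (hlam : 0 < lam) (he : 0 ≤ e) {z : ℝ} (hz : 0 ≤ z) :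
    storage lam (fun y => |y| ^ e) z
      = lam / ((e + 1) * (lam + e + 1)) * z ^ (lam + e + 1) := by
  have h1 : storage lam (fun y => |y| ^ e) z
      = ∫ y in (0:ℝ)..(z ^ lam), y ^ ((e + 1) / lam) / (e + 1) := by
    refine intervalIntegral.integral_congr fun y hy => ?_
    rw [uIcc_of_le (Real.rpow_nonneg hz _)] at hy
    rw [prim_rpow he (Real.rpow_nonneg hy.1 _), ← Real.rpow_mul hy.1]
    congr 2
    ring
  have h0 : 0 < (e + 1) / lam := by positivity
  rw [h1, intervalIntegral.integral_div, integral_rpow (Or.inl (by linarith)),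
    Real.zero_rpow (by linarith), sub_zero, ← Real.rpow_mul hz]
  have e2 : lam * ((e + 1) / lam + 1) = lam + e + 1 := by field_simp; ring
  rw [e2]
  have h3 : lam + e + 1 ≠ 0 := by positivity
  field_simp
  ring

end TruncPow

/-! ### Young's inequality with a small parameter -/

lemma exists_young {p q : ℝ} (h : p.HolderConjugate q) {η : ℝ≥0∞} (h0 : η ≠ 0) (ht : η ≠ ⊤) :
    ∃ C : ℝ≥0∞, C ≠ ⊤ ∧ ∀ a b : ℝ≥0∞, a * b ≤ η * a ^ p + C * b ^ q := by
  have hp := h.pos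
  have hq := h.symm.pos
  set r := η ^ (1 / p) with hr
  have hr0 : r ≠ 0 := (ENNReal.rpow_pos (pos_iff_ne_zero.2 h0) ht).ne'
  have hrt : r ≠ ⊤ := ENNReal.rpow_ne_top_of_nonneg (by positivity) ht
  refine ⟨r⁻¹ ^ q, ENNReal.rpow_ne_top_of_nonneg hq.le (ENNReal.inv_ne_top.2 hr0), fun a b => ?_⟩
  calc a * b = (r * a) * (r⁻¹ * b) := by
        rw [mul_mul_mul_comm, ENNReal.mul_inv_cancel hr0 hrt, one_mul]
    _ ≤ (r * a) ^ p / ENNReal.ofReal p + (r⁻¹ * b) ^ q / ENNReal.ofReal q :=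
        ENNReal.young_inequality _ _ h
    _ ≤ (r * a) ^ p + (r⁻¹ * b) ^ q := by
        refine add_le_add (ENNReal.div_le_of_le_mul ?_) (ENNReal.div_le_of_le_mul ?_)
        · exact le_mul_of_one_le_right' (by simpa using h.lt.le)
        · exact le_mul_of_one_le_right' (by simpa using h.symm.lt.le)
    _ = η * a ^ p + r⁻¹ ^ q * b ^ q := by
        rw [ENNReal.mul_rpow_of_nonneg _ _ hp.le, ENNReal.mul_rpow_of_nonneg _ _ hq.le, hr,
          ← ENNReal.rpow_mul, one_div_mul_cancel hp.ne', ENNReal.rpow_one]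

lemma rpow_le_one_add_rpow {x : ℝ≥0∞} {a b : ℝ} (ha : 0 ≤ a) (hab : a ≤ b) : x ^ a ≤ 1 + x ^ b := by
  rcases le_total x 1 with h | h
  · exact (ENNReal.rpow_le_one h ha).trans le_self_add
  · exact (ENNReal.rpow_le_rpow_of_exponent_le h hab).trans le_add_self

lemma ofReal_rpow_le_one_add {x a b : ℝ} (hx : 0 ≤ x) (ha : 0 ≤ a) (hab : a ≤ b) :
    ENNReal.ofReal (x ^ a) ≤ 1 + ENNReal.ofReal (x ^ b) := by
  rw [← ENNReal.ofReal_rpow_of_nonneg hx ha, ← ENNReal.ofReal_rpow_of_nonneg hx (ha.trans hab)]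
  exact rpow_le_one_add_rpow ha hab

/-! ### The boundary term at a fixed time -/

/-- The pointwise form of the interpolation: `min(z, M)^e` is split as its powers of exponents
`1 - θ`, bounded by `z^{e(1-θ)}`, and `θ`, which is part of the Sobolev function
`∫₀^z min(|y|, M)^{e/p} dy`. -/
lemma rpow_mul_truncPow_le_interpolation {p p' lam e θ ϑ α M : ℝ} (hp : 0 < p) (hlp : 0 < lam * p')
    (he : 0 ≤ e) (hα : 0 ≤ α * (1 - ϑ)) (hθ0 : 0 < θ) (hθ1 : θ < 1)
    (hid : lam * p' + e * (1 - θ) = α * (1 - ϑ) + p * θ) (hM : 0 ≤ M) {z : ℝ} (hz : 0 ≤ z) :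
    z ^ (lam * p') * truncPow e M z
      ≤ (e / p + 1) ^ (p * θ) * ((z ^ α) ^ (1 - ϑ) * prim (truncPow (e / p) M) z ^ (p * θ)) := by
  have hep : 0 ≤ e / p := by positivity
  have ht0 : 0 ≤ truncPow e M z := truncPow_nonneg hM z
  have h1 : truncPow e M z ≤ z ^ (e * (1 - θ)) * truncPow e M z ^ θ := by
    calc truncPow e M z = truncPow e M z ^ (1 - θ) * truncPow e M z ^ θ := by
          rw [← Real.rpow_add_of_nonneg ht0 (by linarith) hθ0.le, sub_add_cancel, Real.rpow_one]
      _ ≤ _ := by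
          refine mul_le_mul_of_nonneg_right ?_ (Real.rpow_nonneg ht0 _)
          rw [Real.rpow_mul hz]
          have := truncPow_le_abs he hM z
          rw [abs_of_nonneg hz] at this
          exact Real.rpow_le_rpow ht0 this (by linarith)
  have h2 : z * truncPow (e / p) M z ≤ (e / p + 1) * prim (truncPow (e / p) M) z := by
    have := mul_truncPow_le_prim (k := 0) le_rfl hep hM hz
    simpa using this
  have h3 : truncPow e M z ^ θ = truncPow (e / p) M z ^ (p * θ) := by
    rw [truncPow_rpow hM, truncPow_rpow hM]
    congr 1
    field_simp
  have hv : 0 ≤ prim (truncPow (e / p) M) z := prim_nonneg (truncPow_nonneg hM) hz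
  calc z ^ (lam * p') * truncPow e M z
      ≤ z ^ (lam * p') * (z ^ (e * (1 - θ)) * truncPow e M z ^ θ) :=
        mul_le_mul_of_nonneg_left h1 (Real.rpow_nonneg hz _)
    _ = (z ^ α) ^ (1 - ϑ) * (z * truncPow (e / p) M z) ^ (p * θ) := by
        rw [← mul_assoc, ← Real.rpow_add_of_nonneg hz hlp.le (mul_nonneg he (by linarith)), hid,
          Real.rpow_add_of_nonneg hz hα (by positivity), Real.rpow_mul hz,
          Real.mul_rpow hz (truncPow_nonneg hM z), h3, mul_assoc]
    _ ≤ (z ^ α) ^ (1 - ϑ) * ((e / p + 1) * prim (truncPow (e / p) M) z) ^ (p * θ) :=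
        mul_le_mul_of_nonneg_left (Real.rpow_le_rpow
          (mul_nonneg hz (truncPow_nonneg hM z)) h2 (by positivity))
          (Real.rpow_nonneg (Real.rpow_nonneg hz _) _)
    _ = _ := by rw [Real.mul_rpow (by positivity) hv]; ring

section FixedTime

variable {n : ℕ} {U : Set (E n)} {p p' lam e α θ : ℝ}

/-- Interpolation between `∫ w^α` and the dissipation by the Sobolev inequality, uniformly in the
truncation level `M`. -/
lemma exists_lintegral_truncPow_le [IsFiniteMeasure (volume.restrict U)] (hp : 1 ≤ p) (hpn : p < n)
    (hlp : 0 < lam * p') (he : 0 ≤ e) (hα : 0 < α) (hpe : p + e ≤ α) (hθ0 : 0 < θ) (hθ1 : θ < 1)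
    (hid : lam * p' + e * (1 - θ) = α * (1 - θ * (1 - p / n)) + p * θ)
    {Cs : ℝ≥0∞} (hCst : Cs ≠ ⊤)
    (hCs : ∀ f : E n → ℝ, ContDiff ℝ 1 f →
      (∫⁻ x in U, ‖f x‖ₑ ^ (n * p / (n - p))) ^ ((n - p) / (n * p))
        ≤ Cs * (eLpNorm f (ENNReal.ofReal p) (volume.restrict U)
          + eLpNorm (gradient f) (ENNReal.ofReal p) (volume.restrict U))) :
    ∃ C : ℝ≥0∞, C ≠ ⊤ ∧ ∀ M : ℝ, 0 ≤ M → ∀ (w : E n → ℝ) (G : E n → E n) (h : E n → ℝ),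
      IsRegular U p w G h → (∀ᵐ x ∂(volume.restrict U), 0 ≤ w x) →
      ∫⁻ x in U, ENNReal.ofReal (w x ^ (lam * p') * truncPow e M (w x))
        ≤ C * ((1 + ∫⁻ x in U, ENNReal.ofReal (w x ^ α)) ^ (1 - θ * (1 - p / n))
          * (1 + (∫⁻ x in U, ENNReal.ofReal (w x ^ α))
              + ∫⁻ x in U, ENNReal.ofReal (truncPow e M (w x)) * ‖G x‖ₑ ^ p) ^ θ) := by
  have hp0 : 0 < p := by linarith
  have hn0 : (0:ℝ) < n := hp0.trans hpn
  have hnp : (0:ℝ) < n - p := by linarith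
  set s : ℝ := n * p / (n - p) with hs
  have hs0 : 0 < s := by positivity
  have hs1 : (n - p) / (n * p) = 1 / s := by rw [hs, one_div_div]
  set ϑ : ℝ := θ * (1 - p / n) with hϑ
  have hpn1 : p / n < 1 := (div_lt_one hn0).2 hpn
  have hpn0 : 0 < p / n := by positivity
  have hϑ0 : 0 < ϑ := mul_pos hθ0 (by linarith)
  have hϑ1 : ϑ < 1 := by nlinarith
  have hsϑ : s * ϑ = p * θ := by rw [hs, hϑ]; field_simp
  rw [hs1] at hCs
  set m : ℝ≥0∞ := volume.restrict U univ with hm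
  have hmt : m ≠ ⊤ := measure_ne_top _ _
  refine ⟨ENNReal.ofReal ((e / p + 1) ^ (p * θ)) * (Cs ^ p * 2 ^ p * (m + 1)) ^ θ, ?_, ?_⟩
  · refine ENNReal.mul_ne_top ENNReal.ofReal_ne_top (ENNReal.rpow_ne_top_of_nonneg hθ0.le ?_)
    refine ENNReal.mul_ne_top (ENNReal.mul_ne_top (ENNReal.rpow_ne_top_of_nonneg hp0.le hCst)
      (ENNReal.rpow_ne_top_of_nonneg hp0.le (by simp))) (by simp [hmt])
  intro M hM w G h hreg hw0
  obtain ⟨v, hv⟩ := hreg.approx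
  set Y := ∫⁻ x in U, ENNReal.ofReal (w x ^ α) with hY
  set D := ∫⁻ x in U, ENNReal.ofReal (truncPow e M (w x)) * ‖G x‖ₑ ^ p with hD
  have hep : 0 ≤ e / p := by positivity
  have hcont := continuous_truncPow hep M
  have hwm : AEMeasurable (fun x => ENNReal.ofReal (w x ^ α)) (volume.restrict U) :=
    ((Real.continuous_rpow_const hα.le).comp_aestronglyMeasurable hreg.aesm).aemeasurable.ennreal_ofReal
  have hvm : AEMeasurable (fun x => ‖prim (truncPow (e / p) M) (w x)‖ₑ ^ s) (volume.restrict U) :=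
    ((continuous_prim hcont).comp_aestronglyMeasurable hreg.aesm).enorm.pow_const _
  -- Sobolev's inequality for the primitive of `min(|z|, M)^(e/p)`
  have hsob := hv.sobolev_le hp hs0 hreg.aesm hreg.memLp hCst hCs hcont (truncPow_nonneg hM)
  set A := eLpNorm (fun x => prim (truncPow (e / p) M) (w x)) (ENNReal.ofReal p) (volume.restrict U)
    with hA
  set B := eLpNorm (fun x => truncPow (e / p) M (w x) • G x) (ENNReal.ofReal p) (volume.restrict U)
    with hB
  have hAp : A ^ p ≤ m + Y := by
    rw [hA, eLpNorm_ofReal_eq hp0, ← ENNReal.rpow_mul, one_div_mul_cancel hp0.ne', ENNReal.rpow_one]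
    calc ∫⁻ x in U, ‖prim (truncPow (e / p) M) (w x)‖ₑ ^ p
        ≤ ∫⁻ x in U, (1 + ENNReal.ofReal (w x ^ α)) := by
          refine lintegral_mono_ae ?_
          filter_upwards [hw0] with x hx
          have h1 := prim_mul_truncPow_le (k := 0) le_rfl hep hM hx
          simp only [Real.rpow_zero, one_mul, zero_add] at h1
          have h2 := prim_nonneg (truncPow_nonneg (e := e / p) hM) hx
          rw [Real.enorm_of_nonneg h2, ENNReal.ofReal_rpow_of_nonneg h2 hp0.le]
          refine le_trans (ENNReal.ofReal_le_ofReal (Real.rpow_le_rpow h2 h1 hp0.le)) ?_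
          rw [← Real.rpow_mul hx]
          refine ofReal_rpow_le_one_add hx (by positivity) ?_
          calc (e / p + 1) * p = p + e := by field_simp; ring
            _ ≤ α := hpe
      _ = m + Y := by rw [lintegral_add_left measurable_const]; simp [hm, hY]
  have hBp : B ^ p = D := by
    rw [hB, eLpNorm_ofReal_eq hp0, ← ENNReal.rpow_mul, one_div_mul_cancel hp0.ne', ENNReal.rpow_one]
    refine lintegral_congr fun x => ?_
    have h1 := truncPow_nonneg (e := e / p) hM (w x)
    rw [enorm_smul, ENNReal.mul_rpow_of_nonneg _ _ hp0.le, Real.enorm_of_nonneg h1,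
      ENNReal.ofReal_rpow_of_nonneg h1 hp0.le, truncPow_rpow hM, div_mul_cancel₀ _ hp0.ne']
  have hV : (∫⁻ x in U, ‖prim (truncPow (e / p) M) (w x)‖ₑ ^ s) ^ ϑ
      ≤ (Cs ^ p * 2 ^ p * (m + 1)) ^ θ * (1 + Y + D) ^ θ := by
    calc (∫⁻ x in U, ‖prim (truncPow (e / p) M) (w x)‖ₑ ^ s) ^ ϑ
        ≤ ((Cs * (A + B)) ^ s) ^ ϑ := ENNReal.rpow_le_rpow hsob hϑ0.le
      _ = ((Cs * (A + B)) ^ p) ^ θ := by rw [← ENNReal.rpow_mul, hsϑ, ENNReal.rpow_mul]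
      _ ≤ (Cs ^ p * (2 ^ p * (A ^ p + B ^ p))) ^ θ := by
          refine ENNReal.rpow_le_rpow ?_ hθ0.le
          rw [ENNReal.mul_rpow_of_nonneg _ _ hp0.le]
          refine mul_le_mul_right ?_ _
          calc (A + B) ^ p ≤ (2 * max A B) ^ p := by
                refine ENNReal.rpow_le_rpow ?_ hp0.le
                rw [two_mul]
                exact add_le_add (le_max_left _ _) (le_max_right _ _)
            _ = 2 ^ p * max A B ^ p := ENNReal.mul_rpow_of_nonneg _ _ hp0.le
            _ ≤ 2 ^ p * (A ^ p + B ^ p) := by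
                refine mul_le_mul_right ?_ _
                rcases le_total A B with h1 | h1
                · rw [max_eq_right h1]; exact le_add_self
                · rw [max_eq_left h1]; exact le_self_add
      _ ≤ (Cs ^ p * 2 ^ p * (m + 1) * (1 + Y + D)) ^ θ := by
          refine ENNReal.rpow_le_rpow ?_ hθ0.le
          rw [hBp, mul_assoc (Cs ^ p * 2 ^ p), ← mul_assoc (Cs ^ p)]
          refine mul_le_mul_right ?_ _
          calc A ^ p + D ≤ m + Y + D := add_le_add hAp le_rfl
            _ ≤ (m + m * (Y + D)) + (1 + Y + D) := by
                rw [add_assoc m, add_assoc 1]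
                exact add_le_add le_self_add le_add_self
            _ = (m + 1) * (1 + Y + D) := by ring
      _ = _ := ENNReal.mul_rpow_of_nonneg _ _ hθ0.le
  calc ∫⁻ x in U, ENNReal.ofReal (w x ^ (lam * p') * truncPow e M (w x))
      ≤ ∫⁻ x in U, ENNReal.ofReal ((e / p + 1) ^ (p * θ))
          * (ENNReal.ofReal (w x ^ α) ^ (1 - ϑ)
            * (‖prim (truncPow (e / p) M) (w x)‖ₑ ^ s) ^ ϑ) := by
        refine lintegral_mono_ae ?_
        filter_upwards [hw0] with x hx
        have h2 := prim_nonneg (truncPow_nonneg (e := e / p) hM) hx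
        rw [← ENNReal.rpow_mul, hsϑ, Real.enorm_of_nonneg h2,
          ENNReal.ofReal_rpow_of_nonneg (Real.rpow_nonneg hx _) (by linarith),
          ENNReal.ofReal_rpow_of_nonneg h2 (by positivity), ← ENNReal.ofReal_mul (by positivity),
          ← ENNReal.ofReal_mul (by positivity)]
        exact ENNReal.ofReal_le_ofReal (rpow_mul_truncPow_le_interpolation hp0 hlp he
          (mul_nonneg hα.le (by linarith)) hθ0 hθ1 hid hM hx)
    _ = ENNReal.ofReal ((e / p + 1) ^ (p * θ)) * ∫⁻ x in U, ENNReal.ofReal (w x ^ α) ^ (1 - ϑ)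
            * (‖prim (truncPow (e / p) M) (w x)‖ₑ ^ s) ^ ϑ :=
        lintegral_const_mul' _ _ ENNReal.ofReal_ne_top
    _ ≤ ENNReal.ofReal ((e / p + 1) ^ (p * θ)) * (Y ^ (1 - ϑ)
          * (∫⁻ x in U, ‖prim (truncPow (e / p) M) (w x)‖ₑ ^ s) ^ ϑ) :=
        mul_le_mul_right (ENNReal.lintegral_mul_norm_pow_le hwm hvm (by linarith) hϑ0.le
          (by ring)) _
    _ ≤ ENNReal.ofReal ((e / p + 1) ^ (p * θ)) * ((1 + Y) ^ (1 - ϑ)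
          * ((Cs ^ p * 2 ^ p * (m + 1)) ^ θ * (1 + Y + D) ^ θ)) :=
        mul_le_mul_right (mul_le_mul' (ENNReal.rpow_le_rpow le_add_self (by linarith)) hV) _
    _ = _ := by ring

/-- The boundary term is absorbed by the dissipation, uniformly in the truncation level `M`. -/
theorem exists_boundary_le [IsFiniteMeasure (volume.restrict U)]
    (hpp : p.HolderConjugate p') (hpn : p < n)
    (hlam : 0 < lam) (he : 0 ≤ e) (hα : α = lam + e + 1) (hpe : p + e ≤ α)
    (hθ0 : 0 < θ) (hθ1 : θ < 1)
    (hid : lam * p' + e * (1 - θ) = α * (1 - θ * (1 - p / n)) + p * θ)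
    {Cs : ℝ≥0∞} (hCst : Cs ≠ ⊤)
    (hCs : ∀ f : E n → ℝ, ContDiff ℝ 1 f →
      (∫⁻ x in U, ‖f x‖ₑ ^ (n * p / (n - p))) ^ ((n - p) / (n * p))
        ≤ Cs * (eLpNorm f (ENNReal.ofReal p) (volume.restrict U)
          + eLpNorm (gradient f) (ENNReal.ofReal p) (volume.restrict U)))
    {Ct : ℝ≥0∞} (hCtt : Ct ≠ ⊤)
    (hCt : ∀ f : E n → ℝ, ContDiff ℝ 1 f →
      ∫⁻ x, ‖f x‖ₑ ∂(surfaceMeasure U) ≤ Ct * ∫⁻ x in U, (‖f x‖ₑ + ‖fderiv ℝ f x‖ₑ))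
    {η : ℝ≥0∞} (hη0 : η ≠ 0) (hηt : η ≠ ⊤) :
    ∃ C : ℝ≥0∞, C ≠ ⊤ ∧ ∀ M : ℝ, 0 ≤ M → ∀ (w : E n → ℝ) (G : E n → E n) (h : E n → ℝ),
      IsRegular U p w G h → (∀ᵐ x ∂(volume.restrict U), 0 ≤ w x) →
      (∀ᵐ x ∂(surfaceMeasure U), 0 ≤ h x) → ∀ Φ : ℝ≥0∞,
      Φ * ∫⁻ x, ENNReal.ofReal (h x ^ lam * prim (truncPow e M) (h x)) ∂(surfaceMeasure U)
        ≤ η * (∫⁻ x in U, ENNReal.ofReal (truncPow e M (w x)) * ‖G x‖ₑ ^ p)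
          + C * ((1 + Φ ^ (p' / (1 - θ)))
            * (1 + ∫⁻ x in U, ENNReal.ofReal (w x ^ α)) ^ (1 + θ * p / (n * (1 - θ)))) := by
  have hp0 := hpp.pos
  have hp'0 := hpp.symm.pos
  have hn0 : (0:ℝ) < n := hp0.trans hpn
  have hα0 : 0 < α := by linarith
  have hpn1 : p / n < 1 := (div_lt_one hn0).2 hpn
  have hpn0 : 0 < p / n := by positivity
  have hθ' : 0 < 1 - θ := by linarith
  set ϑ : ℝ := θ * (1 - p / n) with hϑ
  have hϑ0 : 0 < ϑ := mul_pos hθ0 (by linarith)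
  have hϑ1 : ϑ < 1 := by nlinarith
  set q := p' / (1 - θ) with hq
  have hp'q : p' ≤ q := by rw [hq, le_div_iff₀ hθ']; nlinarith
  set μ := θ * p / (n * (1 - θ)) with hμ
  have hμ0 : 0 ≤ μ := by positivity
  have hμ1 : 1 + μ = (1 - ϑ) / (1 - θ) := by rw [hμ, hϑ]; field_simp; ring
  have hμ2 : 1 - ϑ + θ ≤ 1 + μ := by
    have : θ - ϑ = μ * (1 - θ) := by rw [hμ, hϑ]; field_simp; ring
    nlinarith
  have hη2 : η / 2 ≠ 0 := (ENNReal.div_pos hη0 (by simp)).ne'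
  have hη2t : η / 2 ≠ ⊤ := ENNReal.div_ne_top hηt (by simp)
  obtain ⟨C₁, hC₁t, hC₁⟩ := exists_young hpp hη2 hη2t
  obtain ⟨C₂, hC₂t, hC₂⟩ := exists_lintegral_truncPow_le (U := U) hpp.lt.le hpn
    (mul_pos hlam hp'0) he hα0 hpe hθ0 hθ1 hid hCst hCs
  have hconj : (1 / θ).HolderConjugate (1 / (1 - θ)) := by
    rw [Real.holderConjugate_iff]
    exact ⟨by rw [lt_div_iff₀ hθ0]; linarith, by simp⟩
  obtain ⟨C₃, hC₃t, hC₃⟩ := exists_young hconj hη2 hη2t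
  set c₀ : ℝ≥0∞ := ENNReal.ofReal α * Ct with hc₀
  have hc₀t : c₀ ≠ ⊤ := ENNReal.mul_ne_top ENNReal.ofReal_ne_top hCtt
  set c₁ : ℝ≥0∞ := C₁ * c₀ ^ p' * C₂ with hc₁
  have hc₁t : c₁ ≠ ⊤ :=
    ENNReal.mul_ne_top (ENNReal.mul_ne_top hC₁t (ENNReal.rpow_ne_top_of_nonneg hp'0.le hc₀t)) hC₂t
  refine ⟨c₀ + c₁ + C₃ * c₁ ^ (1 / (1 - θ)), ?_, ?_⟩
  · exact ENNReal.add_ne_top.2 ⟨ENNReal.add_ne_top.2 ⟨hc₀t, hc₁t⟩, ENNReal.mul_ne_top hC₃t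
      (ENNReal.rpow_ne_top_of_nonneg (by positivity) hc₁t)⟩
  intro M hM w G h hreg hw0 hh0 Φ
  have hJ := hC₂ M hM w G h hreg hw0
  obtain ⟨v, hv⟩ := hreg.approx
  set Y := ∫⁻ x in U, ENNReal.ofReal (w x ^ α) with hY
  set D := ∫⁻ x in U, ENNReal.ofReal (truncPow e M (w x)) * ‖G x‖ₑ ^ p with hD
  set J := ∫⁻ x in U, ENNReal.ofReal (w x ^ (lam * p') * truncPow e M (w x)) with hJdef
  have htc := continuous_truncPow he M
  have hc : Continuous fun y => |y| ^ lam * truncPow e M y := (continuous_abs_rpow hlam.le).mul htc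
  have hc0 : ∀ y, 0 ≤ |y| ^ lam * truncPow e M y := fun y =>
    mul_nonneg (by positivity) (truncPow_nonneg hM y)
  have hwm : AEMeasurable (fun x => ENNReal.ofReal (w x ^ α)) (volume.restrict U) :=
    ((Real.continuous_rpow_const hα0.le).comp_aestronglyMeasurable
      hreg.aesm).aemeasurable.ennreal_ofReal
  -- the trace inequality
  have htrace : ∫⁻ x, ENNReal.ofReal (h x ^ lam * prim (truncPow e M) (h x)) ∂(surfaceMeasure U)
      ≤ c₀ * (Y + ∫⁻ x in U, ENNReal.ofReal (w x ^ lam * truncPow e M (w x)) * ‖G x‖ₑ) := by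
    calc ∫⁻ x, ENNReal.ofReal (h x ^ lam * prim (truncPow e M) (h x)) ∂(surfaceMeasure U)
        ≤ ∫⁻ x, ENNReal.ofReal α * ‖prim (fun y => |y| ^ lam * truncPow e M y) (h x)‖ₑ
            ∂(surfaceMeasure U) := by
          refine lintegral_mono_ae ?_
          filter_upwards [hh0] with x hx
          rw [Real.enorm_of_nonneg (prim_nonneg hc0 hx), ← ENNReal.ofReal_mul hα0.le]
          refine ENNReal.ofReal_le_ofReal ?_
          rw [hα]
          refine le_trans ?_ (mul_truncPow_le_prim hlam.le he hM hx)
          rw [Real.rpow_add_of_nonneg hx hlam.le zero_le_one, Real.rpow_one, mul_assoc]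
          exact mul_le_mul_of_nonneg_left (prim_truncPow_le he hM hx) (Real.rpow_nonneg hx _)
      _ = ENNReal.ofReal α * ∫⁻ x, ‖prim (fun y => |y| ^ lam * truncPow e M y) (h x)‖ₑ
            ∂(surfaceMeasure U) := lintegral_const_mul' _ _ ENNReal.ofReal_ne_top
      _ ≤ ENNReal.ofReal α * (Ct * ∫⁻ x in U, (‖prim (fun y => |y| ^ lam * truncPow e M y) (w x)‖ₑ
            + ‖|w x| ^ lam * truncPow e M (w x)‖ₑ * ‖G x‖ₑ)) :=
          mul_le_mul_right (hv.trace_le hpp.lt.le hreg.aesm hreg.memLp hCtt hCt hc hc0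
            hreg.aesm_boundary) _
      _ ≤ ENNReal.ofReal α * (Ct * ∫⁻ x in U, (ENNReal.ofReal (w x ^ α)
            + ENNReal.ofReal (w x ^ lam * truncPow e M (w x)) * ‖G x‖ₑ)) := by
          refine mul_le_mul_right (mul_le_mul_right (lintegral_mono_ae ?_) _) _
          filter_upwards [hw0] with x hx
          have h1 := hc0 (w x)
          rw [Real.enorm_of_nonneg (prim_nonneg hc0 hx), Real.enorm_of_nonneg h1, abs_of_nonneg hx]
          refine add_le_add (ENNReal.ofReal_le_ofReal ?_) le_rfl
          rw [hα]
          exact prim_mul_truncPow_le hlam.le he hM hx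
      _ = _ := by rw [lintegral_add_left' hwm, hc₀, mul_assoc]
  -- Young's inequality for the gradient term
  have hgrad : c₀ * Φ * ∫⁻ x in U, ENNReal.ofReal (w x ^ lam * truncPow e M (w x)) * ‖G x‖ₑ
      ≤ η / 2 * D + C₁ * (c₀ * Φ) ^ p' * J := by
    have hJm : AEMeasurable (fun x => ENNReal.ofReal (truncPow e M (w x)) * ‖G x‖ₑ ^ p)
        (volume.restrict U) :=
      ((htc.comp_aestronglyMeasurable hreg.aesm).aemeasurable.ennreal_ofReal).mul
        (hreg.memLp.1.enorm.pow_const _)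
    have hJm2 : AEMeasurable (fun x => ENNReal.ofReal (w x ^ (lam * p') * truncPow e M (w x)))
        (volume.restrict U) :=
      (((Real.continuous_rpow_const (mul_pos hlam hp'0).le).mul htc).comp_aestronglyMeasurable
        hreg.aesm).aemeasurable.ennreal_ofReal
    have hm1 : AEMeasurable (fun x => ENNReal.ofReal (w x ^ lam * truncPow e M (w x)) * ‖G x‖ₑ)
        (volume.restrict U) :=
      ((((Real.continuous_rpow_const hlam.le).mul htc).comp_aestronglyMeasurable
        hreg.aesm).aemeasurable.ennreal_ofReal).mul hreg.memLp.1.enorm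
    rw [← lintegral_const_mul'' _ hm1, ← lintegral_const_mul'' _ hJm, ← lintegral_const_mul'' _ hJm2,
      ← lintegral_add_left' (hJm.const_mul _)]
    refine lintegral_mono_ae ?_
    filter_upwards [hw0] with x hx
    have ht0 := truncPow_nonneg (e := e) hM (w x)
    have h1 := hC₁ ‖G x‖ₑ (c₀ * Φ * ENNReal.ofReal (w x ^ lam))
    have h2 : (c₀ * Φ * ENNReal.ofReal (w x ^ lam)) ^ p'
        = (c₀ * Φ) ^ p' * ENNReal.ofReal (w x ^ (lam * p')) := by
      rw [ENNReal.mul_rpow_of_nonneg _ _ hp'0.le,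
        ENNReal.ofReal_rpow_of_nonneg (Real.rpow_nonneg hx _) hp'0.le, ← Real.rpow_mul hx]
    rw [h2] at h1
    calc c₀ * Φ * (ENNReal.ofReal (w x ^ lam * truncPow e M (w x)) * ‖G x‖ₑ)
        = ENNReal.ofReal (truncPow e M (w x))
            * (‖G x‖ₑ * (c₀ * Φ * ENNReal.ofReal (w x ^ lam))) := by
          rw [ENNReal.ofReal_mul (Real.rpow_nonneg hx _)]; ring
      _ ≤ ENNReal.ofReal (truncPow e M (w x)) * (η / 2 * ‖G x‖ₑ ^ p
            + C₁ * ((c₀ * Φ) ^ p' * ENNReal.ofReal (w x ^ (lam * p')))) := mul_le_mul_right h1 _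
      _ = _ := by rw [ENNReal.ofReal_mul (Real.rpow_nonneg hx _)]; ring
  -- the remaining term, by interpolation and Young's inequality with the exponents `1/θ`, `1/(1-θ)`
  set Z := 1 + Y with hZ
  have hZ1 : 1 ≤ Z := le_self_add
  have hJ2 : C₁ * (c₀ * Φ) ^ p' * J
      ≤ c₁ * ((1 + Φ ^ q) * Z ^ (1 + μ)) + η / 2 * D
        + C₃ * c₁ ^ (1 / (1 - θ)) * ((1 + Φ ^ q) * Z ^ (1 + μ)) := by
    have h1 := hC₃ (D ^ θ) (c₁ * (Φ ^ p' * Z ^ (1 - ϑ)))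
    rw [← ENNReal.rpow_mul, mul_one_div_cancel hθ0.ne', ENNReal.rpow_one] at h1
    have h2 : (c₁ * (Φ ^ p' * Z ^ (1 - ϑ))) ^ (1 / (1 - θ))
        = c₁ ^ (1 / (1 - θ)) * (Φ ^ q * Z ^ (1 + μ)) := by
      rw [ENNReal.mul_rpow_of_nonneg c₁ _ (by positivity),
        ENNReal.mul_rpow_of_nonneg (Φ ^ p') _ (by positivity), ← ENNReal.rpow_mul, ← ENNReal.rpow_mul,
        hq, hμ1]
      congr 3 <;> ring_nf
    rw [h2] at h1
    have h3 : Φ ^ p' * (Z ^ (1 - ϑ) * Z ^ θ) ≤ (1 + Φ ^ q) * Z ^ (1 + μ) := by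
      rw [← ENNReal.rpow_add_of_nonneg _ _ (by linarith) hθ0.le]
      exact mul_le_mul' (rpow_le_one_add_rpow hp'0.le hp'q)
        (ENNReal.rpow_le_rpow_of_exponent_le hZ1 hμ2)
    calc C₁ * (c₀ * Φ) ^ p' * J
        ≤ C₁ * (c₀ * Φ) ^ p' * (C₂ * (Z ^ (1 - ϑ) * (Z ^ θ + D ^ θ))) := by
          refine mul_le_mul_right (hJ.trans (mul_le_mul_right (mul_le_mul_right ?_ _) _)) _
          exact ENNReal.rpow_add_le_add_rpow _ _ hθ0.le hθ1.le
      _ = c₁ * (Φ ^ p' * (Z ^ (1 - ϑ) * Z ^ θ)) + D ^ θ * (c₁ * (Φ ^ p' * Z ^ (1 - ϑ))) := by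
          rw [ENNReal.mul_rpow_of_nonneg _ _ hp'0.le, hc₁]; ring
      _ ≤ c₁ * ((1 + Φ ^ q) * Z ^ (1 + μ)) + (η / 2 * D
            + C₃ * (c₁ ^ (1 / (1 - θ)) * (Φ ^ q * Z ^ (1 + μ)))) :=
          add_le_add (mul_le_mul_right h3 _) h1
      _ ≤ c₁ * ((1 + Φ ^ q) * Z ^ (1 + μ)) + (η / 2 * D
            + C₃ * (c₁ ^ (1 / (1 - θ)) * ((1 + Φ ^ q) * Z ^ (1 + μ)))) := by
          gcongr
          exact le_add_self
      _ = _ := by ring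
  have hΦY : Φ * Y ≤ (1 + Φ ^ q) * Z ^ (1 + μ) := by
    refine mul_le_mul' ?_ ?_
    · have := rpow_le_one_add_rpow (x := Φ) zero_le_one (hpp.symm.lt.le.trans hp'q)
      rwa [ENNReal.rpow_one] at this
    · calc Y ≤ Z := le_add_self
        _ = Z ^ (1:ℝ) := (ENNReal.rpow_one _).symm
        _ ≤ _ := ENNReal.rpow_le_rpow_of_exponent_le hZ1 (by linarith)
  calc Φ * ∫⁻ x, ENNReal.ofReal (h x ^ lam * prim (truncPow e M) (h x)) ∂(surfaceMeasure U)
      ≤ Φ * (c₀ * (Y + ∫⁻ x in U, ENNReal.ofReal (w x ^ lam * truncPow e M (w x)) * ‖G x‖ₑ)) :=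
        mul_le_mul_right htrace _
    _ = c₀ * (Φ * Y) + c₀ * Φ * ∫⁻ x in U, ENNReal.ofReal (w x ^ lam * truncPow e M (w x)) * ‖G x‖ₑ := by
        ring
    _ ≤ c₀ * ((1 + Φ ^ q) * Z ^ (1 + μ)) + (η / 2 * D
          + (c₁ * ((1 + Φ ^ q) * Z ^ (1 + μ)) + η / 2 * D
            + C₃ * c₁ ^ (1 / (1 - θ)) * ((1 + Φ ^ q) * Z ^ (1 + μ)))) :=
        add_le_add (mul_le_mul_right hΦY _) (hgrad.trans (add_le_add le_rfl hJ2))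
    _ = (η / 2 + η / 2) * D + (c₀ + c₁ + C₃ * c₁ ^ (1 / (1 - θ))) * ((1 + Φ ^ q) * Z ^ (1 + μ)) := by
        ring
    _ = _ := by rw [ENNReal.add_halves]

end FixedTime

/-! ### The energy inequality for powers of the solution -/

/-- The sup norm over a fibre depends measurably on the base point. -/
lemma aemeasurable_eLpNorm_top {X Y : Type*} [MeasurableSpace X] [MeasurableSpace Y] {μ : Measure X}
    {ν : Measure Y} [SFinite μ] [SFinite ν] {f : X × Y → ℝ}
    (hf : AEStronglyMeasurable f (μ.prod ν)) :
    AEMeasurable (fun x => eLpNorm (fun y => f (x, y)) ⊤ ν) μ := by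
  refine ⟨fun x => eLpNorm (fun y => hf.mk f (x, y)) ⊤ ν, ?_, ?_⟩
  · refine measurable_of_Iic fun c => ?_
    have hS : MeasurableSet {z | c < ‖hf.mk f z‖ₑ} :=
      measurableSet_lt measurable_const hf.stronglyMeasurable_mk.measurable.enorm
    have h1 : (fun x => eLpNorm (fun y => hf.mk f (x, y)) ⊤ ν) ⁻¹' Iic c
        = (fun x => ν (Prod.mk x ⁻¹' {z | c < ‖hf.mk f z‖ₑ})) ⁻¹' {0} := by
      ext x
      rw [mem_preimage, mem_Iic, eLpNorm_exponent_top, mem_preimage, mem_singleton_iff]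
      constructor
      · intro h
        have h2 := ae_le_eLpNormEssSup (f := fun y => hf.mk f (x, y)) (μ := ν)
        refine measure_mono_null (fun y hy => ?_) h2
        exact not_le.2 (h.trans_lt hy)
      · intro h
        refine essSup_le_of_ae_le _ ?_
        rw [EventuallyLE, ae_iff]
        simpa [not_le] using h
    rw [h1]
    exact measurable_measure_prodMk_left hS (measurableSet_singleton 0)
  · filter_upwards [Measure.ae_ae_of_ae_prod hf.ae_eq_mk] with x hx
    exact eLpNorm_congr_ae hx

lemma aemeasurable_negSup {n : ℕ} {U : Set (E n)} [IsFiniteMeasure (surfaceMeasure U)]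
    {φ : ℝ → E n → ℝ} {m : Measure ℝ} [SFinite m]
    (hφ : AEStronglyMeasurable (Function.uncurry φ) (m.prod (surfaceMeasure U))) :
    AEMeasurable (negSup U φ) m :=
  aemeasurable_eLpNorm_top (f := fun z : ℝ × E n => max (-φ z.1 z.2) 0)
    (hφ.neg.sup aestronglyMeasurable_const)

section Solution

variable {n : ℕ} {U : Set (E n)} {g : GenPoly} {lam e α θ : ℝ}

/-- The energy inequality for `∫ u^α`: its growth and the dissipation are controlled by the
integral of `(1 + ‖φ⁻‖^q) (1 + ∫ u^α)^{1+μ}`. -/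
theorem exists_power_energy_le [IsFiniteMeasure (volume.restrict U)]
    [IsFiniteMeasure (surfaceMeasure U)] (hpn : 2 - g.a < n)
    (hlam : 0 < lam) (hlam1 : lam ≤ 1) (he : 0 ≤ e) (hα : α = lam + e + 1)
    (hpe : 2 - g.a + e ≤ α) (hθ0 : 0 < θ) (hθ1 : θ < 1)
    (hid : lam * ((2 - g.a) / (1 - g.a)) + e * (1 - θ)
      = α * (1 - θ * (1 - (2 - g.a) / n)) + (2 - g.a) * θ)
    {Cs : ℝ≥0∞} (hCst : Cs ≠ ⊤)
    (hCs : ∀ f : E n → ℝ, ContDiff ℝ 1 f →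
      (∫⁻ x in U, ‖f x‖ₑ ^ (n * (2 - g.a) / (n - (2 - g.a)))) ^ ((n - (2 - g.a)) / (n * (2 - g.a)))
        ≤ Cs * (eLpNorm f (ENNReal.ofReal (2 - g.a)) (volume.restrict U)
          + eLpNorm (gradient f) (ENNReal.ofReal (2 - g.a)) (volume.restrict U)))
    {Ct : ℝ≥0∞} (hCtt : Ct ≠ ⊤)
    (hCt : ∀ f : E n → ℝ, ContDiff ℝ 1 f →
      ∫⁻ x, ‖f x‖ₑ ∂(surfaceMeasure U) ≤ Ct * ∫⁻ x in U, (‖f x‖ₑ + ‖fderiv ℝ f x‖ₑ)) :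
    ∃ C : ℝ≥0∞, C ≠ ⊤ ∧ ∀ (T : ℝ) (φ : ℝ → E n → ℝ) (u₀ : E n → ℝ) (u : ℝ → E n → ℝ)
      (Du : ℝ → E n → E n) (tr : ℝ → E n → ℝ), IsWeakSolution U g lam α T φ u₀ u Du tr →
      AEStronglyMeasurable (Function.uncurry φ)
        ((volume.restrict (Ioc 0 T)).prod (surfaceMeasure U)) →
      ∀ s t : ℝ, 0 < s → s < t → t ≤ T → ∀ F : ℝ → ℝ≥0∞,
      (∀ τ, F τ = (1 + negSup U φ τ ^ ((2 - g.a) / (1 - g.a) / (1 - θ)))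
        * (1 + ∫⁻ x in U, ENNReal.ofReal (u τ x ^ α)) ^ (1 + θ * (2 - g.a) / (n * (1 - θ)))) →
      ∫⁻ x in U, ENNReal.ofReal (u t x ^ α)
        ≤ (∫⁻ x in U, ENNReal.ofReal (u s x ^ α)) + C * ∫⁻ τ in Ioc s t, F τ ∧
      ∫⁻ z, ENNReal.ofReal (|u z.1 z.2| ^ e) * ‖Du z.1 z.2‖ₑ ^ (2 - g.a)
          ∂((volume.restrict (Ioc s t)).prod (volume.restrict U))
        ≤ C * ((∫⁻ x in U, ENNReal.ofReal (u s x ^ α)) + ∫⁻ τ in Ioc s t, F τ) := by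
  set p := 2 - g.a with hp
  set p' := (2 - g.a) / (1 - g.a) with hp'
  have hpp : p.HolderConjugate p' := holderConjugate_flux g
  have hp0 := hpp.pos
  have hn0 : (0:ℝ) < n := hp0.trans hpn
  have hα0 : 0 < α := by linarith
  have hα1 : 1 ≤ α := by linarith
  obtain ⟨CK, hCK0, hCK⟩ := g.exists_rpow_le_K
  set κ : ℝ≥0∞ := ENNReal.ofReal CK with hκ
  have hκ0 : κ ≠ 0 := by simpa [hκ] using hCK0
  have hκt : κ ≠ ⊤ := ENNReal.ofReal_ne_top
  have hη0 : (2 * κ)⁻¹ ≠ 0 := ENNReal.inv_ne_zero.2 (ENNReal.mul_ne_top (by simp) hκt)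
  have hηt : (2 * κ)⁻¹ ≠ ⊤ := ENNReal.inv_ne_top.2 (mul_ne_zero (by simp) hκ0)
  obtain ⟨C₁, hC₁t, hC₁⟩ := exists_boundary_le (U := U) hpp hpn hlam he hα hpe hθ0 hθ1 hid hCst hCs
    hCtt hCt hη0 hηt
  set m : ℝ≥0∞ := volume.restrict U univ with hm
  have hmt : m ≠ ⊤ := measure_ne_top _ _
  set c : ℝ := lam / ((e + 1) * (lam + e + 1)) with hc
  have hc0 : 0 < c := by positivity
  set d : ℝ≥0∞ := ENNReal.ofReal c with hd
  have hd0 : d ≠ 0 := by simpa [hd] using hc0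
  have hdt : d ≠ ⊤ := ENNReal.ofReal_ne_top
  set C₂ : ℝ≥0∞ := C₁ + (m + 1) with hC₂
  have hC₂t : C₂ ≠ ⊤ := ENNReal.add_ne_top.2 ⟨hC₁t, by simp [hmt]⟩
  have hC₂0 : C₂ ≠ 0 := by simp [hC₂]
  refine ⟨d⁻¹ * C₂ + κ * (2 * (d + C₂) + (m + 1)), ?_, ?_⟩
  · refine ENNReal.add_ne_top.2 ⟨ENNReal.mul_ne_top (ENNReal.inv_ne_top.2 hd0) hC₂t,
      ENNReal.mul_ne_top hκt (ENNReal.add_ne_top.2 ⟨ENNReal.mul_ne_top (by simp)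
        (ENNReal.add_ne_top.2 ⟨hdt, hC₂t⟩), by simp [hmt]⟩)⟩
  intro T φ u₀ u Du tr hsol hφ s t hs hst htT F hF
  have htI : t ∈ Icc 0 T := ⟨(hs.trans hst).le, htT⟩
  have hsI : s ∈ Icc 0 T := ⟨hs.le, hst.le.trans htT⟩
  set νU := (volume.restrict (Ioc s t)).prod (volume.restrict U) with hνU
  have hleU : νU ≤ (volume.restrict (Ioc 0 T)).prod (volume.restrict U) :=
    flux_prod_mono _ hs.le htT
  have hum : AEStronglyMeasurable (fun z : ℝ × E n => u z.1 z.2) νU := hsol.meas_u.mono_measure hleU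
  have hDm : AEStronglyMeasurable (fun z : ℝ × E n => Du z.1 z.2) νU :=
    hsol.meas_Du.mono_measure hleU
  set k : ℝ × E n → ℝ≥0∞ := fun z => ENNReal.ofReal (g.K ‖Du z.1 z.2‖ * ‖Du z.1 z.2‖ ^ 2) with hk
  have hkm : AEMeasurable k νU := ((g.measurable_K.comp_aemeasurable hDm.norm.aemeasurable).mul
      (hDm.norm.aemeasurable.pow_const 2)).ennreal_ofReal
  set Y : ℝ → ℝ≥0∞ := fun τ => ∫⁻ x in U, ENNReal.ofReal (u τ x ^ α) with hY
  set I : ℝ≥0∞ := ∫⁻ τ in Ioc s t, F τ with hI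
  have hYt : ∀ r ∈ Icc 0 T, Y r ≠ ⊤ := fun r hr =>
    (hasFiniteIntegral_iff_ofReal (by
      filter_upwards [hsol.nonneg r hr] with x hx using Real.rpow_nonneg hx _)).1
      (hsol.integrable_rpow hα0 le_rfl hr).2 |>.ne
  have hFY : ∀ τ, 1 + Y τ ≤ F τ := fun τ => by
    rw [hF]
    calc 1 + Y τ = 1 * (1 + Y τ) ^ (1:ℝ) := by rw [ENNReal.rpow_one, one_mul]
      _ ≤ _ := mul_le_mul' le_self_add (ENNReal.rpow_le_rpow_of_exponent_le le_self_add (by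
        have : 0 ≤ θ * p / (n * (1 - θ)) :=
          div_nonneg (by positivity) (mul_nonneg hn0.le (by linarith))
        linarith))
  have hS : ∀ r ∈ Icc 0 T, ∫⁻ x in U, ENNReal.ofReal (storage lam (fun y => |y| ^ e) (u r x))
      = d * Y r := fun r hr => by
    rw [hY, ← lintegral_const_mul' _ _ hdt]
    refine lintegral_congr_ae ?_
    filter_upwards [hsol.nonneg r hr] with x hx
    rw [storage_rpow hlam he hx, ENNReal.ofReal_mul hc0.le, hα]
  -- coercivity of the flux
  have hco : ∀ ρ : ℝ → ℝ, Continuous ρ → (∀ z, ρ z ≤ |z| ^ e) →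
      ∫⁻ z, ENNReal.ofReal (ρ (u z.1 z.2)) * ‖Du z.1 z.2‖ₑ ^ p ∂νU
        ≤ κ * (∫⁻ z, ENNReal.ofReal (ρ (u z.1 z.2)) * k z ∂νU) + κ * ((m + 1) * I) := by
    intro ρ hρ hρe
    have hρm : AEMeasurable (fun z : ℝ × E n => ENNReal.ofReal (ρ (u z.1 z.2))) νU :=
      (hρ.comp_aestronglyMeasurable hum).aemeasurable.ennreal_ofReal
    have h1 : ∫⁻ z, ENNReal.ofReal (ρ (u z.1 z.2)) ∂νU ≤ (m + 1) * I := by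
      rw [hνU, lintegral_prod _ hρm, hI, ← lintegral_const_mul' _ _ (by simp [hmt])]
      refine lintegral_mono_ae ?_
      filter_upwards [ae_restrict_mem measurableSet_Ioc] with τ hτ
      have hτI : τ ∈ Icc 0 T := ⟨(hs.trans hτ.1).le, hτ.2.trans htT⟩
      calc ∫⁻ x in U, ENNReal.ofReal (ρ (u τ x))
          ≤ ∫⁻ x in U, (1 + ENNReal.ofReal (u τ x ^ α)) := by
            refine lintegral_mono_ae ?_
            filter_upwards [hsol.nonneg τ hτI] with x hx
            refine (ENNReal.ofReal_le_ofReal (hρe _)).trans ?_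
            rw [abs_of_nonneg hx]
            exact ofReal_rpow_le_one_add hx he (by linarith)
        _ = m + Y τ := by rw [lintegral_add_left measurable_const]; simp [hm, hY]
        _ ≤ (m + m * Y τ) + (1 + Y τ) := add_le_add le_self_add le_add_self
        _ = (m + 1) * (1 + Y τ) := by ring
        _ ≤ (m + 1) * F τ := mul_le_mul_right (hFY τ) _
    calc ∫⁻ z, ENNReal.ofReal (ρ (u z.1 z.2)) * ‖Du z.1 z.2‖ₑ ^ p ∂νU
        ≤ ∫⁻ z, (κ * (ENNReal.ofReal (ρ (u z.1 z.2)) * k z)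
            + κ * ENNReal.ofReal (ρ (u z.1 z.2))) ∂νU := by
          refine lintegral_mono fun z => ?_
          have h2 : ‖Du z.1 z.2‖ₑ ^ p ≤ κ * (k z + 1) := by
            rw [← ofReal_norm, ENNReal.ofReal_rpow_of_nonneg (norm_nonneg _) hp0.le, hκ, hk,
              ← ENNReal.ofReal_one, ← ENNReal.ofReal_add
                (mul_nonneg (g.K_nonneg _) (sq_nonneg _)) zero_le_one, ← ENNReal.ofReal_mul hCK0.le]
            exact ENNReal.ofReal_le_ofReal (hCK _ (norm_nonneg _))
          refine (mul_le_mul_right h2 _).trans (le_of_eq ?_)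
          ring
      _ = κ * (∫⁻ z, ENNReal.ofReal (ρ (u z.1 z.2)) * k z ∂νU)
            + κ * ∫⁻ z, ENNReal.ofReal (ρ (u z.1 z.2)) ∂νU := by
          have h3 : AEMeasurable (fun z => κ * (ENNReal.ofReal (ρ (u z.1 z.2)) * k z)) νU :=
            (hρm.mul hkm).const_mul _
          rw [lintegral_add_left' h3, lintegral_const_mul' _ _ hκt, lintegral_const_mul' _ _ hκt]
      _ ≤ _ := add_le_add le_rfl (mul_le_mul_right h1 _)
  have htr := hsol.ae_trace_nonneg hCtt hCt
  -- the inequality for `min(|z|, j)^e`, in which half of the dissipation is absorbed, and `j → ∞`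
  have hmain : d * Y t + ∫⁻ z, ENNReal.ofReal (|u z.1 z.2| ^ e) * (k z / 2) ∂νU
      ≤ d * Y s + C₂ * I := by
    by_cases hIt : I = ⊤
    · rw [hIt, ENNReal.mul_top hC₂0, add_top]; exact le_top
    rw [← hS t htI]
    refine energy_le_of_exhaustion (w' := fun z : ℝ × E n => u z.1 z.2)
      (ρj := fun j => truncPow e j) (ρ := fun y => |y| ^ e) hlam
      (fun j => continuous_truncPow he _) (fun z i j hij => truncPow_mono he (Nat.cast_nonneg _)
        (by exact_mod_cast hij) z) (fun R => ?_) (hsol.aesm htI) (hsol.nonneg t htI) hum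
      (hkm.div_const _) fun j => ?_
    · obtain ⟨J, hJ⟩ := exists_nat_ge R
      filter_upwards [eventually_ge_atTop J] with j hj z hz
      have : (J : ℝ) ≤ j := by exact_mod_cast hj
      exact truncPow_eq (hz.trans (hJ.trans this))
    have hj0 : (0:ℝ) ≤ j := Nat.cast_nonneg _
    have hcj := continuous_truncPow he j
    have hE := hsol.energy_lintegral_le hlam hlam1 hα1 htr hφ hs hst htT hcj (truncPow_nonneg hj0)
    set D := ∫⁻ z, ENNReal.ofReal (truncPow e j (u z.1 z.2)) * ‖Du z.1 z.2‖ₑ ^ p ∂νU with hD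
    set X := ∫⁻ z, ENNReal.ofReal (truncPow e j (u z.1 z.2)) * k z ∂νU with hX
    have hρm : AEMeasurable (fun z : ℝ × E n => ENNReal.ofReal (truncPow e j (u z.1 z.2))) νU :=
      (hcj.comp_aestronglyMeasurable hum).aemeasurable.ennreal_ofReal
    have hDmeas : AEMeasurable (fun z : ℝ × E n =>
        ENNReal.ofReal (truncPow e j (u z.1 z.2)) * ‖Du z.1 z.2‖ₑ ^ p) νU :=
      hρm.mul (hDm.enorm.pow_const _)
    have hDt : D ≠ ⊤ := by
      have hDu := (hsol.memLp_Du s hs).mono_measure (flux_prod_mono (volume.restrict U) le_rfl htT)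
      have h1 := hDu.2
      rw [eLpNorm_ofReal_eq hp0] at h1
      have h2 : ∫⁻ z, ‖Du z.1 z.2‖ₑ ^ p ∂νU ≠ ⊤ := by
        intro h3
        have h4 : ∫⁻ z, ‖Function.uncurry Du z‖ₑ ^ p ∂νU = ⊤ := h3
        rw [h4, ENNReal.top_rpow_of_pos (by positivity)] at h1
        exact lt_irrefl _ h1
      have h5 : D ≤ ∫⁻ z, ENNReal.ofReal ((j:ℝ) ^ e) * ‖Du z.1 z.2‖ₑ ^ p ∂νU :=
        lintegral_mono fun z => mul_le_mul_left (ENNReal.ofReal_le_ofReal (truncPow_le he hj0 _)) _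
      rw [lintegral_const_mul' _ _ ENNReal.ofReal_ne_top] at h5
      exact (h5.trans_lt (ENNReal.mul_lt_top ENNReal.ofReal_lt_top h2.lt_top)).ne
    -- the boundary term
    have hB : ∫⁻ τ in Ioc s t, negSup U φ τ
          * ∫⁻ x, ENNReal.ofReal (tr τ x ^ lam * prim (truncPow e j) (tr τ x)) ∂(surfaceMeasure U)
        ≤ (2 * κ)⁻¹ * D + C₁ * I := by
      have hsub : Ioc s t ⊆ Ioc 0 T := Ioc_subset_Ioc hs.le htT
      calc _ ≤ ∫⁻ τ in Ioc s t, ((2 * κ)⁻¹ * (∫⁻ x in U, ENNReal.ofReal (truncPow e j (u τ x))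
              * ‖Du τ x‖ₑ ^ p) + C₁ * F τ) := by
            refine lintegral_mono_ae ?_
            filter_upwards [ae_mono (Measure.restrict_mono hsub le_rfl) hsol.ae_isRegular,
              ae_restrict_mem measurableSet_Ioc,
              ae_mono (Measure.restrict_mono hsub le_rfl) (Measure.ae_ae_of_ae_prod htr)]
              with τ h1 h2 h3
            rw [hF]
            exact hC₁ j hj0 _ _ _ h1 (hsol.nonneg τ ⟨(hs.trans h2.1).le, h2.2.trans htT⟩) h3 _
        _ = _ := by
            rw [lintegral_add_left' (hDmeas.lintegral_prod_right'.const_mul _),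
              lintegral_const_mul' _ _ hηt, lintegral_const_mul' _ _ hC₁t, hD, hνU,
              lintegral_prod _ hDmeas]
    have hSs : ∫⁻ x in U, ENNReal.ofReal (storage lam (truncPow e j) (u s x)) ≤ d * Y s := by
      rw [← hS s hsI]
      refine lintegral_mono_ae ?_
      filter_upwards [hsol.nonneg s hsI] with x hx
      exact ENNReal.ofReal_le_ofReal (storage_le_storage hlam hcj (continuous_abs_rpow he)
        (truncPow_le_abs he hj0) hx)
    have hE2 := hE.trans (add_le_add hSs hB)
    -- finiteness of the dissipation allows it to be cancelled
    have hXt : X ≠ ⊤ := by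
      refine (le_add_self.trans hE2).trans_lt ?_ |>.ne
      exact ENNReal.add_lt_top.2 ⟨ENNReal.mul_lt_top hdt.lt_top (hYt s hsI).lt_top,
        ENNReal.add_lt_top.2 ⟨ENNReal.mul_lt_top hηt.lt_top hDt.lt_top,
          ENNReal.mul_lt_top hC₁t.lt_top (lt_top_iff_ne_top.2 hIt)⟩⟩
    have hDX : (2 * κ)⁻¹ * D ≤ X / 2 + (m + 1) * I := by
      have h1 := hco _ hcj (truncPow_le_abs he hj0)
      have h2 : (2 * κ)⁻¹ * κ = 2⁻¹ := by
        rw [ENNReal.mul_inv (Or.inl (by simp)) (Or.inl (by simp)), mul_assoc,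
          ENNReal.inv_mul_cancel hκ0 hκt, mul_one]
      calc (2 * κ)⁻¹ * D ≤ (2 * κ)⁻¹ * (κ * X + κ * ((m + 1) * I)) := mul_le_mul_right h1 _
        _ = ((2 * κ)⁻¹ * κ) * X + ((2 * κ)⁻¹ * κ) * ((m + 1) * I) := by ring
        _ ≤ X / 2 + 1 * ((m + 1) * I) := by
            rw [h2, mul_comm _ X, ← div_eq_mul_inv]
            exact add_le_add le_rfl (mul_le_mul_left (by simp) _)
        _ = _ := by rw [one_mul]
    have hX2 : ∫⁻ z, ENNReal.ofReal (truncPow e j (u z.1 z.2)) * (k z / 2) ∂νU = X / 2 := by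
      simp_rw [div_eq_mul_inv, ← mul_assoc]
      rw [lintegral_mul_const' _ _ (by simp)]
    rw [hX2]
    refine (ENNReal.add_le_add_iff_right (ENNReal.div_ne_top hXt (by simp : (2:ℝ≥0∞) ≠ 0))).1 ?_
    calc _ = (∫⁻ x in U, ENNReal.ofReal (storage lam (truncPow e j) (u t x))) + X := by
          rw [add_assoc, ENNReal.add_halves]
      _ ≤ d * Y s + ((2 * κ)⁻¹ * D + C₁ * I) := hE2
      _ ≤ d * Y s + ((X / 2 + (m + 1) * I) + C₁ * I) := by gcongr
      _ = d * Y s + C₂ * I + X / 2 := by rw [hC₂]; ring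
  constructor
  · have h1 : d * Y t ≤ d * Y s + C₂ * I := le_self_add.trans hmain
    calc Y t = d⁻¹ * (d * Y t) := by rw [← mul_assoc, ENNReal.inv_mul_cancel hd0 hdt, one_mul]
      _ ≤ d⁻¹ * (d * Y s + C₂ * I) := mul_le_mul_right h1 _
      _ = Y s + d⁻¹ * C₂ * I := by
          rw [mul_add, ← mul_assoc, ENNReal.inv_mul_cancel hd0 hdt, one_mul, mul_assoc]
      _ ≤ _ := add_le_add le_rfl (mul_le_mul_left le_self_add _)
  · have h1 : ∫⁻ z, ENNReal.ofReal (|u z.1 z.2| ^ e) * (k z / 2) ∂νU ≤ d * Y s + C₂ * I :=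
      le_add_self.trans hmain
    have h2 : ∫⁻ z, ENNReal.ofReal (|u z.1 z.2| ^ e) * k z ∂νU ≤ 2 * (d * Y s + C₂ * I) := by
      have h3 : ∫⁻ z, ENNReal.ofReal (|u z.1 z.2| ^ e) * k z ∂νU
          = 2 * ∫⁻ z, ENNReal.ofReal (|u z.1 z.2| ^ e) * (k z / 2) ∂νU := by
        rw [← lintegral_const_mul' _ _ (by simp)]
        refine lintegral_congr fun z => ?_
        rw [mul_left_comm, ENNReal.mul_div_cancel (by simp) (by simp)]
      rw [h3]
      exact mul_le_mul_right h1 _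
    refine (hco _ (continuous_abs_rpow he) fun z => le_rfl).trans ?_
    calc κ * (∫⁻ z, ENNReal.ofReal (|u z.1 z.2| ^ e) * k z ∂νU) + κ * ((m + 1) * I)
        ≤ κ * (2 * (d * Y s + C₂ * I)) + κ * ((m + 1) * I) := by gcongr
      _ ≤ κ * (2 * (d * Y s + C₂ * I)) + κ * ((m + 1) * I)
          + (κ * (2 * (C₂ * Y s + d * I) + (m + 1) * Y s) + d⁻¹ * C₂ * (Y s + I)) := le_self_add
      _ = _ := by ring

end Solution

/-! ### The exponents -/

section ExponentLemmas

variable {n : ℕ} {a lam α : ℝ}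

lemma mu0_pos (ha1 : a < 1) (hsuper : delta lam < a) : 0 < mu0 a lam :=
  div_pos (by linarith) (by linarith)

lemma theta_eq (hn : 0 < n) (ha1 : a < 1) (hsuper : delta lam < a) :
    theta n a lam α
      = n * (a - delta lam) / ((1 - a) * (α * (2 - a) - n * (a - delta lam))) := by
  have hn' : (n:ℝ) ≠ 0 := by positivity
  have h1 : a - delta lam ≠ 0 := by linarith
  have h2 : 2 - a ≠ 0 := by linarith
  rw [theta, alphaStar]
  have h3 : α / (n * (a - delta lam) / (2 - a)) - 1
      = (α * (2 - a) - n * (a - delta lam)) / (n * (a - delta lam)) := by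
    field_simp
  rw [h3, mul_div_assoc', one_div_div]

lemma exponent_gap (ha1 : a < 1) (hαn : n * mu0 a lam < α) :
    n * (a - delta lam) < (1 - a) * α := by
  rw [mu0, mul_div_assoc', div_lt_iff₀ (by linarith)] at hαn
  linarith

lemma theta_denom_pos (ha1 : a < 1) (hsuper : delta lam < a)
    (hαn : n * mu0 a lam < α) : 0 < α * (2 - a) - n * (a - delta lam) := by
  have h1 := exponent_gap ha1 hαn
  have h2 : 0 < α := lt_of_le_of_lt (mul_nonneg (Nat.cast_nonneg _) (mu0_pos ha1 hsuper).le) hαn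
  nlinarith

lemma theta_pos (hn : 0 < n) (ha1 : a < 1) (hsuper : delta lam < a)
    (hαn : n * mu0 a lam < α) : 0 < theta n a lam α := by
  rw [theta_eq hn ha1 hsuper]
  have := theta_denom_pos ha1 hsuper hαn
  have hn' : (0:ℝ) < n := by exact_mod_cast hn
  exact div_pos (mul_pos hn' (by linarith)) (mul_pos (by linarith) this)

lemma theta_lt_one (hn : 0 < n) (ha1 : a < 1) (hsuper : delta lam < a)
    (hαn : n * mu0 a lam < α) : theta n a lam α < 1 := by
  rw [theta_eq hn ha1 hsuper]
  have h1 := theta_denom_pos ha1 hsuper hαn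
  have h2 := exponent_gap ha1 hαn
  rw [div_lt_one (mul_pos (by linarith) h1)]
  nlinarith

/-- The relation by which `θ` is chosen. -/
lemma theta_relation (hn : 0 < n) (ha1 : a < 1) (hsuper : delta lam < a)
    (hαn : n * mu0 a lam < α) :
    n * (a - delta lam) * (1 + theta n a lam α * (1 - a))
      = α * theta n a lam α * (2 - a) * (1 - a) := by
  have h1 := theta_denom_pos ha1 hsuper hαn
  have h2 : 1 - a ≠ 0 := by linarith
  rw [theta_eq hn ha1 hsuper]
  field_simp
  ring

/-- The power `1 + μ₁/α` is the one which Young's inequality with the exponents `1/θ`, `1/(1-θ)`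
produces from `(1 + Y)^{1-θ(1-(2-a)/n)}`. -/
lemma mu1_div (hn : 0 < n) (ha1 : a < 1) (hsuper : delta lam < a)
    (hαn : n * mu0 a lam < α) :
    mu1 n a lam α / α = theta n a lam α * (2 - a) / (n * (1 - theta n a lam α)) := by
  have h := theta_relation hn ha1 hsuper hαn
  have h1 : 1 - theta n a lam α ≠ 0 := by linarith [theta_lt_one hn ha1 hsuper hαn]
  have h2 : 1 - a ≠ 0 := by linarith
  have hα : 0 < α := lt_of_le_of_lt (mul_nonneg (Nat.cast_nonneg _) (mu0_pos ha1 hsuper).le) hαn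
  have hn' : (n:ℝ) ≠ 0 := by positivity
  rw [mu1, mu0]
  field_simp
  linarith

/-- The homogeneity condition of the interpolation, for `e = α - λ - 1`. -/
lemma exponent_identity (hn : 0 < n) (ha1 : a < 1) (hsuper : delta lam < a)
    (hαn : n * mu0 a lam < α) :
    lam * ((2 - a) / (1 - a)) + (α - lam - 1) * (1 - theta n a lam α)
      = α * (1 - theta n a lam α * (1 - (2 - a) / n)) + (2 - a) * theta n a lam α := by
  have h := theta_relation hn ha1 hsuper hαn
  have h2 : 1 - a ≠ 0 := by linarith
  have hn' : (n:ℝ) ≠ 0 := by positivity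
  rw [delta] at h
  field_simp
  linear_combination h

end ExponentLemmas

/-! ### Continuity in time of the norm -/

section Solution

variable {n : ℕ} {U : Set (E n)} {g : GenPoly} {lam α T : ℝ} {φ : ℝ → E n → ℝ} {u₀ : E n → ℝ}
  {u : ℝ → E n → ℝ} {Du : ℝ → E n → E n} {tr : ℝ → E n → ℝ}

lemma IsWeakSolution.continuousOn_integral_rpow
    (hsol : IsWeakSolution U g lam α T φ u₀ u Du tr) (hα : 1 ≤ α) :
    ContinuousOn (fun t => ∫ x in U, u t x ^ α) (Icc 0 T) := by
  have hα0 : 0 < α := by linarith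
  have : Fact (1 ≤ ENNReal.ofReal α) := ⟨by simpa using hα⟩
  have hN : ContinuousOn (fun t => (eLpNorm (u t) (ENNReal.ofReal α) (volume.restrict U)).toReal)
      (Icc 0 T) := by
    intro t ht
    rw [ContinuousWithinAt, tendsto_iff_dist_tendsto_zero]
    have h1 : Tendsto (fun s => (eLpNorm (fun x => u s x - u t x) (ENNReal.ofReal α)
        (volume.restrict U)).toReal) (𝓝[Icc 0 T] t) (𝓝 0) := by
      exact (ENNReal.tendsto_toReal ENNReal.zero_ne_top).comp (hsol.continuousInLp.2 t ht)
    refine squeeze_zero' (Eventually.of_forall fun _ => dist_nonneg) ?_ h1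
    filter_upwards [self_mem_nhdsWithin] with s hs
    have hs' := hsol.continuousInLp.1 s hs
    have ht' := hsol.continuousInLp.1 t ht
    have h2 := abs_norm_sub_norm_le (hs'.toLp (u s)) (ht'.toLp (u t))
    rw [← MemLp.toLp_sub, Lp.norm_toLp, Lp.norm_toLp, Lp.norm_toLp] at h2
    rw [Real.dist_eq]
    exact h2
  refine (hN.rpow_const fun t _ => Or.inr hα0.le).congr fun t ht => ?_
  simp only
  have hnn : 0 ≤ᵐ[volume.restrict U] fun x => u t x ^ α := by
    filter_upwards [hsol.nonneg t ht] with x hx using Real.rpow_nonneg hx _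
  have hm : AEStronglyMeasurable (fun x => u t x ^ α) (volume.restrict U) :=
    (Real.continuous_rpow_const hα0.le).comp_aestronglyMeasurable (hsol.aesm ht)
  rw [integral_eq_lintegral_of_nonneg_ae hnn hm, eLpNorm_ofReal_eq hα0, ENNReal.toReal_rpow,
    ← ENNReal.rpow_mul, one_div_mul_cancel hα0.ne', ENNReal.rpow_one]
  congr 1
  refine lintegral_congr_ae ?_
  filter_upwards [hsol.nonneg t ht] with x hx
  rw [Real.enorm_of_nonneg hx, ENNReal.ofReal_rpow_of_nonneg hx hα0.le]

/-! ### The differential inequality -/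

/-- The weight `1 + ‖φ⁻(τ)‖^q` as a real number. The maximum sets it to `1` at the times at which the
norm is infinite, so that it is at least `1` everywhere. -/
def boundaryWeight (U : Set (E n)) (φ : ℝ → E n → ℝ) (q τ : ℝ) : ℝ :=
  max 1 (1 + negSup U φ τ ^ q).toReal

lemma one_le_boundaryWeight (U : Set (E n)) (φ : ℝ → E n → ℝ) (q τ : ℝ) :
    1 ≤ boundaryWeight U φ q τ := le_max_left _ _

lemma boundaryWeight_nonneg (U : Set (E n)) (φ : ℝ → E n → ℝ) (q τ : ℝ) :
    0 ≤ boundaryWeight U φ q τ := zero_le_one.trans (one_le_boundaryWeight U φ q τ)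

lemma ae_ofReal_boundaryWeight [IsFiniteMeasure (surfaceMeasure U)]
    (hφ : AEStronglyMeasurable (Function.uncurry φ)
      ((volume.restrict (Ioc 0 T)).prod (surfaceMeasure U))) {q : ℝ}
    (hfin : dataIntegral U φ q T ≠ ⊤) :
    ∀ᵐ τ ∂(volume.restrict (Ioc 0 T)),
      ENNReal.ofReal (boundaryWeight U φ q τ) = 1 + negSup U φ τ ^ q := by
  have hm : AEMeasurable (fun τ => 1 + negSup U φ τ ^ q) (volume.restrict (Ioc 0 T)) :=
    ((aemeasurable_negSup hφ).pow_const q).const_add 1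
  filter_upwards [ae_lt_top' hm hfin] with τ hτ
  have h1 : (1:ℝ) ≤ (1 + negSup U φ τ ^ q).toReal := by
    rw [← ENNReal.toReal_one]
    exact ENNReal.toReal_mono hτ.ne le_self_add
  rw [boundaryWeight, max_eq_right h1, ENNReal.ofReal_toReal hτ.ne]

lemma integrableOn_boundaryWeight [IsFiniteMeasure (surfaceMeasure U)]
    (hφ : AEStronglyMeasurable (Function.uncurry φ)
      ((volume.restrict (Ioc 0 T)).prod (surfaceMeasure U))) {q : ℝ}
    (hfin : dataIntegral U φ q T ≠ ⊤) : IntegrableOn (boundaryWeight U φ q) (Ioc 0 T) := by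
  have hm : AEMeasurable (boundaryWeight U φ q) (volume.restrict (Ioc 0 T)) :=
    aemeasurable_const.max (((aemeasurable_negSup hφ).pow_const q).const_add 1).ennreal_toReal
  refine ⟨hm.aestronglyMeasurable, ?_⟩
  rw [hasFiniteIntegral_iff_ofReal (ae_of_all _ fun τ => boundaryWeight_nonneg _ _ _ _),
    lintegral_congr_ae (ae_ofReal_boundaryWeight hφ hfin)]
  exact hfin.lt_top

lemma integral_boundaryWeight [IsFiniteMeasure (surfaceMeasure U)]
    (hφ : AEStronglyMeasurable (Function.uncurry φ)
      ((volume.restrict (Ioc 0 T)).prod (surfaceMeasure U))) {q : ℝ}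
    (hfin : dataIntegral U φ q T ≠ ⊤) {t : ℝ} (ht : t ≤ T) :
    ∫ τ in Ioc 0 t, boundaryWeight U φ q τ = (dataIntegral U φ q t).toReal := by
  have hsub : Ioc 0 t ⊆ Ioc 0 T := Ioc_subset_Ioc le_rfl ht
  rw [integral_eq_lintegral_of_nonneg_ae
    (ae_of_all _ fun τ => boundaryWeight_nonneg _ _ _ _)
    ((integrableOn_boundaryWeight hφ hfin).mono_set hsub).1, dataIntegral]
  congr 1
  exact lintegral_congr_ae (ae_mono (Measure.restrict_mono hsub le_rfl)
    (ae_ofReal_boundaryWeight hφ hfin))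

lemma IsWeakSolution.ofReal_one_add_integral [IsFiniteMeasure (volume.restrict U)]
    (hsol : IsWeakSolution U g lam α T φ u₀ u Du tr) (hα : 0 < α) {t : ℝ} (ht : t ∈ Icc 0 T) :
    1 + ∫⁻ x in U, ENNReal.ofReal (u t x ^ α) = ENNReal.ofReal (1 + ∫ x in U, u t x ^ α) := by
  have hnn : 0 ≤ᵐ[volume.restrict U] fun x => u t x ^ α := by
    filter_upwards [hsol.nonneg t ht] with x hx using Real.rpow_nonneg hx _
  rw [ENNReal.ofReal_add zero_le_one (integral_nonneg_of_ae hnn), ENNReal.ofReal_one,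
    ofReal_integral_eq_lintegral_ofReal (hsol.integrable_rpow hα le_rfl ht) hnn]

/-- The lower integral on the right of the energy inequality is a Bochner integral. -/
lemma IsWeakSolution.lintegral_weight [IsFiniteMeasure (volume.restrict U)]
    [IsFiniteMeasure (surfaceMeasure U)]
    (hsol : IsWeakSolution U g lam α T φ u₀ u Du tr) (hα : 1 ≤ α)
    (hφ : AEStronglyMeasurable (Function.uncurry φ)
      ((volume.restrict (Ioc 0 T)).prod (surfaceMeasure U))) {q m : ℝ}
    (hfin : dataIntegral U φ q T ≠ ⊤) {s t : ℝ} (hs : 0 ≤ s) (ht : t ≤ T) :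
    IntegrableOn (fun τ => boundaryWeight U φ q τ * (1 + ∫ x in U, u τ x ^ α) ^ m) (Ioc s t) ∧
    ∫⁻ τ in Ioc s t, (1 + negSup U φ τ ^ q) * (1 + ∫⁻ x in U, ENNReal.ofReal (u τ x ^ α)) ^ m
      = ENNReal.ofReal
        (∫ τ in Ioc s t, boundaryWeight U φ q τ * (1 + ∫ x in U, u τ x ^ α) ^ m) := by
  have hsub : Ioc s t ⊆ Ioc 0 T := Ioc_subset_Ioc hs ht
  have hZ0 : ∀ τ ∈ Icc 0 T, 0 < 1 + ∫ x in U, u τ x ^ α := fun τ hτ => by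
    have : 0 ≤ ∫ x in U, u τ x ^ α := integral_nonneg_of_ae (by
      filter_upwards [hsol.nonneg τ hτ] with x hx using Real.rpow_nonneg hx _)
    linarith
  have hcont : ContinuousOn (fun τ => (1 + ∫ x in U, u τ x ^ α) ^ m) (Icc 0 T) :=
    (continuousOn_const.add (hsol.continuousOn_integral_rpow hα)).rpow_const
      fun τ hτ => Or.inl (hZ0 τ hτ).ne'
  have hψ := (integrableOn_Icc_iff_integrableOn_Ioc (μ := volume)).2
    (integrableOn_boundaryWeight hφ hfin)
  have hint : IntegrableOn (fun τ => boundaryWeight U φ q τ * (1 + ∫ x in U, u τ x ^ α) ^ m)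
      (Ioc s t) :=
    (hψ.mul_continuousOn hcont isCompact_Icc).mono_set (hsub.trans Ioc_subset_Icc_self)
  refine ⟨hint, ?_⟩
  rw [ofReal_integral_eq_lintegral_ofReal hint]
  · refine lintegral_congr_ae ?_
    filter_upwards [ae_mono (Measure.restrict_mono hsub le_rfl) (ae_ofReal_boundaryWeight hφ hfin),
      ae_restrict_mem measurableSet_Ioc] with τ h1 h2
    have h3 : τ ∈ Icc 0 T := Ioc_subset_Icc_self (hsub h2)
    rw [hsol.ofReal_one_add_integral (by linarith) h3, ENNReal.ofReal_rpow_of_pos (hZ0 τ h3), ← h1,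
      ENNReal.ofReal_mul (boundaryWeight_nonneg _ _ _ _)]
  · filter_upwards [ae_restrict_mem measurableSet_Ioc] with τ h2
    exact mul_nonneg (boundaryWeight_nonneg _ _ _ _)
      (Real.rpow_nonneg (hZ0 τ (Ioc_subset_Icc_self (hsub h2))).le _)

end Solution

/-! ### Growth and dissipation bounds -/

section Solution

variable {n : ℕ} {U : Set (E n)} {g : GenPoly} {lam α T : ℝ} {φ : ℝ → E n → ℝ} {u₀ : E n → ℝ}
  {u : ℝ → E n → ℝ} {Du : ℝ → E n → E n} {tr : ℝ → E n → ℝ}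

/-- The growth of `∫ u^α`: Bihari's inequality, applied to `1 + ∫ u^α`. -/
lemma IsWeakSolution.rpow_neg_le [IsFiniteMeasure (volume.restrict U)]
    [IsFiniteMeasure (surfaceMeasure U)]
    (hsol : IsWeakSolution U g lam α T φ u₀ u Du tr) (hα : 1 ≤ α)
    (hφ : AEStronglyMeasurable (Function.uncurry φ)
      ((volume.restrict (Ioc 0 T)).prod (surfaceMeasure U))) {q m c : ℝ} (hm : 0 < m) (hc : 0 < c)
    (hfin : dataIntegral U φ q T ≠ ⊤)
    (hineq : ∀ s t : ℝ, 0 < s → s < t → t ≤ T →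
      ∫⁻ x in U, ENNReal.ofReal (u t x ^ α) ≤ (∫⁻ x in U, ENNReal.ofReal (u s x ^ α))
        + ENNReal.ofReal c * ∫⁻ τ in Ioc s t, (1 + negSup U φ τ ^ q)
          * (1 + ∫⁻ x in U, ENNReal.ofReal (u τ x ^ α)) ^ (1 + m))
    {t : ℝ} (ht : t ∈ Icc 0 T) :
    (1 + ∫ x in U, u 0 x ^ α) ^ (-m) - c * m * (dataIntegral U φ q t).toReal
      ≤ (1 + ∫ x in U, u t x ^ α) ^ (-m) := by
  set Z : ℝ → ℝ := fun t => 1 + ∫ x in U, u t x ^ α with hZ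
  have hZ0 : ∀ τ ∈ Icc 0 T, 0 < Z τ := fun τ hτ => by
    have : 0 ≤ ∫ x in U, u τ x ^ α := integral_nonneg_of_ae (by
      filter_upwards [hsol.nonneg τ hτ] with x hx using Real.rpow_nonneg hx _)
    rw [hZ]
    simp only
    linarith
  have hZc : ContinuousOn Z (Icc 0 T) := continuousOn_const.add (hsol.continuousOn_integral_rpow hα)
  set ψ := boundaryWeight U φ q with hψ
  have hpos : ∀ s t : ℝ, 0 < s → s < t → t ≤ T →
      Z t ≤ Z s + c * ∫ τ in Ioc s t, ψ τ * Z τ ^ (1 + m) := by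
    intro s t hs hst htT
    have hsI : s ∈ Icc 0 T := ⟨hs.le, hst.le.trans htT⟩
    have htI : t ∈ Icc 0 T := ⟨(hs.trans hst).le, htT⟩
    have h1 := add_le_add (le_refl (1:ℝ≥0∞)) (hineq s t hs hst htT)
    have hnn : 0 ≤ ∫ τ in Ioc s t, ψ τ * Z τ ^ (1 + m) :=
      setIntegral_nonneg measurableSet_Ioc fun τ hτ => mul_nonneg (boundaryWeight_nonneg _ _ _ _)
        (Real.rpow_nonneg (hZ0 τ ⟨(hs.trans hτ.1).le, hτ.2.trans htT⟩).le _)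
    rw [(hsol.lintegral_weight hα hφ hfin hs.le htT).2, ← add_assoc,
      hsol.ofReal_one_add_integral (by linarith) htI, hsol.ofReal_one_add_integral (by linarith) hsI,
      ← ENNReal.ofReal_mul hc.le, ← ENNReal.ofReal_add (hZ0 s hsI).le (mul_nonneg hc.le hnn)] at h1
    exact (ENNReal.ofReal_le_ofReal_iff (add_nonneg (hZ0 s hsI).le (mul_nonneg hc.le hnn))).1 h1
  -- the case `s = 0`, by continuity
  have hall : ∀ s t : ℝ, 0 ≤ s → s < t → t ≤ T →
      Z t - Z s ≤ c * ∫ τ in Ioc s t, ψ τ * Z τ ^ (1 + m) := by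
    intro s t hs hst htT
    have hlim : Tendsto (fun r => Z r + c * ∫ τ in Ioc s t, ψ τ * Z τ ^ (1 + m)) (𝓝[Ioo s t] s)
        (𝓝 (Z s + c * ∫ τ in Ioc s t, ψ τ * Z τ ^ (1 + m))) := by
      refine Tendsto.add_const _ ?_
      exact (hZc s ⟨hs, hst.le.trans htT⟩).mono_left
        (nhdsWithin_mono _ fun r hr => ⟨hs.trans hr.1.le, hr.2.le.trans htT⟩)
    have : (𝓝[Ioo s t] s).NeBot := by
      rw [nhdsWithin_Ioo_eq_nhdsGT hst]; infer_instance
    have h := ge_of_tendsto hlim (b := Z t) (by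
      filter_upwards [self_mem_nhdsWithin] with r hr
      refine (hpos r t (hs.trans_lt hr.1) hr.2 htT).trans (add_le_add le_rfl
        (mul_le_mul_of_nonneg_left ?_ hc.le))
      refine setIntegral_mono_set (hsol.lintegral_weight hα hφ hfin hs htT).1 ?_
        (Eventually.of_forall (Ioc_subset_Ioc hr.1.le le_rfl))
      filter_upwards [ae_restrict_mem measurableSet_Ioc] with τ hτ
      exact mul_nonneg (boundaryWeight_nonneg _ _ _ _)
        (Real.rpow_nonneg (hZ0 τ ⟨hs.trans hτ.1.le, hτ.2.trans htT⟩).le _))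
    linarith
  have hB := bihari hc hm hZc hZ0 (integrableOn_boundaryWeight hφ hfin)
    (one_le_boundaryWeight U φ q) hall t ht
  rwa [integral_boundaryWeight hφ hfin ht.2] at hB

/-- The dissipation on `(0, T)`, from bounds on the intervals `(s, T)`. -/
lemma IsWeakSolution.dissipation_le [IsFiniteMeasure (volume.restrict U)]
    (hsol : IsWeakSolution U g lam α T φ u₀ u Du tr) {e p : ℝ} (he : 0 ≤ e) (hp : 0 ≤ p) {R : ℝ≥0∞}
    (h : ∀ s, 0 < s → s < T → ∫⁻ z, ENNReal.ofReal (|u z.1 z.2| ^ e) * ‖Du z.1 z.2‖ₑ ^ p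
      ∂((volume.restrict (Ioc s T)).prod (volume.restrict U)) ≤ R) :
    ∫⁻ t in Ioc 0 T, ∫⁻ x in U, ENNReal.ofReal (u t x ^ e * ‖Du t x‖ ^ p) ≤ R := by
  have hU : Ioc 0 T = ⋃ k : ℕ, Ioc (1 / ((k:ℝ) + 1)) T := by
    refine Subset.antisymm (fun t ht => ?_) (iUnion_subset fun k =>
      Ioc_subset_Ioc (by positivity) le_rfl)
    obtain ⟨k, hk⟩ := exists_nat_one_div_lt ht.1
    exact mem_iUnion.2 ⟨k, hk, ht.2⟩
  have hdir : Directed (· ⊆ ·) fun k : ℕ => Ioc (1 / ((k:ℝ) + 1)) T := by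
    refine directed_of_isDirected_le fun i j hij => Ioc_subset_Ioc ?_ le_rfl
    exact Nat.one_div_le_one_div hij
  rw [hU, setLIntegral_iUnion_of_directed _ hdir]
  refine iSup_le fun k => ?_
  have hk : (0:ℝ) < 1 / ((k:ℝ) + 1) := by positivity
  rcases le_or_gt T (1 / ((k:ℝ) + 1)) with hT | hT
  · rw [Ioc_eq_empty (not_lt.2 hT), Measure.restrict_empty, lintegral_zero_measure]
    exact zero_le
  have hle := flux_prod_mono (volume.restrict U) hk.le (le_refl T)
  have hum : AEStronglyMeasurable (fun z : ℝ × E n => u z.1 z.2)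
      ((volume.restrict (Ioc (1 / ((k:ℝ) + 1)) T)).prod (volume.restrict U)) :=
    hsol.meas_u.mono_measure hle
  have hDm : AEStronglyMeasurable (fun z : ℝ × E n => Du z.1 z.2)
      ((volume.restrict (Ioc (1 / ((k:ℝ) + 1)) T)).prod (volume.restrict U)) :=
    hsol.meas_Du.mono_measure hle
  refine le_trans (le_of_eq ?_) (h _ hk hT)
  have hm : AEMeasurable (fun z : ℝ × E n => ENNReal.ofReal (|u z.1 z.2| ^ e) * ‖Du z.1 z.2‖ₑ ^ p)
      ((volume.restrict (Ioc (1 / ((k:ℝ) + 1)) T)).prod (volume.restrict U)) :=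
    (((continuous_abs_rpow he).comp_aestronglyMeasurable hum).aemeasurable.ennreal_ofReal).mul
      (hDm.enorm.pow_const _)
  rw [lintegral_prod _ hm]
  refine lintegral_congr_ae ?_
  filter_upwards [ae_restrict_mem measurableSet_Ioc] with τ hτ
  refine lintegral_congr_ae ?_
  filter_upwards [hsol.nonneg τ ⟨(hk.trans hτ.1).le, hτ.2⟩] with x hx
  rw [abs_of_nonneg hx, ENNReal.ofReal_mul (Real.rpow_nonneg hx _),
    ← ENNReal.ofReal_rpow_of_nonneg (norm_nonneg _) hp, ofReal_norm]

end Solution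

end Forchheimer

end

open Forchheimer in
theorem theorem3p3 (n : ℕ) (hn : 2 ≤ n) (U : Set (E n)) (hUo : IsOpen U)
    (hUb : Bornology.IsBounded U) (hUC : HasC1Boundary U) (g : GenPoly)
    (lam : ℝ) (hlam0 : 0 < lam) (hlam1 : lam ≤ 1) (hsuper : delta lam < g.a)
    (α : ℝ) (hα : 2 - delta lam ≤ α) (hαn : n * mu0 g.a lam < α) :
    ∃ C₂ C₃ C : ℝ, 0 < C₂ ∧ C₃ = C₂ * mu1 n g.a lam α / α ∧ 0 < C₃ ∧ 0 < C ∧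
      ∀ (T : ℝ) (φ : ℝ → E n → ℝ) (u₀ : E n → ℝ)
        (u : ℝ → E n → ℝ) (Du : ℝ → E n → E n) (tr : ℝ → E n → ℝ), 0 < T →
        AEStronglyMeasurable (Function.uncurry φ)
          ((volume.restrict (Ioc 0 T)).prod (surfaceMeasure U)) →
        IsWeakSolution U g lam α T φ u₀ u Du tr →
        (dataIntegral U φ (phiExp n g.a lam α) T
            < ENNReal.ofReal (1 / C₃ * (1 + ∫ x in U, u₀ x ^ α) ^ (-(mu1 n g.a lam α / α))) →
          ∀ t ∈ Ioc 0 T,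
            ∫ x in U, u t x ^ α
              ≤ ((1 + ∫ x in U, u₀ x ^ α) ^ (-(mu1 n g.a lam α / α))
                  - C₃ * (dataIntegral U φ (phiExp n g.a lam α) t).toReal)
                    ^ (-(α / mu1 n g.a lam α))) ∧
        (dataIntegral U φ (phiExp n g.a lam α) T
            ≤ ENNReal.ofReal ((1 - 2 ^ (-(mu1 n g.a lam α / α))) / C₃
                * (1 + ∫ x in U, u₀ x ^ α) ^ (-(mu1 n g.a lam α / α))) →
          (∀ t ∈ Ioc 0 T, ∫ x in U, u t x ^ α ≤ 2 * (1 + ∫ x in U, u₀ x ^ α)) ∧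
          ∫⁻ t in Ioc 0 T, ∫⁻ x in U,
              ENNReal.ofReal (u t x ^ (α + delta lam - 2) * ‖Du t x‖ ^ (2 - g.a))
            ≤ ENNReal.ofReal (C * (1 + ∫ x in U, u₀ x ^ α))) := by
  have hfinU : IsFiniteMeasure (volume.restrict U) :=
    isFiniteMeasure_restrict.2 hUb.measure_lt_top.ne
  have hfinΓ : IsFiniteMeasure (surfaceMeasure U) := isFiniteMeasure_surfaceMeasure hUo hUb hUC
  have ha0 := g.a_pos
  have ha1 := g.a_lt_one
  have hn0 : 0 < n := by omega
  have hn2 : (2:ℝ) ≤ n := by exact_mod_cast hn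
  have hδ : delta lam = 1 - lam := rfl
  have hα1 : 1 ≤ α := by linarith
  have hpn : 2 - g.a < n := by linarith
  obtain ⟨Cs, hCst, hCs⟩ := exists_sobolev_rpow hUo hUb hUC (p := 2 - g.a) (by linarith) hpn
  obtain ⟨Ct, hCtt, hCt⟩ := exists_trace hUo hUb hUC
  have hθ0 := theta_pos hn0 ha1 hsuper hαn
  have hθ1 := theta_lt_one hn0 ha1 hsuper hαn
  have hid := exponent_identity hn0 ha1 hsuper hαn
  obtain ⟨C, hCtop, hC⟩ := exists_power_energy_le (U := U) (g := g) (e := α - lam - 1) (α := α)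
    hpn hlam0 hlam1 (by linarith) (by ring) (by linarith) hθ0 hθ1 hid hCst hCs hCtt hCt
  have hmdef := mu1_div hn0 ha1 hsuper hαn
  have hqdef : phiExp n g.a lam α = (2 - g.a) / (1 - g.a) / (1 - theta n g.a lam α) := by
    rw [phiExp, div_div]
  set q := phiExp n g.a lam α with hq
  have hm0 : 0 < mu1 n g.a lam α / α := by
    rw [hmdef]
    exact div_pos (mul_pos hθ0 (by linarith)) (mul_pos (by linarith) (by linarith))
  have hminv : α / mu1 n g.a lam α = (mu1 n g.a lam α / α)⁻¹ := (inv_div _ _).symm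
  rw [hminv]
  set m := mu1 n g.a lam α / α with hm
  rw [← hqdef, ← hmdef] at hC
  set c : ℝ := C.toReal + 1 with hc
  have hc0 : 0 < c := by positivity
  have hCc : C ≤ ENNReal.ofReal c :=
    (ENNReal.le_ofReal_iff_toReal_le hCtop hc0.le).2 (by linarith)
  have hcm : 0 < c * m := mul_pos hc0 hm0
  refine ⟨c, c * m, c * (2 + 2 ^ (1 + m) / (c * m)), hc0, by rw [hm, mul_div_assoc], hcm,
    by positivity, ?_⟩
  intro T φ u₀ u Du tr hT hφ hsol
  have hinit : ∫ x in U, u₀ x ^ α = ∫ x in U, u 0 x ^ α := by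
    refine integral_congr_ae ?_
    filter_upwards [hsol.initial] with x hx
    rw [hx]
  rw [hinit]
  have hY0 : ∀ τ ∈ Icc 0 T, 0 ≤ ∫ x in U, u τ x ^ α := fun τ hτ => integral_nonneg_of_ae (by
    filter_upwards [hsol.nonneg τ hτ] with x hx using Real.rpow_nonneg hx _)
  have h0I : (0:ℝ) ∈ Icc 0 T := ⟨le_rfl, hT.le⟩
  set Z₀ := 1 + ∫ x in U, u 0 x ^ α with hZ₀
  have hZ₀1 : 1 ≤ Z₀ := by linarith [hY0 0 h0I]
  have hZ₀0 : 0 < Z₀ := by linarith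
  have hZm : 0 < Z₀ ^ (-m) := Real.rpow_pos_of_pos hZ₀0 _
  have hE := fun s t hs hst htT => hC T φ u₀ u Du tr hsol hφ s t hs hst htT _ fun τ => rfl
  have hgrow : dataIntegral U φ q T ≠ ⊤ → ∀ t ∈ Icc 0 T,
      Z₀ ^ (-m) - c * m * (dataIntegral U φ q t).toReal ≤ (1 + ∫ x in U, u t x ^ α) ^ (-m) :=
    fun hfin t ht => hsol.rpow_neg_le hα1 hφ hm0 hc0 hfin (fun s t hs hst htT =>
      (hE s t hs hst htT).1.trans (add_le_add le_rfl (mul_le_mul_left hCc _))) ht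
  have hmono : dataIntegral U φ q T ≠ ⊤ → ∀ t ∈ Icc 0 T,
      (dataIntegral U φ q t).toReal ≤ (dataIntegral U φ q T).toReal := fun hfin t ht =>
    ENNReal.toReal_mono hfin (lintegral_mono_set (Ioc_subset_Ioc le_rfl ht.2))
  -- a positive lower bound `B` of `Z^{-m}` gives the upper bound `B^{-1/m}` of `Z`
  have hinv : ∀ B Z : ℝ, 0 < B → 0 < Z → B ≤ Z ^ (-m) → Z ≤ B ^ (-m⁻¹) := by
    intro B Z hB hZ h
    have h1 := Real.rpow_le_rpow_of_nonpos hB h (by simpa using hm0.le : -m⁻¹ ≤ 0)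
    rwa [← Real.rpow_mul hZ.le, neg_mul_neg, mul_inv_cancel₀ hm0.ne', Real.rpow_one] at h1
  refine ⟨fun hdata t ht => ?_, fun hdata => ?_⟩
  · have hfin : dataIntegral U φ q T ≠ ⊤ := hdata.ne_top
    have htI : t ∈ Icc 0 T := Ioc_subset_Icc_self ht
    have h1 := (ENNReal.lt_ofReal_iff_toReal_lt hfin).1 hdata
    have h2 : c * m * (dataIntegral U φ q t).toReal < Z₀ ^ (-m) := by
      have h3 := (hmono hfin t htI).trans_lt h1
      rw [one_div, inv_mul_eq_div, lt_div_iff₀ hcm] at h3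
      linarith
    have h3 := hinv _ _ (sub_pos.2 h2) (by linarith [hY0 t htI]) (hgrow hfin t htI)
    linarith
  · have hfin : dataIntegral U φ q T ≠ ⊤ := (hdata.trans_lt ENNReal.ofReal_lt_top).ne
    have h2m : (2:ℝ) ^ (-m) < 1 := Real.rpow_lt_one_of_one_lt_of_neg one_lt_two (by linarith)
    have h1 : (dataIntegral U φ q T).toReal ≤ (1 - 2 ^ (-m)) / (c * m) * Z₀ ^ (-m) :=
      ENNReal.toReal_le_of_le_ofReal
        (mul_nonneg (div_nonneg (by linarith) hcm.le) hZm.le) hdata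
    have hle : ∀ t ∈ Icc 0 T, 1 + ∫ x in U, u t x ^ α ≤ 2 * Z₀ := by
      intro t ht
      have h3 : (2 * Z₀) ^ (-m) ≤ (1 + ∫ x in U, u t x ^ α) ^ (-m) := by
        refine le_trans ?_ (hgrow hfin t ht)
        have h4 := (hmono hfin t ht).trans h1
        rw [div_mul_eq_mul_div, le_div_iff₀ hcm] at h4
        rw [Real.mul_rpow zero_le_two hZ₀0.le]
        linarith
      have h5 := hinv _ _ (Real.rpow_pos_of_pos (by linarith) _) (by linarith [hY0 t ht]) h3
      rwa [← Real.rpow_mul (by linarith), neg_mul_neg, mul_inv_cancel₀ hm0.ne', Real.rpow_one] at h5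
    refine ⟨fun t ht => by linarith [hle t (Ioc_subset_Icc_self ht)], ?_⟩
    have he : α + delta lam - 2 = α - lam - 1 := by rw [hδ]; ring
    rw [he]
    refine hsol.dissipation_le (by linarith) (by linarith) fun s hs hsT => ?_
    have hsI : s ∈ Icc 0 T := ⟨hs.le, hsT.le⟩
    refine (hE s T hs hsT le_rfl).2.trans ?_
    have hYs : ∫⁻ x in U, ENNReal.ofReal (u s x ^ α) ≤ ENNReal.ofReal (2 * Z₀) := by
      refine le_trans le_add_self ((hsol.ofReal_one_add_integral (by linarith) hsI).trans_le ?_)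
      exact ENNReal.ofReal_le_ofReal (hle s hsI)
    have hF : ∫⁻ τ in Ioc s T, (1 + negSup U φ τ ^ q)
          * (1 + ∫⁻ x in U, ENNReal.ofReal (u τ x ^ α)) ^ (1 + m)
        ≤ ENNReal.ofReal (2 ^ (1 + m) / (c * m) * Z₀) := by
      calc _ ≤ ∫⁻ τ in Ioc s T, (1 + negSup U φ τ ^ q) * ENNReal.ofReal ((2 * Z₀) ^ (1 + m)) := by
            refine lintegral_mono_ae ?_
            filter_upwards [ae_restrict_mem measurableSet_Ioc] with τ hτ
            have hτI : τ ∈ Icc 0 T := ⟨(hs.trans hτ.1).le, hτ.2⟩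
            refine mul_le_mul_right ?_ _
            rw [hsol.ofReal_one_add_integral (by linarith) hτI,
              ENNReal.ofReal_rpow_of_nonneg (by linarith [hY0 τ hτI]) (by linarith)]
            exact ENNReal.ofReal_le_ofReal (Real.rpow_le_rpow (by linarith [hY0 τ hτI])
              (hle τ hτI) (by linarith))
        _ = (∫⁻ τ in Ioc s T, (1 + negSup U φ τ ^ q)) * ENNReal.ofReal ((2 * Z₀) ^ (1 + m)) :=
            lintegral_mul_const' _ _ ENNReal.ofReal_ne_top
        _ ≤ dataIntegral U φ q T * ENNReal.ofReal ((2 * Z₀) ^ (1 + m)) :=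
            mul_le_mul_left (lintegral_mono_set (Ioc_subset_Ioc hs.le le_rfl)) _
        _ ≤ ENNReal.ofReal (Z₀ ^ (-m) / (c * m)) * ENNReal.ofReal ((2 * Z₀) ^ (1 + m)) := by
            refine mul_le_mul_left (hdata.trans (ENNReal.ofReal_le_ofReal ?_)) _
            rw [div_mul_eq_mul_div]
            refine div_le_div_of_nonneg_right ?_ hcm.le
            have : 0 < (2:ℝ) ^ (-m) := by positivity
            nlinarith
        _ = _ := by
            rw [← ENNReal.ofReal_mul (by positivity), Real.mul_rpow zero_le_two hZ₀0.le]
            congr 1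
            have h6 : Z₀ ^ (-m) * Z₀ ^ (1 + m) = Z₀ := by
              rw [← Real.rpow_add hZ₀0]; simp
            calc Z₀ ^ (-m) / (c * m) * (2 ^ (1 + m) * Z₀ ^ (1 + m))
                = 2 ^ (1 + m) / (c * m) * (Z₀ ^ (-m) * Z₀ ^ (1 + m)) := by ring
              _ = _ := by rw [h6]
    refine (mul_le_mul' hCc (add_le_add hYs hF)).trans (le_of_eq ?_)
    rw [← ENNReal.ofReal_add (by positivity) (by positivity), ← ENNReal.ofReal_mul hc0.le]
    congr 1
    ring
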